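/- **Notation.** All functions and measures live on $\mathbb R$; subscripts $\xi,x,t$ denote derivatives. $W^{1,1}_{\rm loc}$ functions are identified with their (locally absolutely continuous) continuous representatives, and $W^{1,1}_{\rm per},W^{1,\infty}_{\rm per},H^1_{\rm per},L^1_{\rm per}$ are the corresponding spaces of $1$-periodic functions. *Lagrangian variables.* Let $V$ be the set of $f\in W^{1,1}_{\rm loc}(\mathbb R)$ such that for some $\alpha\in\mathbb R$, $f(\xi+1)=f(\xi)+\alpha$ for all $\xi$, and $V_1\subset V$ the subset with $\alpha=1$. Put $\|f\|_V=\|f\|_{L^\infty([0,1])}+\|f_\xi\|_{L^1([0,1])}$ and $E=V\times W^{1,1}_{\rm per}\times L^1_{\rm per}$ with norm $\|(y,U,\nu)\|_E=\|y\|_V+\|U\|_V+\|\nu\|_{L^1([0,1])}$. Let $\mathcal F$ be the set of $X=(y,U,\nu)\in E$ with $y\in V_1$, $y,U\in W^{1,\infty}_{\rm loc}$, $\nu\in L^\infty$, and, almost everywhere, $y_\xi\ge0$, $\nu\ge0$, $y_\xi+\nu\ge c$ for some constant $c>0$, and $y_\xi\nu=y_\xi^2U^2+U_\xi^2$. Write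 $h=\|\nu\|_{L^1([0,1])}$ and set $$\mathcal F_0=\{X\in\mathcal F: y_\xi+\nu=1+h \text{ a.e.}\},\quad \mathcal H=\{X\in\mathcal F_0:\textstyle\int_0^1y\,d\xi=0\},\quad \mathcal H^M=\{X\in\mathcal H: h\le M\}.$$ Let $S_t(X_0)=X(t)$, where $X=(y,U,\nu)\in C^1([0,\infty),E)$ is the solution with $X(0)=X_0\in\mathcal F$ of $$y_t=U,\qquad U_t=-Q,\qquad \nu_t=-2QUy_\xi+(3U^2-2P)U_\xi,$$ $$Q(\xi)=-\tfrac14\int_{\mathbb R}\operatorname{sign}(\xi-\eta)\,e^{-\operatorname{sign}(\xi-\eta)(y(\xi)-y(\eta))}(U^2y_\xi+\nu)(\eta)\,d\eta,$$ $$P(\xi)=\tfrac14\int_{\mathbb R}e^{-\operatorname{sign}(\xi-\eta)(y(\xi)-y(\eta))}(U^2y_\xi+\nu)(\eta)\,d\eta.$$ *Relabeling.* Let $G$ be the group of bijections $f\in W^{1,\infty}_{\rm loc}(\mathbb R)$ with $f(\xi+1)=f(\xi)+1$ for all $\xi$ and $f-\mathrm{id},\,f^{-1}-\mathrm{id}\in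 W^{1,\infty}_{\rm per}$, acting by $X\bullet f=(y\circ f,\,U\circ f,\,(\nu\circ f)f_\xi)$. For $X\in\mathcal F$ let $\Pi_1(X)=X\bullet f^{-1}\in\mathcal F_0$ with $f(\xi)=\frac1{1+h}\big(y(\xi)+\int_0^\xi\nu\,d\eta\big)$; for $X\in\mathcal F_0$ let $\Pi_2(X)=X(\cdot-a)\in\mathcal H$ with $a=\int_0^1y\,d\xi$. Put $\Pi=\Pi_2\circ\Pi_1$ and $\bar S_t=\Pi\circ S_t$. *Distances.* Let $J(X,Y)=\inf_{f,g\in G}\|X\bullet f-Y\bullet g\|_E$. Let $d(X,Y)$ be the infimum of $\sum_{n=1}^NJ(X_{n-1},X_n)$ over all finite sequences in $\mathcal F$ with $X_0=X$ and $X_N=Y$, and let $d_M$ be the same infimum over sequences in $\mathcal H^M$. *Eulerian variables.* Let $\mathcal D$ be the set of pairs $(u,\mu)$ where $u\in H^1_{\rm per}$ and $\mu$ is a positive $1$-periodic Radon measure on $\mathbb R$ with absolutely continuous part $\mu_{\rm ac}=(u^2+u_x^2)\,dx$, and $\mathcal D^M=\{(u,\mu)\in\mathcal D:\mu([0,1))\le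 M\}$. For $(u,\mu)\in\mathcal D$ put $h=\mu([0,1))$; $F_\mu(x)=\mu([0,x))$ for $x>0$, $F_\mu(0)=0$, $F_\mu(x)=-\mu([x,0))$ for $x<0$; $y(\xi)=\sup\{x: F_\mu(x)+x<(1+h)\xi\}$; and $L(u,\mu)=\Pi\big(y,\,u\circ y,\,(1+h)-y_\xi\big)$. For $X\in\mathcal F$ let $M(X)=(u,\mu)$ with $u(x)=U(\xi)$ for any $\xi$ such that $y(\xi)=x$, and $\mu=y_\#(\nu\,d\xi)$. Finally let $$T_t=M\bar S_tL,\quad d_{\mathcal D}(p,q)=d(L(p),L(q)),\quad d_{\mathcal D^M}(p,q)=d_M(L(p),L(q)).$$ **Theorem.** These maps are well defined: for every $X_0\in\mathcal F$ the system has a unique solution in $C^1([0,\infty),E)$ with $X(0)=X_0$, and it stays in $\mathcal F$; $L$ maps $\mathcal D$ into $\mathcal H$; and $M$ maps $\mathcal F$ into $\mathcal D$ (the value $u(x)$ being independent of the choice of $\xi$). Moreover: 1. For $t\ge 0$ the maps $T_t:\mathcal D\to\mathcal D$ form a semigroup, that is, $T_0=\mathrm{id}$ and $T_{s+t}=T_sT_t$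 for $s,t\ge0$; $d_{\mathcal D}$ is a metric on $\mathcal D$; and the semigroup is continuous with respect to $d_{\mathcal D}$, in the sense that $(t,p)\mapsto T_t(p)$ is continuous from $[0,\infty)\times\mathcal D$ to $\mathcal D$. 2. For every $M>0$, $d_{\mathcal D^M}$ is a metric on $\mathcal D^M$, $T_t$ maps $\mathcal D^M$ into itself for every $t\ge0$, and for every $T>0$ there is a constant $C$ depending only on $M$ and $T$ such that $$d_{\mathcal D^M}\big(T_t(u,\mu),T_t(\tilde u,\tilde\mu)\big)\le C\,d_{\mathcal D^M}\big((u,\mu),(\tilde u,\tilde\mu)\big)\qquad\text{for all }(u,\mu),(\tilde u,\tilde\mu)\in\mathcal D^M,\ t\in[0,T].$$ -/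

import Mathlib

open Set Filter Topology MeasureTheory

namespace PeriodicCH

noncomputable section

/-! ## Function spaces

Sobolev functions are represented by their continuous representatives, so that the weak
derivative is the almost everywhere defined classical derivative `deriv f`. -/

/-- `W^{1,1}_loc(ℝ)`: the locally absolutely continuous functions. -/
def W11loc (f : ℝ → ℝ) : Prop := ∀ a b : ℝ, AbsolutelyContinuousOnInterval f a b

/-- `V₁`: functions in `W^{1,1}_loc` with `f (ξ + 1) = f ξ + 1`. -/
def MemV1 (f : ℝ → ℝ) : Prop := W11loc f ∧ ∀ ξ, f (ξ + 1) = f ξ + 1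

/-- `V`: functions in `W^{1,1}_loc` with `f (ξ + 1) = f ξ + α` for some constant `α`. -/
def MemV (f : ℝ → ℝ) : Prop := W11loc f ∧ ∃ α : ℝ, ∀ ξ, f (ξ + 1) = f ξ + α

/-- `W^{1,1}_per`. -/
def MemW11per (f : ℝ → ℝ) : Prop := W11loc f ∧ Function.Periodic f 1

/-- `W^{1,∞}_per`: the periodic Lipschitz functions. -/
def MemW1infPer (f : ℝ → ℝ) : Prop := (∃ K, LipschitzWith K f) ∧ Function.Periodic f 1

/-- `L¹_per`; elements are functions that matter only up to null sets. -/
def MemL1per (f : ℝ → ℝ) : Prop :=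
  LocallyIntegrable f volume ∧ ∀ᵐ ξ : ℝ, f (ξ + 1) = f ξ

/-- `H¹_per`. -/
def MemH1per (u : ℝ → ℝ) : Prop :=
  W11loc u ∧ Function.Periodic u 1 ∧ MemLp (deriv u) 2 (volume.restrict (Ioc (0 : ℝ) 1))

/-- The norm of `L¹([0,1])`. -/
def normL1 (f : ℝ → ℝ) : ℝ := ∫ ξ in (0 : ℝ)..1, |f ξ|

/-- The common norm of `V` and `W^{1,1}_per`: `‖f‖_{L^∞([0,1])} + ‖f_ξ‖_{L¹([0,1])}`
(the functions are continuous, so the essential supremum is the supremum). -/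
def normV (f : ℝ → ℝ) : ℝ := (⨆ ξ : Icc (0 : ℝ) 1, |f ξ|) + normL1 (deriv f)

/-! ## Lagrangian variables -/

/-- Triples `X = (y, U, ν)` of real functions. -/
abbrev Lag := (ℝ → ℝ) × (ℝ → ℝ) × (ℝ → ℝ)

/-- The characteristic `y`. -/
abbrev Lag.y (X : Lag) : ℝ → ℝ := X.1
/-- The Lagrangian velocity `U`. -/
abbrev Lag.U (X : Lag) : ℝ → ℝ := X.2.1
/-- The Lagrangian energy density `ν`. -/
abbrev Lag.ν (X : Lag) : ℝ → ℝ := X.2.2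

/-- Equality in `E`: the third component is an equivalence class modulo null sets. -/
def LagEq (X Y : Lag) : Prop := X.y = Y.y ∧ X.U = Y.U ∧ X.ν =ᵐ[volume] Y.ν

/-- The space `E = V × W^{1,1}_per × L¹_per`. -/
def MemE (X : Lag) : Prop := MemV X.y ∧ MemW11per X.U ∧ MemL1per X.ν

/-- The norm of `E`. -/
def normE (X : Lag) : ℝ := normV X.y + normV X.U + normL1 X.ν

/-- The total energy `h = ‖ν‖_{L¹}`. -/
def energy (X : Lag) : ℝ := normL1 X.ν

/-- The set `F` of Lagrangian variables. -/
def setF : Set Lag := {X | MemE X ∧ MemV1 X.y ∧ LocallyLipschitz X.y ∧ LocallyLipschitz X.U ∧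
  (∃ C : ℝ, ∀ᵐ ξ : ℝ, |X.ν ξ| ≤ C) ∧
  (∀ᵐ ξ : ℝ, 0 ≤ deriv X.y ξ) ∧ (∀ᵐ ξ : ℝ, 0 ≤ X.ν ξ) ∧
  (∃ c : ℝ, 0 < c ∧ ∀ᵐ ξ : ℝ, c ≤ deriv X.y ξ + X.ν ξ) ∧
  (∀ᵐ ξ : ℝ, deriv X.y ξ * X.ν ξ = (deriv X.y ξ) ^ 2 * (X.U ξ) ^ 2 + (deriv X.U ξ) ^ 2)}

/-- `F₀ = {X ∈ F : y_ξ + ν = 1 + h}`. -/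
def setF0 : Set Lag := {X | X ∈ setF ∧ ∀ᵐ ξ : ℝ, deriv X.y ξ + X.ν ξ = 1 + energy X}

/-- `H = {X ∈ F₀ : ∫₀¹ y = 0}`. -/
def setH : Set Lag := {X | X ∈ setF0 ∧ ∫ ξ in (0 : ℝ)..1, X.y ξ = 0}

/-- The bounded-energy part `H^M` of `H`. -/
def setHM (M : ℝ) : Set Lag := {X | X ∈ setH ∧ energy X ≤ M}

/-! ## The Lagrangian system -/

/-- `Q(ξ) = -¼ ∫_ℝ sign(ξ-η) exp(-sign(ξ-η)(y(ξ)-y(η))) (U² y_ξ + ν)(η) dη`. -/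
def Qop (X : Lag) (ξ : ℝ) : ℝ :=
  -(1 / 4) * ∫ η : ℝ, Real.sign (ξ - η) * Real.exp (-Real.sign (ξ - η) * (X.y ξ - X.y η)) *
    ((X.U η) ^ 2 * deriv X.y η + X.ν η)

/-- `P(ξ) = ¼ ∫_ℝ exp(-sign(ξ-η)(y(ξ)-y(η))) (U² y_ξ + ν)(η) dη`. -/
def Pop (X : Lag) (ξ : ℝ) : ℝ :=
  (1 / 4) * ∫ η : ℝ, Real.exp (-Real.sign (ξ - η) * (X.y ξ - X.y η)) *
    ((X.U η) ^ 2 * deriv X.y η + X.ν η)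

/-- The right-hand side `(U, -Q, -2 Q U y_ξ + (3 U² - 2 P) U_ξ)` of the Lagrangian system. -/
def vecField (X : Lag) : Lag :=
  (X.U, fun ξ => -Qop X ξ,
    fun ξ => -2 * Qop X ξ * X.U ξ * deriv X.y ξ + (3 * (X.U ξ) ^ 2 - 2 * Pop X ξ) * deriv X.U ξ)

/-- `X ∈ C¹([0,∞), E)` solves `X_t = (U, -Q, -2 Q U y_ξ + (3 U² - 2 P) U_ξ)` with `X(0) = X₀`.
Difference quotients converge in the norm of `E` (one-sided at `t = 0`), and the derivative is
an `E`-valued continuous function of time. -/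
def IsGlobalSolution (X : ℝ → Lag) (X₀ : Lag) : Prop :=
  LagEq (X 0) X₀ ∧
  (∀ t, 0 ≤ t → MemE (X t) ∧ MemE (vecField (X t))) ∧
  (∀ t, 0 ≤ t → Tendsto (fun s => normE ((s - t)⁻¹ • (X s - X t) - vecField (X t)))
    (𝓝[Ici 0 \ {t}] t) (𝓝 0)) ∧
  (∀ t, 0 ≤ t → Tendsto (fun s => normE (vecField (X s) - vecField (X t)))
    (𝓝[Ici 0] t) (𝓝 0))

open Classical in
/-- The flow `S_t`: the value at time `t` of the global solution starting at `X₀`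
(meaningful where a unique global solution exists). -/
def flowS (t : ℝ) (X₀ : Lag) : Lag :=
  if h : ∃ X : ℝ → Lag, IsGlobalSolution X X₀ then h.choose t else X₀

/-! ## Relabeling -/

/-- The group `G` of relabeling functions. -/
def setG : Set (ℝ → ℝ) := {f | Function.Bijective f ∧ LocallyLipschitz f ∧
  (∀ ξ, f (ξ + 1) = f ξ + 1) ∧ MemW1infPer (fun ξ => f ξ - ξ) ∧
  MemW1infPer (fun ξ => Function.invFun f ξ - ξ)}

/-- The action `X • f = (y ∘ f, U ∘ f, (ν ∘ f) f_ξ)`. -/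
def relabel (X : Lag) (f : ℝ → ℝ) : Lag :=
  (X.y ∘ f, X.U ∘ f, fun ξ => X.ν (f ξ) * deriv f ξ)

/-- `Π₁ : F → F₀`, `Π₁(X) = X • f⁻¹` with `f = (y + ∫₀^ξ ν) / (1 + h)`. -/
def proj1 (X : Lag) : Lag :=
  relabel X (Function.invFun
    (fun ξ => (1 / (1 + energy X)) * (X.y ξ + ∫ η in (0 : ℝ)..ξ, X.ν η)))

/-- `Π₂ : F₀ → H`, the translation by `a = ∫₀¹ y`. -/
def proj2 (X : Lag) : Lag :=
  relabel X (fun ξ => ξ - ∫ η in (0 : ℝ)..1, X.y η)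

/-- The projection `Π : F → H` onto the normalized representative. -/
def proj (X : Lag) : Lag := proj2 (proj1 X)

/-- `S̄_t = Π ∘ S_t`. -/
def flowSbar (t : ℝ) (X : Lag) : Lag := proj (flowS t X)

/-! ## Distances in Lagrangian variables -/

/-- `J(X, Y) = inf_{f, g ∈ G} ‖X • f - Y • g‖_E`. -/
def J (X Y : Lag) : ℝ :=
  sInf {r | ∃ f ∈ setG, ∃ g ∈ setG, r = normE (relabel X f - relabel Y g)}

/-- Infimum of `∑ J(X_{n-1}, X_n)` over finite chains `X_0 = X, …, X_N = Y` in `S`. -/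
def chainDist (S : Set Lag) (X Y : Lag) : ℝ :=
  sInf {r | ∃ (N : ℕ) (Z : ℕ → Lag), (∀ n ≤ N, Z n ∈ S) ∧ Z 0 = X ∧ Z N = Y ∧
    r = ∑ n ∈ Finset.range N, J (Z n) (Z (n + 1))}

/-- The distance `d` (chains in `F`). -/
def dist_d (X Y : Lag) : ℝ := chainDist setF X Y

/-- The distance `d_M` (chains in `H^M`). -/
def dist_dM (M : ℝ) (X Y : Lag) : ℝ := chainDist (setHM M) X Y

/-! ## Eulerian variables -/

/-- Pairs `(u, μ)`. -/
abbrev Eul := (ℝ → ℝ) × Measure ℝ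

/-- The set `D`: `u ∈ H¹_per` and `μ` is a positive Radon (i.e. locally finite Borel) measure of
period one whose absolutely continuous part is `(u² + u_x²) dx`. -/
def setD : Set Eul := {p | MemH1per p.1 ∧ IsLocallyFiniteMeasure p.2 ∧
  p.2.map (fun x => x + 1) = p.2 ∧
  volume.withDensity (p.2.rnDeriv volume) =
    volume.withDensity (fun x => ENNReal.ofReal ((p.1 x) ^ 2 + (deriv p.1 x) ^ 2))}

/-- `D^M = {(u, μ) ∈ D : μ([0,1)) ≤ M}`. -/
def setDM (M : ℝ) : Set Eul := {p | p ∈ setD ∧ p.2.real (Ico 0 1) ≤ M}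

/-- The distribution function `F_μ`, with `F_μ(0) = 0`. -/
def distrib (μ : Measure ℝ) (x : ℝ) : ℝ :=
  if 0 ≤ x then μ.real (Ico 0 x) else -μ.real (Ico x 0)

/-- `y(ξ) = sup {y : F_μ(y) + y < (1 + h) ξ}` with `h = μ([0,1))`. -/
def charOf (μ : Measure ℝ) (ξ : ℝ) : ℝ :=
  sSup {x : ℝ | distrib μ x + x < (1 + μ.real (Ico 0 1)) * ξ}

/-- The map `L : D → H`, `L(u, μ) = Π(y, u ∘ y, (1 + h) - y_ξ)`. -/
def mapL (p : Eul) : Lag :=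
  proj (charOf p.2, p.1 ∘ charOf p.2,
    fun ξ => (1 + p.2.real (Ico 0 1)) - deriv (charOf p.2) ξ)

/-- The map `M : F → D`: `u(x) = U(ξ)` for any `ξ` with `y(ξ) = x`, and `μ = y_#(ν dξ)`. -/
def mapM (X : Lag) : Eul :=
  (fun x => X.U (Function.invFun X.y x),
    (volume.withDensity (fun ξ => ENNReal.ofReal (X.ν ξ))).map X.y)

/-- `T_t = M S̄_t L`. -/
def flowT (t : ℝ) (p : Eul) : Eul := mapM (flowSbar t (mapL p))

/-- `d_D`, the distance `d` transported by `L`. -/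
def dist_D (p q : Eul) : ℝ := dist_d (mapL p) (mapL q)

/-- `d_{D^M}`, the distance `d_M` transported by `L`. -/
def dist_DM (M : ℝ) (p q : Eul) : ℝ := dist_dM M (mapL p) (mapL q)

/-- `d` is a metric on the set `S`. -/
def IsMetricOn (S : Set Eul) (d : Eul → Eul → ℝ) : Prop :=
  (∀ p ∈ S, ∀ q ∈ S, 0 ≤ d p q) ∧
  (∀ p ∈ S, ∀ q ∈ S, d p q = 0 ↔ p = q) ∧
  (∀ p ∈ S, ∀ q ∈ S, d p q = d q p) ∧
  (∀ p ∈ S, ∀ q ∈ S, ∀ r ∈ S, d p r ≤ d p q + d q r)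

end

end PeriodicCH

open PeriodicCH

namespace PeriodicCH
noncomputable section

/-! ## Locally absolutely continuous functions -/

theorem intervalIntegrable_of_locallyIntegrable {f : ℝ → ℝ} (hf : LocallyIntegrable f volume)
    (a b : ℝ) : IntervalIntegrable f volume a b :=
  (hf.integrableOn_isCompact isCompact_uIcc).intervalIntegrable

theorem locallyIntegrable_of_intervalIntegrable {f : ℝ → ℝ}
    (hf : ∀ a b, IntervalIntegrable f volume a b) : LocallyIntegrable f volume := by
  intro x
  refine ⟨Ioc (x - 1) (x + 1), Ioc_mem_nhds (by linarith) (by linarith), ?_⟩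
  exact (intervalIntegrable_iff_integrableOn_Ioc_of_le (by linarith)).1 (hf (x - 1) (x + 1))

namespace W11loc

variable {f g : ℝ → ℝ}

theorem continuous (hf : W11loc f) : Continuous f := by
  rw [continuous_iff_continuousAt]
  intro x
  refine ((hf (x - 1) (x + 1)).continuousOn).continuousAt ?_
  rw [uIcc_of_le (by linarith)]
  exact Icc_mem_nhds (by linarith) (by linarith)

theorem ae_differentiableAt (hf : W11loc f) : ∀ᵐ x, DifferentiableAt ℝ f x := by
  have : ∀ n : ℕ, ∀ᵐ x, x ∈ uIcc (-(n : ℝ)) n → DifferentiableAt ℝ f x :=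
    fun n => (hf _ _).ae_differentiableAt
  filter_upwards [ae_all_iff.2 this] with x hx
  obtain ⟨n, hn⟩ := exists_nat_ge |x|
  refine hx n ?_
  rw [uIcc_of_le (by linarith [Nat.cast_nonneg (α := ℝ) n])]
  exact abs_le.1 hn

theorem intervalIntegrable_deriv (hf : W11loc f) (a b : ℝ) :
    IntervalIntegrable (deriv f) volume a b := (hf a b).intervalIntegrable_deriv

theorem locallyIntegrable_deriv (hf : W11loc f) : LocallyIntegrable (deriv f) volume :=
  locallyIntegrable_of_intervalIntegrable hf.intervalIntegrable_deriv

theorem integral_deriv (hf : W11loc f) (a b : ℝ) : ∫ x in a..b, deriv f x = f b - f a :=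
  (hf a b).integral_deriv_eq_sub

theorem of_lipschitz {K : NNReal} (hf : LipschitzWith K f) : W11loc f := fun _ _ =>
  (hf.lipschitzOnWith (s := _)).absolutelyContinuousOnInterval

theorem of_locallyLipschitz (hf : LocallyLipschitz f) : W11loc f := fun a b => by
  obtain ⟨K, hK⟩ := (hf.locallyLipschitzOn (s := uIcc a b)).exists_lipschitzOnWith_of_compact
    isCompact_uIcc
  exact hK.absolutelyContinuousOnInterval

theorem add (hf : W11loc f) (hg : W11loc g) : W11loc (fun x => f x + g x) :=
  fun a b => (hf a b).add (hg a b)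

theorem sub (hf : W11loc f) (hg : W11loc g) : W11loc (fun x => f x - g x) :=
  fun a b => (hf a b).sub (hg a b)

theorem neg (hf : W11loc f) : W11loc (fun x => -f x) := fun a b => (hf a b).neg

theorem mul (hf : W11loc f) (hg : W11loc g) : W11loc (fun x => f x * g x) :=
  fun a b => (hf a b).mul (hg a b)

theorem const_mul (c : ℝ) (hf : W11loc f) : W11loc (fun x => c * f x) :=
  fun a b => (hf a b).const_mul c

theorem const (c : ℝ) : W11loc (fun _ => c) := of_lipschitz (LipschitzWith.const c)

theorem id : W11loc (fun x => x) := of_lipschitz LipschitzWith.id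

/-- Composition with a locally Lipschitz function on the left. -/
theorem comp_left (hf : W11loc f) {G : ℝ → ℝ} (hG : LocallyLipschitz G) :
    W11loc (fun x => G (f x)) := by
  intro a b
  have hc : IsCompact (f '' uIcc a b) := isCompact_uIcc.image hf.continuous
  obtain ⟨K, hK⟩ := (hG.locallyLipschitzOn (s := f '' uIcc a b)).exists_lipschitzOnWith_of_compact
    hc
  have hfab := hf a b
  rw [absolutelyContinuousOnInterval_iff] at hfab ⊢
  intro ε hε
  obtain ⟨δ, hδ, H⟩ := hfab (ε / (K + 1)) (by positivity)
  refine ⟨δ, hδ, fun E hE hEd => ?_⟩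
  have h1 := H E hE hEd
  calc ∑ i ∈ Finset.range E.1, dist (G (f (E.2 i).1)) (G (f (E.2 i).2))
      ≤ ∑ i ∈ Finset.range E.1, K * dist (f (E.2 i).1) (f (E.2 i).2) := by
        refine Finset.sum_le_sum fun i hi => ?_
        exact hK.dist_le_mul _ (mem_image_of_mem _ (hE.1 i hi).1) _
          (mem_image_of_mem _ (hE.1 i hi).2)
    _ = K * ∑ i ∈ Finset.range E.1, dist (f (E.2 i).1) (f (E.2 i).2) := by
        rw [Finset.mul_sum]
    _ ≤ K * (ε / (K + 1)) := by gcongr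
    _ < ε := by
        rw [← mul_div_assoc, div_lt_iff₀ (by positivity)]
        nlinarith [K.coe_nonneg]

theorem exp (hf : W11loc f) : W11loc (fun x => Real.exp (f x)) :=
  hf.comp_left (Real.contDiff_exp (n := 1)).locallyLipschitz

theorem primitive (c x₀ : ℝ) (hf : LocallyIntegrable f volume) :
    W11loc (fun x => c + ∫ t in x₀..x, f t) := by
  refine (const c).add ?_
  intro a b
  have h := (intervalIntegrable_of_locallyIntegrable hf (min x₀ (min a b)) (max x₀ (max a b)))
  have h2 := h.absolutelyContinuousOnInterval_intervalIntegral (c := x₀) (by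
    rw [uIcc_of_le (by simp)]; constructor <;> simp)
  refine h2.mono ?_
  rw [uIcc_of_le (a := min x₀ _) (by simp)]
  exact Icc_subset_Icc (by simp) (by simp)

theorem ae_hasDerivAt_primitive (c x₀ : ℝ) (hf : LocallyIntegrable f volume) :
    ∀ᵐ x, HasDerivAt (fun x => c + ∫ t in x₀..x, f t) (f x) x := by
  filter_upwards [_root_.LocallyIntegrable.ae_hasDerivAt_integral hf] with x hx
  simpa using (hx x₀).const_add c

/-- A function with the increments of an integral is locally absolutely continuous. -/
theorem of_integral (hg : LocallyIntegrable g volume)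
    (h : ∀ x, f x = f 0 + ∫ t in (0 : ℝ)..x, g t) :
    W11loc f ∧ deriv f =ᵐ[volume] g := by
  have e : f = fun x => f 0 + ∫ t in (0 : ℝ)..x, g t := funext h
  constructor
  · rw [e]; exact primitive _ _ hg
  · filter_upwards [ae_hasDerivAt_primitive (f 0) 0 hg] with x hx
    rw [← e] at hx
    exact hx.deriv

theorem eq_add_integral (hf : W11loc f) (x : ℝ) : f x = f 0 + ∫ t in (0 : ℝ)..x, deriv f t := by
  rw [hf.integral_deriv]; ring

theorem abs_sub_le (hf : W11loc f) {a b : ℝ} (hab : a ≤ b) :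
    |f b - f a| ≤ ∫ x in a..b, |deriv f x| := by
  rw [← hf.integral_deriv]
  exact intervalIntegral.abs_integral_le_integral_abs hab

theorem deriv_sub_ae (hf : W11loc f) (hg : W11loc g) :
    deriv (fun x => f x - g x) =ᵐ[volume] fun x => deriv f x - deriv g x := by
  filter_upwards [hf.ae_differentiableAt, hg.ae_differentiableAt] with x h1 h2
  exact deriv_fun_sub h1 h2

theorem deriv_add_ae (hf : W11loc f) (hg : W11loc g) :
    deriv (fun x => f x + g x) =ᵐ[volume] fun x => deriv f x + deriv g x := by
  filter_upwards [hf.ae_differentiableAt, hg.ae_differentiableAt] with x h1 h2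
  exact deriv_fun_add h1 h2

theorem lipschitz_of_abs_deriv_le (hf : W11loc f) {K : ℝ} (hK : ∀ᵐ x, |deriv f x| ≤ K) :
    LipschitzWith K.toNNReal f := by
  have hK0 : 0 ≤ K := by
    obtain ⟨x, hx⟩ := hK.exists
    exact (abs_nonneg _).trans hx
  have key : ∀ a b, a ≤ b → |f b - f a| ≤ K * (b - a) := by
    intro a b hab
    refine (hf.abs_sub_le hab).trans ?_
    calc ∫ x in a..b, |deriv f x| ≤ ∫ x in a..b, K :=
          intervalIntegral.integral_mono_ae hab (hf.intervalIntegrable_deriv a b).abs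
            intervalIntegrable_const hK
      _ = K * (b - a) := by simp [mul_comm]
  refine LipschitzWith.of_dist_le_mul fun x y => ?_
  rw [Real.dist_eq, Real.dist_eq, Real.coe_toNNReal _ hK0]
  rcases le_total x y with h | h
  · rw [abs_sub_comm, abs_sub_comm x y, abs_of_nonneg (sub_nonneg.2 h)]; exact key x y h
  · rw [abs_of_nonneg (sub_nonneg.2 h)]; exact key y x h

theorem monotone_of_deriv_nonneg (hf : W11loc f) (h : ∀ᵐ x, 0 ≤ deriv f x) : Monotone f := by
  intro a b hab
  have : 0 ≤ ∫ x in a..b, deriv f x :=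
    intervalIntegral.integral_nonneg_of_ae hab h
  rw [hf.integral_deriv] at this
  linarith

end W11loc

theorem deriv_add_one {f : ℝ → ℝ} {α : ℝ} (h : ∀ ξ, f (ξ + 1) = f ξ + α) (ξ : ℝ) :
    deriv f (ξ + 1) = deriv f ξ := by
  have : (fun x => f (x + 1)) = fun x => f x + α := funext h
  rw [← deriv_comp_add_const, this, deriv_add_const]

theorem abs_deriv_le_of_lipschitz {f : ℝ → ℝ} {K : NNReal} (hf : LipschitzWith K f) (x : ℝ) :
    |deriv f x| ≤ K := by
  simpa using norm_deriv_le_of_lipschitz hf (x₀ := x)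

/-- A locally Lipschitz function with periodic increments is Lipschitz. -/
theorem exists_lipschitzWith_of_periodic {f : ℝ → ℝ} {α : ℝ} (hf : LocallyLipschitz f)
    (h : ∀ ξ, f (ξ + 1) = f ξ + α) : ∃ K, LipschitzWith K f := by
  obtain ⟨K, hK⟩ := (hf.locallyLipschitzOn (s := Icc (-1 : ℝ) 2)).exists_lipschitzOnWith_of_compact
    isCompact_Icc
  have hper : Function.Periodic (deriv f) 1 := deriv_add_one h
  refine ⟨_, (W11loc.of_locallyLipschitz hf).lipschitz_of_abs_deriv_le (K := K)
    (Eventually.of_forall fun x => ?_)⟩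
  obtain ⟨y, hy, hxy⟩ := hper.exists_mem_Ico₀ one_pos x
  rw [hxy]
  by_cases hd : DifferentiableAt ℝ f y
  · have hn : Icc (-1 : ℝ) 2 ∈ 𝓝 y := Icc_mem_nhds (by linarith [hy.1]) (by linarith [hy.2])
    simpa using norm_deriv_le_of_lipschitzOn hn hK
  · rw [deriv_zero_of_not_differentiableAt hd]; simp

/-! ## Monotone Lipschitz changes of variables -/

theorem volume_image_eq_zero_of_lipschitz {g : ℝ → ℝ} {K : NNReal} (hg : LipschitzWith K g)
    {s : Set ℝ} (hs : volume s = 0) : volume (g '' s) = 0 := by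
  have := (hg.lipschitzOnWith (s := s)).hausdorffMeasure_image_le (d := 1) zero_le_one
  rw [hausdorffMeasure_real, hs, mul_zero] at this
  exact le_antisymm this bot_le

section ChangeOfVariables

variable {g : ℝ → ℝ} {K : NNReal} (hg : LipschitzWith K g) (hm : Monotone g)
include hg

theorem image_inter_differentiableAt_ae_eq (s : Set ℝ) :
    g '' (s ∩ {x | DifferentiableAt ℝ g x}) =ᵐ[volume] g '' s := by
  refine ae_eq_set.2 ⟨?_, ?_⟩
  · rw [sdiff_eq_empty.2 (image_mono inter_subset_left)]; simp
  · refine measure_mono_null ?_ (volume_image_eq_zero_of_lipschitz hg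
      (W11loc.of_lipschitz hg).ae_differentiableAt)
    rintro _ ⟨⟨x, hx, rfl⟩, hn⟩
    exact ⟨x, fun hd => hn ⟨x, ⟨hx, hd⟩, rfl⟩, rfl⟩

theorem inter_differentiableAt_ae_eq (s : Set ℝ) :
    (s ∩ {x | DifferentiableAt ℝ g x} : Set ℝ) =ᵐ[volume] s := by
  have : ({x | DifferentiableAt ℝ g x} : Set ℝ) =ᵐ[volume] univ :=
    eventuallyEq_univ.2 (W11loc.of_lipschitz hg).ae_differentiableAt
  simpa using (ae_eq_refl s).inter this

include hm

theorem lintegral_image_eq_of_monotone_lipschitz {s : Set ℝ} (hs : MeasurableSet s)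
    (φ : ℝ → ENNReal) :
    ∫⁻ x in g '' s, φ x = ∫⁻ x in s, ENNReal.ofReal (deriv g x) * φ (g x) := by
  rw [← setLIntegral_congr (image_inter_differentiableAt_ae_eq hg s),
    ← setLIntegral_congr (inter_differentiableAt_ae_eq hg s)]
  exact lintegral_image_eq_lintegral_deriv_mul_of_monotoneOn
    (hs.inter (measurableSet_of_differentiableAt ℝ g))
    (fun x hx => hx.2.hasDerivAt.hasDerivWithinAt) (hm.monotoneOn _) φ

theorem integral_image_eq_of_monotone_lipschitz {s : Set ℝ} (hs : MeasurableSet s)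
    (φ : ℝ → ℝ) : ∫ x in g '' s, φ x = ∫ x in s, deriv g x * φ (g x) := by
  rw [← setIntegral_congr_set (image_inter_differentiableAt_ae_eq hg s),
    ← setIntegral_congr_set (inter_differentiableAt_ae_eq hg s)]
  exact integral_image_eq_integral_deriv_smul_of_monotoneOn
    (hs.inter (measurableSet_of_differentiableAt ℝ g))
    (fun x hx => hx.2.hasDerivAt.hasDerivWithinAt) (hm.monotoneOn _) φ

theorem integrableOn_image_iff_of_monotone_lipschitz {s : Set ℝ} (hs : MeasurableSet s)
    (φ : ℝ → ℝ) :
    IntegrableOn φ (g '' s) ↔ IntegrableOn (fun x => deriv g x * φ (g x)) s := by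
  rw [← integrableOn_congr_set_ae (image_inter_differentiableAt_ae_eq hg s),
    ← integrableOn_congr_set_ae (inter_differentiableAt_ae_eq hg s)]
  exact integrableOn_image_iff_integrableOn_deriv_smul_of_monotoneOn
    (hs.inter (measurableSet_of_differentiableAt ℝ g))
    (fun x hx => hx.2.hasDerivAt.hasDerivWithinAt) (hm.monotoneOn _) φ

theorem image_Icc_of_monotone_lipschitz {a b : ℝ} (hab : a ≤ b) :
    g '' Icc a b = Icc (g a) (g b) := by
  apply Subset.antisymm
  · rintro _ ⟨x, hx, rfl⟩
    exact ⟨hm hx.1, hm hx.2⟩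
  · exact intermediate_value_Icc hab hg.continuous.continuousOn

theorem intervalIntegral_comp_mul_deriv (φ : ℝ → ℝ) (a b : ℝ) :
    ∫ x in a..b, φ (g x) * deriv g x = ∫ x in g a..g b, φ x := by
  wlog hab : a ≤ b generalizing a b
  · rw [intervalIntegral.integral_symm, this b a (not_le.1 hab).le,
      intervalIntegral.integral_symm (g a), neg_neg]
  rw [intervalIntegral.integral_of_le hab, intervalIntegral.integral_of_le (hm hab),
    ← integral_Icc_eq_integral_Ioc, ← integral_Icc_eq_integral_Ioc,
    ← image_Icc_of_monotone_lipschitz hg hm hab,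
    integral_image_eq_of_monotone_lipschitz hg hm measurableSet_Icc]
  simp_rw [mul_comm]

theorem locallyIntegrable_comp_mul_deriv {φ : ℝ → ℝ} (hφ : LocallyIntegrable φ volume) :
    LocallyIntegrable (fun x => φ (g x) * deriv g x) volume := by
  refine locallyIntegrable_of_intervalIntegrable fun a b => ?_
  wlog hab : a ≤ b generalizing a b
  · exact (this b a (not_le.1 hab).le).symm
  rw [intervalIntegrable_iff_integrableOn_Icc_of_le hab]
  have : IntegrableOn φ (g '' Icc a b) := by
    rw [image_Icc_of_monotone_lipschitz hg hm hab]
    exact hφ.integrableOn_isCompact isCompact_Icc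
  rw [integrableOn_image_iff_of_monotone_lipschitz hg hm measurableSet_Icc] at this
  simpa [mul_comm] using this

/-- Composition of a locally absolutely continuous function with a monotone Lipschitz one. -/
theorem W11loc.comp_right {f : ℝ → ℝ} (hf : W11loc f) :
    W11loc (fun x => f (g x)) ∧
      deriv (fun x => f (g x)) =ᵐ[volume] fun x => deriv f (g x) * deriv g x := by
  refine W11loc.of_integral (locallyIntegrable_comp_mul_deriv hg hm hf.locallyIntegrable_deriv)
    fun x => ?_
  rw [intervalIntegral_comp_mul_deriv hg hm, hf.integral_deriv]
  ring

end ChangeOfVariables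

/-! ## Periodic integrable functions -/

theorem ae_comp_add {p : ℝ → Prop} (h : ∀ᵐ x, p x) (c : ℝ) : ∀ᵐ x, p (x + c) :=
  (measurePreserving_add_right volume c).quasiMeasurePreserving.ae h

theorem MemL1per.exists_periodic {φ : ℝ → ℝ} (hφ : ∀ᵐ ξ : ℝ, φ (ξ + 1) = φ ξ) :
    ∃ g : ℝ → ℝ, Function.Periodic g 1 ∧ g =ᵐ[volume] φ := by
  refine ⟨fun x => φ (Int.fract x), fun x => by simp, ?_⟩
  have h1 : ∀ n : ℤ, ∀ᵐ ξ : ℝ, φ (ξ + n + 1) = φ (ξ + n) := fun n => ae_comp_add hφ n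
  filter_upwards [ae_all_iff.2 h1] with x hx
  have : ∀ n : ℤ, φ (x + n) = φ x := by
    intro n
    induction n using Int.induction_on with
    | zero => simp
    | succ k ih => rw [← ih, ← hx k]; push_cast; ring_nf
    | pred k ih => rw [← ih, ← hx]; push_cast; ring_nf
  have h2 := this (-⌊x⌋)
  rw [← h2]
  congr 1
  push_cast
  rw [Int.fract]; ring

namespace MemL1per

variable {φ ψ : ℝ → ℝ}

theorem intervalIntegrable (hφ : MemL1per φ) (a b : ℝ) : IntervalIntegrable φ volume a b :=
  intervalIntegrable_of_locallyIntegrable hφ.1 a b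

theorem congr (hφ : MemL1per φ) (h : φ =ᵐ[volume] ψ) : MemL1per ψ := by
  refine ⟨locallyIntegrable_of_intervalIntegrable fun a b =>
    (hφ.intervalIntegrable a b).congr_ae (ae_restrict_of_ae h), ?_⟩
  filter_upwards [hφ.2, h, ae_comp_add h 1] with x h1 h2 h3
  rw [← h2, ← h3, h1]

theorem integral_add_one (hφ : MemL1per φ) (a : ℝ) :
    ∫ x in a..(a + 1), φ x = ∫ x in (0 : ℝ)..1, φ x := by
  obtain ⟨g, hg, hgφ⟩ := exists_periodic hφ.2
  rw [← intervalIntegral.integral_congr_ae (hgφ.mono fun x hx _ => hx),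
    ← intervalIntegral.integral_congr_ae (hgφ.mono fun x hx _ => hx)]
  simpa using hg.intervalIntegral_add_eq a 0

theorem add (hφ : MemL1per φ) (hψ : MemL1per ψ) : MemL1per (fun x => φ x + ψ x) :=
  ⟨hφ.1.add hψ.1, by filter_upwards [hφ.2, hψ.2] with x h1 h2; rw [h1, h2]⟩

theorem sub (hφ : MemL1per φ) (hψ : MemL1per ψ) : MemL1per (fun x => φ x - ψ x) :=
  ⟨hφ.1.sub hψ.1, by filter_upwards [hφ.2, hψ.2] with x h1 h2; rw [h1, h2]⟩

theorem abs (hφ : MemL1per φ) : MemL1per (fun x => |φ x|) :=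
  ⟨locallyIntegrable_of_intervalIntegrable fun a b => (hφ.intervalIntegrable a b).abs,
    by filter_upwards [hφ.2] with x h1; rw [h1]⟩

theorem continuous_mul (hφ : MemL1per φ) {g : ℝ → ℝ} (hg : Continuous g)
    (hp : Function.Periodic g 1) : MemL1per (fun x => g x * φ x) :=
  ⟨locallyIntegrable_of_intervalIntegrable fun a b =>
    (hφ.intervalIntegrable a b).continuousOn_mul hg.continuousOn,
    by filter_upwards [hφ.2] with x h1; rw [h1, hp x]⟩

theorem const_mul (c : ℝ) (hφ : MemL1per φ) : MemL1per (fun x => c * φ x) :=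
  hφ.continuous_mul continuous_const (fun _ => rfl)

theorem normL1_eq (hφ : MemL1per φ) (a : ℝ) : normL1 φ = ∫ x in a..(a + 1), |φ x| :=
  (hφ.abs.integral_add_one a).symm

/-- Intervals of length at most one carry at most the whole mass. -/
theorem integral_abs_le (hφ : MemL1per φ) {a b : ℝ} (hab : a ≤ b) (hb : b ≤ a + 1) :
    ∫ x in a..b, |φ x| ≤ normL1 φ := by
  rw [hφ.normL1_eq a]
  exact intervalIntegral.integral_mono_interval le_rfl hab hb
    (Eventually.of_forall fun x => abs_nonneg _) (hφ.abs.intervalIntegrable _ _)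

end MemL1per

theorem normL1_nonneg (φ : ℝ → ℝ) : 0 ≤ normL1 φ :=
  intervalIntegral.integral_nonneg zero_le_one fun _ _ => abs_nonneg _

theorem normL1_congr {φ ψ : ℝ → ℝ} (h : φ =ᵐ[volume] ψ) : normL1 φ = normL1 ψ :=
  intervalIntegral.integral_congr_ae (h.mono fun x hx _ => by rw [hx])

theorem normL1_mono {φ ψ : ℝ → ℝ} (hφ : LocallyIntegrable φ volume)
    (hψ : LocallyIntegrable ψ volume) (h : ∀ᵐ x, |φ x| ≤ ψ x) :
    normL1 φ ≤ ∫ x in (0 : ℝ)..1, ψ x :=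
  intervalIntegral.integral_mono_ae zero_le_one
    (intervalIntegrable_of_locallyIntegrable hφ 0 1).abs
    (intervalIntegrable_of_locallyIntegrable hψ 0 1) h

theorem normL1_add_le {φ ψ : ℝ → ℝ} (hφ : LocallyIntegrable φ volume)
    (hψ : LocallyIntegrable ψ volume) :
    normL1 (fun x => φ x + ψ x) ≤ normL1 φ + normL1 ψ := by
  have h1 := (intervalIntegrable_of_locallyIntegrable hφ 0 1).abs
  have h2 := (intervalIntegrable_of_locallyIntegrable hψ 0 1).abs
  unfold normL1
  rw [← intervalIntegral.integral_add h1 h2]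
  exact intervalIntegral.integral_mono zero_le_one
    ((intervalIntegrable_of_locallyIntegrable hφ 0 1).add
      (intervalIntegrable_of_locallyIntegrable hψ 0 1)).abs (h1.add h2)
    fun x => abs_add_le _ _

theorem normL1_const_mul (c : ℝ) (φ : ℝ → ℝ) : normL1 (fun x => c * φ x) = |c| * normL1 φ := by
  simp [normL1, abs_mul]

theorem W11loc.memL1per_deriv {f : ℝ → ℝ} (hf : W11loc f) {α : ℝ}
    (h : ∀ ξ, f (ξ + 1) = f ξ + α) : MemL1per (deriv f) :=
  ⟨hf.locallyIntegrable_deriv, Eventually.of_forall fun ξ => deriv_add_one h ξ⟩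

theorem MemW11per.memL1per_deriv {f : ℝ → ℝ} (hf : MemW11per f) : MemL1per (deriv f) :=
  hf.1.memL1per_deriv (α := 0) (fun ξ => by rw [hf.2 ξ, add_zero])


/-! ## Norms -/

/-- The supremum of `|f|` over a period. -/
def supN (f : ℝ → ℝ) : ℝ := ⨆ ξ : Icc (0 : ℝ) 1, |f ξ|

theorem normV_eq (f : ℝ → ℝ) : normV f = supN f + normL1 (deriv f) := rfl

theorem supN_nonneg (f : ℝ → ℝ) : 0 ≤ supN f := Real.iSup_nonneg fun _ => abs_nonneg _

theorem abs_le_supN {f : ℝ → ℝ} (hf : Continuous f) {ξ : ℝ} (hξ : ξ ∈ Icc (0 : ℝ) 1) :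
    |f ξ| ≤ supN f := by
  have hb : BddAbove (range fun ξ : Icc (0 : ℝ) 1 => |f ξ|) := by
    have := (isCompact_Icc (a := (0 : ℝ)) (b := 1)).bddAbove_image (f := fun x => |f x|)
      hf.abs.continuousOn
    refine this.mono ?_
    rintro _ ⟨x, rfl⟩
    exact ⟨x, x.2, rfl⟩
  exact le_ciSup hb (⟨ξ, hξ⟩ : Icc (0 : ℝ) 1)

theorem abs_le_supN_of_periodic {f : ℝ → ℝ} (hf : Continuous f) (hp : Function.Periodic f 1)
    (ξ : ℝ) : |f ξ| ≤ supN f := by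
  obtain ⟨x, hx, h⟩ := hp.exists_mem_Ico₀ one_pos ξ
  rw [h]
  exact abs_le_supN hf ⟨hx.1, hx.2.le⟩

theorem supN_le {f : ℝ → ℝ} {C : ℝ} (h : ∀ ξ ∈ Icc (0 : ℝ) 1, |f ξ| ≤ C) : supN f ≤ C := by
  have : Nonempty (Icc (0 : ℝ) 1) := ⟨⟨0, by simp⟩⟩
  exact ciSup_le fun ξ => h ξ ξ.2

theorem normV_nonneg (f : ℝ → ℝ) : 0 ≤ normV f := add_nonneg (supN_nonneg f) (normL1_nonneg _)

theorem normE_nonneg (X : Lag) : 0 ≤ normE X :=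
  add_nonneg (add_nonneg (normV_nonneg _) (normV_nonneg _)) (normL1_nonneg _)

theorem normV_add_le {f g : ℝ → ℝ} (hf : W11loc f) (hg : W11loc g) :
    normV (fun x => f x + g x) ≤ normV f + normV g := by
  have h1 : supN (fun x => f x + g x) ≤ supN f + supN g := supN_le fun ξ hξ =>
    (abs_add_le _ _).trans (add_le_add (abs_le_supN hf.continuous hξ)
      (abs_le_supN hg.continuous hξ))
  have h2 : normL1 (deriv fun x => f x + g x) ≤ normL1 (deriv f) + normL1 (deriv g) := by
    rw [normL1_congr (hf.deriv_add_ae hg)]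
    exact normL1_add_le hf.locallyIntegrable_deriv hg.locallyIntegrable_deriv
  simp only [normV_eq]
  linarith

theorem normV_const_mul (c : ℝ) (f : ℝ → ℝ) : normV (fun x => c * f x) = |c| * normV f := by
  have h1 : supN (fun x => c * f x) = |c| * supN f := by
    simp only [supN, abs_mul]
    exact (Real.mul_iSup_of_nonneg (abs_nonneg c) _).symm
  have h2 : deriv (fun x => c * f x) = fun x => c * deriv f x := by
    funext x; exact deriv_const_mul_field c
  rw [normV_eq, h1, h2, normL1_const_mul, normV_eq]; ring

/-- The part of `E` with periodic first component. -/
structure MemE0 (Z : Lag) : Prop where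
  y : MemW11per Z.y
  U : MemW11per Z.U
  ν : MemL1per Z.ν

/-- The part of `E` with first component in `V₁`. -/
structure MemE1 (X : Lag) : Prop where
  y : MemV1 X.y
  U : MemW11per X.U
  ν : MemL1per X.ν

theorem MemW11per.add {f g : ℝ → ℝ} (hf : MemW11per f) (hg : MemW11per g) :
    MemW11per (fun x => f x + g x) := ⟨hf.1.add hg.1, hf.2.add hg.2⟩

theorem MemW11per.sub {f g : ℝ → ℝ} (hf : MemW11per f) (hg : MemW11per g) :
    MemW11per (fun x => f x - g x) := ⟨hf.1.sub hg.1, hf.2.sub hg.2⟩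

theorem MemW11per.neg {f : ℝ → ℝ} (hf : MemW11per f) :
    MemW11per (fun x => -f x) := ⟨hf.1.neg, fun x => by simp only [hf.2 x]⟩

theorem MemW11per.const_mul {f : ℝ → ℝ} (c : ℝ) (hf : MemW11per f) :
    MemW11per (fun x => c * f x) := ⟨hf.1.const_mul c, fun x => by simp only [hf.2 x]⟩

theorem MemE1.sub {X Y : Lag} (hX : MemE1 X) (hY : MemE1 Y) : MemE0 (X - Y) where
  y := ⟨hX.y.1.sub hY.y.1, fun ξ => by
    change X.y (ξ + 1) - Y.y (ξ + 1) = X.y ξ - Y.y ξ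
    rw [hX.y.2, hY.y.2]; ring⟩
  U := hX.U.sub hY.U
  ν := hX.ν.sub hY.ν

theorem MemE0.sub {X Y : Lag} (hX : MemE0 X) (hY : MemE0 Y) : MemE0 (X - Y) where
  y := hX.y.sub hY.y
  U := hX.U.sub hY.U
  ν := hX.ν.sub hY.ν

theorem MemE0.add {X Y : Lag} (hX : MemE0 X) (hY : MemE0 Y) : MemE0 (X + Y) where
  y := hX.y.add hY.y
  U := hX.U.add hY.U
  ν := hX.ν.add hY.ν

theorem MemE0.smul (c : ℝ) {X : Lag} (hX : MemE0 X) : MemE0 (c • X) where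
  y := hX.y.const_mul c
  U := hX.U.const_mul c
  ν := hX.ν.const_mul c

theorem MemE0.memE {Z : Lag} (h : MemE0 Z) : MemE Z :=
  ⟨⟨h.y.1, 0, fun ξ => by rw [h.y.2 ξ, add_zero]⟩, h.U, h.ν⟩

theorem MemE1.memE {Z : Lag} (h : MemE1 Z) : MemE Z := ⟨⟨h.y.1, 1, h.y.2⟩, h.U, h.ν⟩

theorem normE_add_le {X Y : Lag} (hX : MemE0 X) (hY : MemE0 Y) :
    normE (X + Y) ≤ normE X + normE Y := by
  have h1 := normV_add_le hX.y.1 hY.y.1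
  have h2 := normV_add_le hX.U.1 hY.U.1
  have h3 := normL1_add_le hX.ν.1 hY.ν.1
  have : normE (X + Y) = normV (fun x => X.y x + Y.y x) + normV (fun x => X.U x + Y.U x) +
    normL1 (fun x => X.ν x + Y.ν x) := rfl
  rw [this]; unfold normE; linarith

theorem normE_smul (c : ℝ) (X : Lag) : normE (c • X) = |c| * normE X := by
  have : normE (c • X) = normV (fun x => c * X.y x) + normV (fun x => c * X.U x) +
    normL1 (fun x => c * X.ν x) := rfl
  rw [this, normV_const_mul, normV_const_mul, normL1_const_mul]; unfold normE; ring

theorem normE_neg (X : Lag) : normE (-X) = normE X := by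
  have := normE_smul (-1) X
  simpa using this

theorem normE_sub_comm (X Y : Lag) : normE (X - Y) = normE (Y - X) := by
  rw [← normE_neg, neg_sub]

theorem normE_zero : normE 0 = 0 := by
  have := normE_smul 0 0
  simpa using this

theorem normE_sub_le {X Y Z : Lag} (h1 : MemE0 (X - Y)) (h2 : MemE0 (Y - Z)) :
    normE (X - Z) ≤ normE (X - Y) + normE (Y - Z) := by
  have := normE_add_le h1 h2
  rwa [sub_add_sub_cancel] at this

theorem LagEq.refl (X : Lag) : LagEq X X := ⟨rfl, rfl, ae_eq_refl _⟩

theorem LagEq.symm {X Y : Lag} (h : LagEq X Y) : LagEq Y X := ⟨h.1.symm, h.2.1.symm, h.2.2.symm⟩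

theorem LagEq.trans {X Y Z : Lag} (h : LagEq X Y) (h' : LagEq Y Z) : LagEq X Z :=
  ⟨h.1.trans h'.1, h.2.1.trans h'.2.1, h.2.2.trans h'.2.2⟩

theorem LagEq.sub {X Y X' Y' : Lag} (h : LagEq X X') (h' : LagEq Y Y') :
    LagEq (X - Y) (X' - Y') := by
  refine ⟨?_, ?_, h.2.2.sub h'.2.2⟩
  · exact congrArg₂ (· - ·) h.1 h'.1
  · exact congrArg₂ (· - ·) h.2.1 h'.2.1

theorem LagEq.normE_eq {X Y : Lag} (h : LagEq X Y) : normE X = normE Y := by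
  unfold normE
  rw [h.1, h.2.1, normL1_congr h.2.2]

theorem LagEq.energy_eq {X Y : Lag} (h : LagEq X Y) : energy X = energy Y := normL1_congr h.2.2

theorem supN_y_le_normE (Z : Lag) : supN Z.y ≤ normE Z := by
  unfold normE
  linarith [normL1_nonneg (deriv Z.y), normV_nonneg Z.U, normL1_nonneg Z.ν, normV_eq Z.y]

theorem supN_U_le_normE (Z : Lag) : supN Z.U ≤ normE Z := by
  unfold normE
  linarith [normL1_nonneg (deriv Z.U), normV_nonneg Z.y, normL1_nonneg Z.ν, normV_eq Z.U]

theorem normL1_dy_le_normE (Z : Lag) : normL1 (deriv Z.y) ≤ normE Z := by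
  unfold normE
  linarith [supN_nonneg Z.y, normV_nonneg Z.U, normL1_nonneg Z.ν, normV_eq Z.y]

theorem normL1_dU_le_normE (Z : Lag) : normL1 (deriv Z.U) ≤ normE Z := by
  unfold normE
  linarith [supN_nonneg Z.U, normV_nonneg Z.y, normL1_nonneg Z.ν, normV_eq Z.U]

theorem normL1_ν_le_normE (Z : Lag) : normL1 Z.ν ≤ normE Z := by
  unfold normE
  linarith [normV_nonneg Z.U, normV_nonneg Z.y]

/-! ## Exponential convolutions along a characteristic -/

/-- The constant `1 / (1 - e⁻¹)`. -/
def kap : ℝ := (1 - Real.exp (-1))⁻¹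

theorem one_sub_exp_pos : 0 < 1 - Real.exp (-1) := by
  have : Real.exp (-1) < 1 := by rw [Real.exp_lt_one_iff]; norm_num
  linarith

theorem kap_pos : 0 < kap := inv_pos.2 one_sub_exp_pos

theorem kap_le_two : kap ≤ 2 := by
  unfold kap
  have h : Real.exp (-1) ≤ 1 / 2 := by
    rw [Real.exp_neg, inv_le_comm₀ (Real.exp_pos _) (by norm_num)]
    have := Real.add_one_le_exp (1 : ℝ)
    norm_num at this ⊢
    linarith
  rw [inv_le_comm₀ one_sub_exp_pos (by norm_num)]
  linarith

theorem kap_eq (c : ℝ) : c + Real.exp (-1) * (kap * c) = kap * c := by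
  have h : kap * (1 - Real.exp (-1)) = 1 := inv_mul_cancel₀ one_sub_exp_pos.ne'
  linear_combination (-c) * h

section Window

variable {y φ : ℝ → ℝ} (hy : Continuous y) (hy1 : ∀ ξ, y (ξ + 1) = y ξ + 1) (hφ : MemL1per φ)
include hy hφ

theorem locallyIntegrable_exp_mul : LocallyIntegrable (fun η => Real.exp (y η) * φ η) volume :=
  locallyIntegrable_of_intervalIntegrable fun a b =>
    (hφ.intervalIntegrable a b).continuousOn_mul (Real.continuous_exp.comp hy).continuousOn

omit hy in
include hy1 in
theorem integral_exp_mul_shift (a b : ℝ) :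
    ∫ η in (a - 1)..(b - 1), Real.exp (y η) * φ η =
      Real.exp (-1) * ∫ η in a..b, Real.exp (y η) * φ η := by
  rw [← intervalIntegral.integral_comp_sub_right, ← intervalIntegral.integral_const_mul]
  refine intervalIntegral.integral_congr_ae ?_
  filter_upwards [ae_comp_add hφ.2 (-1)] with x hx _
  have h1 : y x = y (x - 1) + 1 := by rw [← hy1]; ring_nf
  have h2 : φ (x - 1) = φ x := by
    rw [← sub_eq_add_neg] at hx
    rw [← hx]; ring_nf
  rw [h2, h1, Real.exp_add, ← mul_assoc, ← mul_assoc, mul_comm (Real.exp (-1)),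
    mul_assoc (Real.exp (y (x - 1))), ← Real.exp_add]
  simp

include hy1

theorem integral_norm_exp_mul_le (ξ : ℝ) (n : ℕ) :
    ∫ η in (ξ - n)..ξ, ‖Real.exp (y η) * φ η‖ ≤
      kap * ∫ η in (ξ - 1)..ξ, Real.exp (y η) * |φ η| := by
  have hI := fun a b => intervalIntegrable_of_locallyIntegrable
    (locallyIntegrable_exp_mul hy hφ.abs) a b
  simp only [norm_mul, Real.norm_eq_abs, Real.abs_exp]
  have hc : 0 ≤ ∫ η in (ξ - 1)..ξ, Real.exp (y η) * |φ η| :=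
    intervalIntegral.integral_nonneg (by linarith) fun x _ => by positivity
  induction n with
  | zero => simp only [Nat.cast_zero, sub_zero, intervalIntegral.integral_same]
            exact mul_nonneg kap_pos.le hc
  | succ k ih =>
    have h1 := integral_exp_mul_shift hy1 hφ.abs (ξ - k) ξ
    have e : ξ - ((k + 1 : ℕ) : ℝ) = ξ - k - 1 := by push_cast; ring
    rw [e, ← intervalIntegral.integral_add_adjacent_intervals (hI _ (ξ - 1)) (hI _ _), h1]
    rw [← kap_eq, add_comm]
    gcongr

theorem integrableOn_Iic_exp_mul (ξ : ℝ) :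
    IntegrableOn (fun η => Real.exp (y η) * φ η) (Iic ξ) :=
  integrableOn_Iic_of_intervalIntegral_norm_bounded (l := atTop) _ ξ
    (a := fun n : ℕ => ξ - n)
    (fun n => ((locallyIntegrable_exp_mul hy hφ).integrableOn_isCompact
      (isCompact_Icc (a := ξ - n) (b := ξ))).mono_set Ioc_subset_Icc_self)
    (tendsto_atBot_add_const_left atTop ξ
      (tendsto_neg_atTop_atBot.comp tendsto_natCast_atTop_atTop))
    (Eventually.of_forall (integral_norm_exp_mul_le hy hy1 hφ ξ))

theorem integral_Iic_exp_mul (ξ : ℝ) :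
    ∫ η in Iic ξ, Real.exp (y η) * φ η =
      kap * ∫ η in (ξ - 1)..ξ, Real.exp (y η) * φ η := by
  have hi := integrableOn_Iic_exp_mul hy hy1 hφ
  have hI := fun a b => intervalIntegrable_of_locallyIntegrable
    (locallyIntegrable_exp_mul hy hφ) a b
  have ht := intervalIntegral_tendsto_integral_Iic ξ (hi ξ) tendsto_id
  have ht2 := ht.comp (tendsto_atBot_add_const_right atBot (-1) tendsto_id)
  have hrec : ∀ a, ∫ η in (a + -1)..ξ, Real.exp (y η) * φ η =
      (∫ η in (ξ - 1)..ξ, Real.exp (y η) * φ η) +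
        Real.exp (-1) * ∫ η in a..ξ, Real.exp (y η) * φ η := by
    intro a
    rw [← integral_exp_mul_shift hy1 hφ, ← sub_eq_add_neg, add_comm,
      intervalIntegral.integral_add_adjacent_intervals (hI _ _) (hI _ _)]
  have ht3 := (ht.const_mul (Real.exp (-1))).const_add
    (∫ η in (ξ - 1)..ξ, Real.exp (y η) * φ η)
  have he := tendsto_nhds_unique (ht2.congr fun a => hrec a) ht3
  have h : kap * (1 - Real.exp (-1)) = 1 := inv_mul_cancel₀ one_sub_exp_pos.ne'
  set I := ∫ η in Iic ξ, Real.exp (y η) * φ η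
  linear_combination (1 * kap) * he - I * h

/-- The left exponential convolution. -/
theorem expL_window (ξ : ℝ) :
    Real.exp (-y ξ) * ∫ η in Iic ξ, Real.exp (y η) * φ η =
      kap * ∫ η in (ξ - 1)..ξ, Real.exp (y η - y ξ) * φ η := by
  rw [integral_Iic_exp_mul hy hy1 hφ, mul_left_comm, ← intervalIntegral.integral_const_mul]
  congr 2
  funext η
  rw [← mul_assoc, ← Real.exp_add]; ring_nf

end Window

/-- `∫_{-∞}^ξ exp(-(y(ξ)-y(η))) φ(η) dη`. -/
def expL (y φ : ℝ → ℝ) (ξ : ℝ) : ℝ := Real.exp (-y ξ) * ∫ η in Iic ξ, Real.exp (y η) * φ η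

/-- `∫_ξ^∞ exp(y(ξ)-y(η)) φ(η) dη`. -/
def expR (y φ : ℝ → ℝ) (ξ : ℝ) : ℝ := Real.exp (y ξ) * ∫ η in Ioi ξ, Real.exp (-y η) * φ η

theorem expR_eq (y φ : ℝ → ℝ) (ξ : ℝ) :
    expR y φ ξ = expL (fun η => -y (-η)) (fun η => φ (-η)) (-ξ) := by
  unfold expR expL
  have := integral_comp_neg_Iic (-ξ) (fun η => Real.exp (-y η) * φ η)
  rw [neg_neg] at this ⊢
  rw [this, neg_neg]

theorem ae_comp_neg {p : ℝ → Prop} (h : ∀ᵐ x, p x) : ∀ᵐ x, p (-x) :=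
  (Measure.measurePreserving_neg (volume : Measure ℝ)).quasiMeasurePreserving.ae h

theorem MemL1per.comp_neg {φ : ℝ → ℝ} (hφ : MemL1per φ) : MemL1per (fun η => φ (-η)) := by
  refine ⟨locallyIntegrable_of_intervalIntegrable fun a b => ?_, ?_⟩
  · have := (hφ.intervalIntegrable (-a) (-b)).comp_mul_left (c := -1)
    simpa using this
  · filter_upwards [ae_comp_neg (ae_comp_add hφ.2 (-1))] with x hx
    have h1 : -x + -1 + 1 = -x := by ring
    have h2 : -x + -1 = -(x + 1) := by ring
    rw [h1, h2] at hx
    exact hx.symm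

theorem normL1_comp_neg {φ : ℝ → ℝ} (hφ : MemL1per φ) :
    normL1 (fun η => φ (-η)) = normL1 φ := by
  rw [hφ.normL1_eq (-1)]
  unfold normL1
  have := intervalIntegral.integral_comp_neg (fun x => |φ x|) (a := 0) (b := 1)
  rw [this]; simp

/-- Oscillation at most `R` over distances at most one. -/
def OscLe (R : ℝ) (y : ℝ → ℝ) : Prop := ∀ a b, |a - b| ≤ 1 → |y a - y b| ≤ R

theorem OscLe.reflect {R : ℝ} {y : ℝ → ℝ} (h : OscLe R y) : OscLe R (fun η => -y (-η)) := by
  intro a b hab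
  have h1 := h (-b) (-a) (by rw [show -b - -a = a - b by ring]; exact hab)
  rwa [show -y (-a) - -y (-b) = y (-b) - y (-a) by ring]

theorem abs_exp_sub_exp_le {R p q : ℝ} (hp : p ≤ R) (hq : q ≤ R) :
    |Real.exp p - Real.exp q| ≤ Real.exp R * |p - q| := by
  wlog h : q ≤ p generalizing p q
  · rw [abs_sub_comm, abs_sub_comm p]; exact this hq hp (not_le.1 h).le
  rw [abs_of_nonneg (sub_nonneg.2 (Real.exp_le_exp.2 h)), abs_of_nonneg (sub_nonneg.2 h)]
  have h1 := Real.add_one_le_exp (q - p)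
  have h2 : Real.exp q = Real.exp p * Real.exp (q - p) := by rw [← Real.exp_add]; ring_nf
  calc Real.exp p - Real.exp q = Real.exp p * (1 - Real.exp (q - p)) := by rw [h2]; ring
    _ ≤ Real.exp p * (p - q) := by
        apply mul_le_mul_of_nonneg_left _ (Real.exp_pos _).le; linarith
    _ ≤ Real.exp R * (p - q) := by
        apply mul_le_mul_of_nonneg_right (Real.exp_le_exp.2 hp); linarith

section

variable {y φ y' φ' : ℝ → ℝ} (hy : Continuous y) (hy1 : ∀ ξ, y (ξ + 1) = y ξ + 1)
  (hφ : MemL1per φ)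
include hy hy1 hφ

theorem abs_expL_le {m : ℝ} (hm : ∀ a b, a ≤ b → b ≤ a + 1 → y a - y b ≤ m) (ξ : ℝ) :
    |expL y φ ξ| ≤ kap * (Real.exp m * normL1 φ) := by
  rw [expL, expL_window hy hy1 hφ, abs_mul, abs_of_pos kap_pos]
  have hle : ξ - 1 ≤ ξ := by linarith
  have hi := intervalIntegrable_of_locallyIntegrable
    (locallyIntegrable_exp_mul (y := fun η => y η - y ξ) (hy.sub continuous_const) hφ) (ξ - 1) ξ
  refine mul_le_mul_of_nonneg_left ?_ kap_pos.le
  calc |∫ η in (ξ - 1)..ξ, Real.exp (y η - y ξ) * φ η|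
      ≤ ∫ η in (ξ - 1)..ξ, |Real.exp (y η - y ξ) * φ η| :=
        intervalIntegral.abs_integral_le_integral_abs hle
    _ ≤ ∫ η in (ξ - 1)..ξ, Real.exp m * |φ η| := by
        refine intervalIntegral.integral_mono_on hle hi.abs
          ((hφ.abs.intervalIntegrable _ _).const_mul _) fun η hη => ?_
        rw [abs_mul, Real.abs_exp]
        refine mul_le_mul_of_nonneg_right (Real.exp_le_exp.2 ?_) (abs_nonneg _)
        exact hm _ _ hη.2 (by linarith [hη.1])
    _ = Real.exp m * ∫ η in (ξ - 1)..ξ, |φ η| := intervalIntegral.integral_const_mul _ _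
    _ ≤ Real.exp m * normL1 φ :=
        mul_le_mul_of_nonneg_left (hφ.integral_abs_le hle (by linarith)) (Real.exp_pos _).le

theorem abs_expL_sub_le (hy' : Continuous y') (hy1' : ∀ ξ, y' (ξ + 1) = y' ξ + 1)
    (hφ' : MemL1per φ') {R δ : ℝ} (hR : OscLe R y) (hR' : OscLe R y')
    (hδ : ∀ ξ, |y ξ - y' ξ| ≤ δ) (ξ : ℝ) :
    |expL y φ ξ - expL y' φ' ξ| ≤
      kap * (Real.exp R * (2 * δ * normL1 φ + normL1 (fun η => φ η - φ' η))) := by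
  rw [expL, expL, expL_window hy hy1 hφ, expL_window hy' hy1' hφ', ← mul_sub, abs_mul,
    abs_of_pos kap_pos]
  have hle : ξ - 1 ≤ ξ := by linarith
  have hi := intervalIntegrable_of_locallyIntegrable
    (locallyIntegrable_exp_mul (y := fun η => y η - y ξ) (hy.sub continuous_const) hφ) (ξ - 1) ξ
  have hi' := intervalIntegrable_of_locallyIntegrable
    (locallyIntegrable_exp_mul (y := fun η => y' η - y' ξ) (hy'.sub continuous_const) hφ')
    (ξ - 1) ξ
  refine mul_le_mul_of_nonneg_left ?_ kap_pos.le
  rw [← intervalIntegral.integral_sub hi hi']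
  have hδ0 : 0 ≤ δ := (abs_nonneg _).trans (hδ ξ)
  have ha := (hφ.abs.intervalIntegrable (ξ - 1) ξ)
  have hb := ((hφ.sub hφ').abs.intervalIntegrable (ξ - 1) ξ)
  calc |∫ η in (ξ - 1)..ξ, (Real.exp (y η - y ξ) * φ η - Real.exp (y' η - y' ξ) * φ' η)|
      ≤ ∫ η in (ξ - 1)..ξ, |Real.exp (y η - y ξ) * φ η - Real.exp (y' η - y' ξ) * φ' η| :=
        intervalIntegral.abs_integral_le_integral_abs hle
    _ ≤ ∫ η in (ξ - 1)..ξ, Real.exp R * (2 * δ * |φ η| + |φ η - φ' η|) := by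
        refine intervalIntegral.integral_mono_on hle (hi.sub hi').abs
          (((ha.const_mul _).add hb).const_mul _) fun η hη => ?_
        have hη1 : |η - ξ| ≤ 1 := by rw [abs_le]; constructor <;> linarith [hη.1, hη.2]
        have h1 : y η - y ξ ≤ R := (le_abs_self _).trans (hR _ _ hη1)
        have h2 : y' η - y' ξ ≤ R := (le_abs_self _).trans (hR' _ _ hη1)
        have h3 : |(y η - y ξ) - (y' η - y' ξ)| ≤ 2 * δ := by
          rw [show (y η - y ξ) - (y' η - y' ξ) = (y η - y' η) - (y ξ - y' ξ) by ring]
          exact (abs_sub _ _).trans (by linarith [hδ η, hδ ξ])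
        have e : Real.exp (y η - y ξ) * φ η - Real.exp (y' η - y' ξ) * φ' η =
          (Real.exp (y η - y ξ) - Real.exp (y' η - y' ξ)) * φ η +
            Real.exp (y' η - y' ξ) * (φ η - φ' η) := by ring
        rw [e]
        refine (abs_add_le _ _).trans ?_
        rw [abs_mul, abs_mul, Real.abs_exp, mul_add]
        refine add_le_add ?_ ?_
        · rw [← mul_assoc]
          refine mul_le_mul_of_nonneg_right ?_ (abs_nonneg _)
          exact (abs_exp_sub_exp_le h1 h2).trans
            (mul_le_mul_of_nonneg_left h3 (Real.exp_pos _).le)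
        · exact mul_le_mul_of_nonneg_right (Real.exp_le_exp.2 h2) (abs_nonneg _)
    _ = Real.exp R * (2 * δ * (∫ η in (ξ - 1)..ξ, |φ η|) +
          ∫ η in (ξ - 1)..ξ, |φ η - φ' η|) := by
        rw [intervalIntegral.integral_const_mul, intervalIntegral.integral_add (ha.const_mul _) hb,
          intervalIntegral.integral_const_mul]
    _ ≤ _ := by
        refine mul_le_mul_of_nonneg_left ?_ (Real.exp_pos _).le
        exact add_le_add (mul_le_mul_of_nonneg_left (hφ.integral_abs_le hle (by linarith))
          (by linarith)) ((hφ.sub hφ').integral_abs_le hle (by linarith))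

theorem expL_periodic : Function.Periodic (expL y φ) 1 := by
  intro ξ
  rw [expL, expL, expL_window hy hy1 hφ, expL_window hy hy1 hφ]
  congr 1
  have h := integral_exp_mul_shift (y := fun η => y η) hy1 hφ (ξ + 1 - 1 + 1) (ξ + 1)
  have e1 : ∀ c : ℝ, ∀ a b : ℝ, ∫ η in a..b, Real.exp (y η - c) * φ η =
      Real.exp (-c) * ∫ η in a..b, Real.exp (y η) * φ η := by
    intro c a b
    rw [← intervalIntegral.integral_const_mul]
    congr 1; funext η
    rw [← mul_assoc, ← Real.exp_add]; ring_nf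
  have h := integral_exp_mul_shift hy1 hφ (ξ + 1 - 1) (ξ + 1)
  rw [e1, e1, hy1]
  rw [show ξ + 1 - 1 - 1 = ξ - 1 by ring, show ξ + 1 - 1 = ξ by ring] at h
  rw [show ξ + 1 - 1 = ξ by ring, h, ← mul_assoc, ← Real.exp_add]; ring_nf

end

section

variable {y φ : ℝ → ℝ} (hy : W11loc y) (hy1 : ∀ ξ, y (ξ + 1) = y ξ + 1) (hφ : MemL1per φ)
include hy hy1 hφ

theorem expL_W11loc : W11loc (expL y φ) ∧
    deriv (expL y φ) =ᵐ[volume] fun ξ => -deriv y ξ * expL y φ ξ + φ ξ := by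
  have hl := locallyIntegrable_exp_mul hy.continuous hφ
  have e : ∀ ξ, ∫ η in Iic ξ, Real.exp (y η) * φ η =
      (∫ η in Iic 0, Real.exp (y η) * φ η) + ∫ η in (0 : ℝ)..ξ, Real.exp (y η) * φ η := by
    intro ξ
    rw [← intervalIntegral.integral_Iic_sub_Iic
      (integrableOn_Iic_exp_mul hy.continuous hy1 hφ 0)
      (integrableOn_Iic_exp_mul hy.continuous hy1 hφ ξ)]
    ring
  have e2 : expL y φ = fun ξ => Real.exp (-y ξ) *
      ((∫ η in Iic 0, Real.exp (y η) * φ η) + ∫ η in (0 : ℝ)..ξ, Real.exp (y η) * φ η) := by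
    funext ξ; rw [expL, e]
  constructor
  · rw [e2]; exact hy.neg.exp.mul (W11loc.primitive _ 0 hl)
  · filter_upwards [hy.ae_differentiableAt, W11loc.ae_hasDerivAt_primitive
      (∫ η in Iic 0, Real.exp (y η) * φ η) 0 hl] with x h1 h2
    have h3 := (h1.hasDerivAt.neg.exp).mul h2
    refine ((congrArg (fun f => deriv f x) e2).trans h3.deriv).trans ?_
    rw [e2]
    simp only [Pi.neg_apply]
    have : Real.exp (-y x) * Real.exp (y x) = 1 := by rw [← Real.exp_add]; simp
    linear_combination φ x * this

theorem integrableOn_Ioi_exp_mul (ξ : ℝ) :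
    IntegrableOn (fun η => Real.exp (-y η) * φ η) (Ioi ξ) := by
  have hr : ∀ ξ, -y (-(ξ + 1)) = -y (-ξ) + 1 := fun ξ => by
    have := hy1 (-(ξ + 1)); rw [show -(ξ + 1) + 1 = -ξ by ring] at this; linarith
  have := integrableOn_Iic_exp_mul (y := fun η => -y (-η)) (φ := fun η => φ (-η))
    (hy.continuous.comp continuous_neg).neg hr hφ.comp_neg (-ξ)
  have h2 := (integrableOn_Ici_iff_integrableOn_Ioi (f := fun η => Real.exp (-y η) * φ η)
    (μ := volume) (b := ξ))
  rw [← h2]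
  have h3 := (Measure.measurePreserving_neg (volume : Measure ℝ)).integrableOn_comp_preimage
    (f := fun η => Real.exp (-y η) * φ η) (s := Ici ξ) (Homeomorph.neg ℝ).measurableEmbedding
  rw [← h3]
  simpa [Function.comp_def] using this

theorem expR_W11loc : W11loc (expR y φ) ∧
    deriv (expR y φ) =ᵐ[volume] fun ξ => deriv y ξ * expR y φ ξ - φ ξ := by
  have hl := locallyIntegrable_exp_mul (y := fun η => -y η) hy.neg.continuous hφ
  have e : ∀ ξ, ∫ η in Ioi ξ, Real.exp (-y η) * φ η =
      (∫ η in Ioi 0, Real.exp (-y η) * φ η) - ∫ η in (0 : ℝ)..ξ, Real.exp (-y η) * φ η := by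
    intro ξ
    have := intervalIntegral.integral_Ioi_sub_Ioi'
      (integrableOn_Ioi_exp_mul hy hy1 hφ 0)
      (integrableOn_Ioi_exp_mul hy hy1 hφ ξ)
    rw [← this]; ring
  have e2 : expR y φ = fun ξ => Real.exp (y ξ) *
      ((∫ η in Ioi 0, Real.exp (-y η) * φ η) + -∫ η in (0 : ℝ)..ξ, Real.exp (-y η) * φ η) := by
    funext ξ; rw [expR, e, sub_eq_add_neg]
  have hp := W11loc.primitive 0 0 hl
  simp only [zero_add] at hp
  constructor
  · rw [e2]; exact hy.exp.mul ((W11loc.const _).add hp.neg)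
  · have h2 := W11loc.ae_hasDerivAt_primitive 0 0 hl
    simp only [zero_add] at h2
    filter_upwards [hy.ae_differentiableAt, h2] with x h1 h2
    have h3 := (h1.hasDerivAt.exp).mul (h2.neg.const_add (∫ η in Ioi 0, Real.exp (-y η) * φ η))
    refine ((congrArg (fun f => deriv f x) e2).trans h3.deriv).trans ?_
    rw [e2]
    simp only [Pi.neg_apply]
    have : Real.exp (-y x) * Real.exp (y x) = 1 := by rw [← Real.exp_add]; simp
    linear_combination (-φ x) * this

end


/-! ## The nonlocal terms `P` and `Q` -/

/-- The density `U² y_ξ + ν`. -/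
def dens (X : Lag) (η : ℝ) : ℝ := (X.U η) ^ 2 * deriv X.y η + X.ν η

namespace MemE1

variable {X Y : Lag}

theorem memL1per_dy (hX : MemE1 X) : MemL1per (deriv X.y) := hX.y.1.memL1per_deriv hX.y.2

theorem memL1per_dU (hX : MemE1 X) : MemL1per (deriv X.U) := hX.U.memL1per_deriv

theorem memL1per_dens (hX : MemE1 X) : MemL1per (dens X) :=
  (hX.memL1per_dy.continuous_mul (hX.U.1.continuous.pow 2)
    (fun ξ => by simp only [Pi.pow_apply, hX.U.2 ξ])).add hX.ν

theorem exp_split (hX : MemE1 X) (s : ℝ → ℝ) (ξ : ℝ) :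
    ∫ η : ℝ, s (Real.sign (ξ - η)) * Real.exp (-Real.sign (ξ - η) * (X.y ξ - X.y η)) * dens X η =
      s 1 * expL X.y (dens X) ξ + s (-1) * expR X.y (dens X) ξ := by
  have hc := hX.y.1.continuous
  have e1 : ∀ᵐ η : ℝ, η ∈ Iic ξ →
      s 1 * (Real.exp (-X.y ξ) * (Real.exp (X.y η) * dens X η)) =
      s (Real.sign (ξ - η)) * Real.exp (-Real.sign (ξ - η) * (X.y ξ - X.y η)) * dens X η := by
    have : ∀ᵐ η : ℝ, η ≠ ξ := by simp [ae_iff, measure_singleton]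
    filter_upwards [this] with η h1 h2
    rw [Real.sign_of_pos (sub_pos.2 (lt_of_le_of_ne h2 h1)), mul_assoc, ← mul_assoc (Real.exp _),
      ← Real.exp_add]
    ring_nf
  have e2 : ∀ η ∈ Ioi ξ,
      s (-1) * (Real.exp (X.y ξ) * (Real.exp (-X.y η) * dens X η)) =
      s (Real.sign (ξ - η)) * Real.exp (-Real.sign (ξ - η) * (X.y ξ - X.y η)) * dens X η := by
    intro η h2
    rw [Real.sign_of_neg (sub_neg.2 h2), mul_assoc, ← mul_assoc (Real.exp _),
      ← Real.exp_add]
    ring_nf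
  have i1 := ((integrableOn_Iic_exp_mul hc hX.y.2 hX.memL1per_dens ξ).const_mul
    (Real.exp (-X.y ξ))).const_mul (s 1)
  have i2 := ((integrableOn_Ioi_exp_mul hX.y.1 hX.y.2 hX.memL1per_dens ξ).const_mul
    (Real.exp (X.y ξ))).const_mul (s (-1))
  rw [← intervalIntegral.integral_Iic_add_Ioi (b := ξ)
    (i1.congr ((ae_restrict_iff' measurableSet_Iic).2 e1))
    (i2.congr ((ae_restrict_iff' measurableSet_Ioi).2 (Eventually.of_forall e2))),
    ← setIntegral_congr_ae measurableSet_Iic e1, ← setIntegral_congr_fun measurableSet_Ioi e2,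
    integral_const_mul, integral_const_mul, integral_const_mul, integral_const_mul]
  rfl

theorem Qop_eq (hX : MemE1 X) (ξ : ℝ) :
    Qop X ξ = -(1 / 4) * (expL X.y (dens X) ξ - expR X.y (dens X) ξ) := by
  have := hX.exp_split (fun x => x) ξ
  unfold Qop
  simp only [dens] at this ⊢
  rw [this]; ring

theorem Pop_eq (hX : MemE1 X) (ξ : ℝ) :
    Pop X ξ = (1 / 4) * (expL X.y (dens X) ξ + expR X.y (dens X) ξ) := by
  have := hX.exp_split (fun _ => 1) ξ
  unfold Pop
  simp only [dens, one_mul] at this ⊢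
  rw [this]

theorem expL_W (hX : MemE1 X) : W11loc (expL X.y (dens X)) ∧ deriv (expL X.y (dens X))
    =ᵐ[volume] fun ξ => -deriv X.y ξ * expL X.y (dens X) ξ + dens X ξ :=
  expL_W11loc hX.y.1 hX.y.2 hX.memL1per_dens

theorem expR_W (hX : MemE1 X) : W11loc (expR X.y (dens X)) ∧ deriv (expR X.y (dens X))
    =ᵐ[volume] fun ξ => deriv X.y ξ * expR X.y (dens X) ξ - dens X ξ :=
  expR_W11loc hX.y.1 hX.y.2 hX.memL1per_dens

theorem reflect_add_one (hX : MemE1 X) (ξ : ℝ) : -X.y (-(ξ + 1)) = -X.y (-ξ) + 1 := by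
  have := hX.y.2 (-(ξ + 1)); rw [show -(ξ + 1) + 1 = -ξ by ring] at this; linarith

theorem continuous_reflect (hX : MemE1 X) : Continuous fun η => -X.y (-η) :=
  (hX.y.1.continuous.comp continuous_neg).neg

theorem expL_per (hX : MemE1 X) : Function.Periodic (expL X.y (dens X)) 1 :=
  expL_periodic hX.y.1.continuous hX.y.2 hX.memL1per_dens

theorem expR_per (hX : MemE1 X) : Function.Periodic (expR X.y (dens X)) 1 := by
  intro ξ
  rw [expR_eq, expR_eq]
  have := expL_periodic hX.continuous_reflect hX.reflect_add_one hX.memL1per_dens.comp_neg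
    (-(ξ + 1))
  rw [← this]; congr 1; ring

theorem Qop_fun_eq (hX : MemE1 X) :
    Qop X = fun ξ => -(1 / 4) * (expL X.y (dens X) ξ - expR X.y (dens X) ξ) :=
  funext hX.Qop_eq

theorem Pop_fun_eq (hX : MemE1 X) :
    Pop X = fun ξ => (1 / 4) * (expL X.y (dens X) ξ + expR X.y (dens X) ξ) :=
  funext hX.Pop_eq

theorem memW11per_Qop (hX : MemE1 X) : MemW11per (Qop X) := by
  rw [hX.Qop_fun_eq]
  exact ⟨(hX.expL_W.1.sub hX.expR_W.1).const_mul _, fun ξ => by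
    simp only [hX.expL_per ξ, hX.expR_per ξ]⟩

theorem memW11per_Pop (hX : MemE1 X) : MemW11per (Pop X) := by
  rw [hX.Pop_fun_eq]
  exact ⟨(hX.expL_W.1.add hX.expR_W.1).const_mul _, fun ξ => by
    simp only [hX.expL_per ξ, hX.expR_per ξ]⟩

theorem deriv_Qop (hX : MemE1 X) :
    deriv (Qop X) =ᵐ[volume] fun ξ => deriv X.y ξ * Pop X ξ - dens X ξ / 2 := by
  filter_upwards [hX.expL_W.2, hX.expR_W.2, hX.expL_W.1.ae_differentiableAt,
    hX.expR_W.1.ae_differentiableAt] with ξ h1 h2 h3 h4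
  rw [hX.Qop_fun_eq, deriv_const_mul_field, deriv_fun_sub h3 h4, h1, h2, hX.Pop_eq]
  ring

theorem deriv_Pop (hX : MemE1 X) :
    deriv (Pop X) =ᵐ[volume] fun ξ => deriv X.y ξ * Qop X ξ := by
  filter_upwards [hX.expL_W.2, hX.expR_W.2, hX.expL_W.1.ae_differentiableAt,
    hX.expR_W.1.ae_differentiableAt] with ξ h1 h2 h3 h4
  rw [hX.Pop_fun_eq, deriv_const_mul_field, deriv_fun_add h3 h4, h1, h2, hX.Qop_eq]
  ring

theorem memE0_vecField (hX : MemE1 X) : MemE0 (vecField X) where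
  y := hX.U
  U := hX.memW11per_Qop.neg
  ν := by
    have h1 := hX.memL1per_dy.continuous_mul (g := fun ξ => -2 * Qop X ξ * X.U ξ)
      ((continuous_const.mul hX.memW11per_Qop.1.continuous).mul hX.U.1.continuous)
      (fun ξ => by simp only [hX.memW11per_Qop.2 ξ, hX.U.2 ξ])
    have h2 := hX.memL1per_dU.continuous_mul (g := fun ξ => 3 * (X.U ξ) ^ 2 - 2 * Pop X ξ)
      ((continuous_const.mul (hX.U.1.continuous.pow 2)).sub
        (continuous_const.mul hX.memW11per_Pop.1.continuous))
      (fun ξ => by simp only [hX.memW11per_Pop.2 ξ, hX.U.2 ξ])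
    exact h1.add h2

/-- General sup bound for `P` and `Q`. -/
theorem abs_PQ_le (hX : MemE1 X) {m : ℝ}
    (hm : ∀ a b, a ≤ b → b ≤ a + 1 → X.y a - X.y b ≤ m) (ξ : ℝ) :
    |Pop X ξ| ≤ Real.exp m * normL1 (dens X) ∧ |Qop X ξ| ≤ Real.exp m * normL1 (dens X) := by
  have h1 := abs_expL_le hX.y.1.continuous hX.y.2 hX.memL1per_dens hm ξ
  have h2 := abs_expL_le hX.continuous_reflect hX.reflect_add_one hX.memL1per_dens.comp_neg
    (m := m) (fun a b hab hb => by
      have := hm (-b) (-a) (by linarith) (by linarith); linarith) (-ξ)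
  rw [← expR_eq, normL1_comp_neg hX.memL1per_dens] at h2
  have h3 : kap * (Real.exp m * normL1 (dens X)) ≤ 2 * (Real.exp m * normL1 (dens X)) :=
    mul_le_mul_of_nonneg_right kap_le_two (mul_nonneg (Real.exp_pos _).le (normL1_nonneg _))
  rw [hX.Pop_eq, hX.Qop_eq]
  rw [abs_le] at h1 h2
  constructor <;> rw [abs_le] <;> constructor <;> linarith [h1.1, h1.2, h2.1, h2.2]

end MemE1

/-! ## Lipschitz estimates for the vector field -/

/-- The quantities on which the Lipschitz constants of the vector field depend. -/
structure SizeLe (R : ℝ) (X : Lag) : Prop where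
  U : ∀ ξ, |X.U ξ| ≤ R
  dy : normL1 (deriv X.y) ≤ R
  dU : normL1 (deriv X.U) ≤ R
  ν : normL1 X.ν ≤ R

theorem SizeLe.of_normE (X : Lag) (hX : MemE1 X) : SizeLe (normE X) X where
  U := fun ξ => (abs_le_supN_of_periodic hX.U.1.continuous hX.U.2 ξ).trans (supN_U_le_normE X)
  dy := normL1_dy_le_normE X
  dU := normL1_dU_le_normE X
  ν := normL1_ν_le_normE X

theorem SizeLe.mono {R R' : ℝ} {X : Lag} (h : SizeLe R X) (hR : R ≤ R') : SizeLe R' X :=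
  ⟨fun ξ => (h.U ξ).trans hR, h.dy.trans hR, h.dU.trans hR, h.ν.trans hR⟩

theorem SizeLe.nonneg {R : ℝ} {X : Lag} (h : SizeLe R X) : 0 ≤ R :=
  (normL1_nonneg _).trans h.ν

theorem SizeLe.osc {R : ℝ} {X : Lag} (h : SizeLe R X) (hX : MemE1 X) : OscLe R X.y := by
  intro a b hab
  wlog hle : a ≤ b generalizing a b
  · rw [abs_sub_comm]; exact this b a (by rwa [abs_sub_comm]) (not_le.1 hle).le
  rw [abs_sub_comm]
  refine (hX.y.1.abs_sub_le hle).trans ((hX.memL1per_dy.integral_abs_le hle ?_).trans h.dy)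
  rw [abs_sub_comm, abs_of_nonneg (sub_nonneg.2 hle)] at hab
  linarith

theorem SizeLe.normL1_dens_le {R : ℝ} {X : Lag} (h : SizeLe R X) (hX : MemE1 X) :
    normL1 (dens X) ≤ R ^ 3 + R := by
  have h1 : normL1 (dens X) ≤ ∫ x in (0 : ℝ)..1, (R ^ 2 * |deriv X.y x| + |X.ν x|) := by
    refine normL1_mono hX.memL1per_dens.1 ((hX.memL1per_dy.abs.const_mul _).add hX.ν.abs).1
      (Eventually.of_forall fun x => (abs_add_le _ _).trans ?_)
    rw [abs_mul, abs_pow]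
    gcongr
    exact h.U x
  rw [intervalIntegral.integral_add ((hX.memL1per_dy.abs.const_mul _).intervalIntegrable _ _)
    (hX.ν.abs.intervalIntegrable _ _), intervalIntegral.integral_const_mul] at h1
  have h2 : R ^ 2 * (∫ x in (0 : ℝ)..1, |deriv X.y x|) ≤ R ^ 2 * R :=
    mul_le_mul_of_nonneg_left h.dy (sq_nonneg R)
  have h3 : (∫ x in (0 : ℝ)..1, |X.ν x|) ≤ R := h.ν
  linarith [h1, h2, h3, pow_succ R 2]

section Diff

variable {X Y : Lag} (hX : MemE1 X) (hY : MemE1 Y)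
include hX hY

theorem abs_y_sub_le (ξ : ℝ) : |X.y ξ - Y.y ξ| ≤ normE (X - Y) :=
  (abs_le_supN_of_periodic (hX.sub hY).y.1.continuous (hX.sub hY).y.2 ξ).trans
    (supN_y_le_normE (X - Y))

theorem abs_U_sub_le (ξ : ℝ) : |X.U ξ - Y.U ξ| ≤ normE (X - Y) :=
  (abs_le_supN_of_periodic (hX.sub hY).U.1.continuous (hX.sub hY).U.2 ξ).trans
    (supN_U_le_normE (X - Y))

theorem normL1_dy_sub_le : normL1 (fun x => deriv X.y x - deriv Y.y x) ≤ normE (X - Y) := by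
  rw [← normL1_congr (hX.y.1.deriv_sub_ae hY.y.1)]
  exact normL1_dy_le_normE (X - Y)

theorem normL1_dU_sub_le : normL1 (fun x => deriv X.U x - deriv Y.U x) ≤ normE (X - Y) := by
  rw [← normL1_congr (hX.U.1.deriv_sub_ae hY.U.1)]
  exact normL1_dU_le_normE (X - Y)

omit hX hY in
theorem normL1_ν_sub_le : normL1 (fun x => X.ν x - Y.ν x) ≤ normE (X - Y) :=
  normL1_ν_le_normE (X - Y)

theorem normL1_dens_sub_le {R : ℝ} (h : SizeLe R X) (h' : SizeLe R Y) :
    normL1 (fun x => dens X x - dens Y x) ≤ (3 * R ^ 2 + 1) * normE (X - Y) := by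
  have hR := h.nonneg
  have hD := normE_nonneg (X - Y)
  set D := normE (X - Y)
  have i1 := hX.memL1per_dy.abs.const_mul (2 * R * D)
  have i2 := (hX.memL1per_dy.sub hY.memL1per_dy).abs.const_mul (R ^ 2)
  have i3 := (hX.ν.sub hY.ν).abs
  have h1 : normL1 (fun x => dens X x - dens Y x) ≤ ∫ x in (0 : ℝ)..1,
      (2 * R * D * |deriv X.y x| + R ^ 2 * |deriv X.y x - deriv Y.y x| + |X.ν x - Y.ν x|) := by
    refine normL1_mono (hX.memL1per_dens.sub hY.memL1per_dens).1 ((i1.add i2).add i3).1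
      (Eventually.of_forall fun x => ?_)
    have e : dens X x - dens Y x = (X.U x + Y.U x) * (X.U x - Y.U x) * deriv X.y x +
      Y.U x ^ 2 * (deriv X.y x - deriv Y.y x) + (X.ν x - Y.ν x) := by unfold dens; ring
    rw [e]
    refine (abs_add_le _ _).trans (add_le_add_left ((abs_add_le _ _).trans ?_) _)
    rw [abs_mul, abs_mul, abs_mul, abs_pow]
    have a1 := h.U x
    have a2 := h'.U x
    have a3 := abs_U_sub_le hX hY x
    have a4 : |X.U x + Y.U x| ≤ 2 * R := (abs_add_le _ _).trans (by linarith)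
    gcongr
  rw [intervalIntegral.integral_add ((i1.add i2).intervalIntegrable _ _)
    (i3.intervalIntegrable _ _), intervalIntegral.integral_add (i1.intervalIntegrable _ _)
    (i2.intervalIntegrable _ _), intervalIntegral.integral_const_mul,
    intervalIntegral.integral_const_mul] at h1
  have j1 : (∫ x in (0 : ℝ)..1, |deriv X.y x|) ≤ R := h.dy
  have j2 : (∫ x in (0 : ℝ)..1, |deriv X.y x - deriv Y.y x|) ≤ D := normL1_dy_sub_le hX hY
  have j3 : (∫ x in (0 : ℝ)..1, |X.ν x - Y.ν x|) ≤ D := normL1_ν_sub_le (X := X) (Y := Y)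
  have k1 := mul_le_mul_of_nonneg_left j1 (show 0 ≤ 2 * R * D by positivity)
  have k2 := mul_le_mul_of_nonneg_left j2 (show 0 ≤ R ^ 2 by positivity)
  calc _ ≤ _ := h1
    _ ≤ 2 * R * D * R + R ^ 2 * D + D := by gcongr
    _ = _ := by ring

theorem abs_PQ_sub_le {R : ℝ} (h : SizeLe R X) (h' : SizeLe R Y) (ξ : ℝ) :
    |Pop X ξ - Pop Y ξ| ≤ Real.exp R * (2 * (R ^ 3 + R) + (3 * R ^ 2 + 1)) * normE (X - Y) ∧
    |Qop X ξ - Qop Y ξ| ≤ Real.exp R * (2 * (R ^ 3 + R) + (3 * R ^ 2 + 1)) * normE (X - Y) := by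
  have hD := normE_nonneg (X - Y)
  have hR := h.nonneg
  have hd := abs_y_sub_le hX hY
  have h0 := normL1_dens_sub_le hX hY h h'
  have h1 := abs_expL_sub_le hX.y.1.continuous hX.y.2 hX.memL1per_dens hY.y.1.continuous hY.y.2
    hY.memL1per_dens (h.osc hX) (h'.osc hY) hd ξ
  have h2 := abs_expL_sub_le hX.continuous_reflect hX.reflect_add_one
    hX.memL1per_dens.comp_neg hY.continuous_reflect hY.reflect_add_one
    hY.memL1per_dens.comp_neg (h.osc hX).reflect (h'.osc hY).reflect (δ := normE (X - Y))
    (fun η => by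
      have := hd (-η)
      rwa [abs_sub_comm, show Y.y (-η) - X.y (-η) = -X.y (-η) - -Y.y (-η) by ring] at this) (-ξ)
  rw [← expR_eq, ← expR_eq, normL1_comp_neg hX.memL1per_dens,
    normL1_comp_neg (φ := fun η => dens X η - dens Y η)
      (hX.memL1per_dens.sub hY.memL1per_dens)] at h2
  set D := normE (X - Y)
  have h3 : kap * (Real.exp R * (2 * D * normL1 (dens X) +
      normL1 fun η => dens X η - dens Y η)) ≤
      2 * (Real.exp R * (2 * (R ^ 3 + R) + (3 * R ^ 2 + 1)) * D) := by
    have a1 : 2 * D * normL1 (dens X) + (normL1 fun η => dens X η - dens Y η) ≤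
        (2 * (R ^ 3 + R) + (3 * R ^ 2 + 1)) * D := by
      have := mul_le_mul_of_nonneg_left (h.normL1_dens_le hX) (show 0 ≤ 2 * D by positivity)
      linarith
    have a2 : 0 ≤ 2 * D * normL1 (dens X) + (normL1 fun η => dens X η - dens Y η) :=
      add_nonneg (mul_nonneg (by positivity) (normL1_nonneg _)) (normL1_nonneg _)
    rw [mul_assoc (Real.exp R)]
    exact mul_le_mul kap_le_two (mul_le_mul_of_nonneg_left a1 (Real.exp_pos _).le)
      (mul_nonneg (Real.exp_pos _).le a2) (by norm_num)
  rw [hX.Pop_eq, hX.Qop_eq, hY.Pop_eq, hY.Qop_eq]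
  rw [abs_le] at h1 h2
  constructor <;> rw [abs_le] <;> constructor <;> linarith [h1.1, h1.2, h2.1, h2.2]

end Diff

/-- The time derivative of `U_ξ`. -/
def rateB (U P a ν : ℝ) : ℝ := (U ^ 2 * a + ν) / 2 - a * P

/-- The time derivative of `ν`. -/
def rateN (U P Q a b : ℝ) : ℝ := -2 * Q * U * a + (3 * U ^ 2 - 2 * P) * b

section Pointwise

variable {R U U' P P' Q Q' a a' b b' ν ν' : ℝ}

theorem abs_rateB_le (hU : |U| ≤ R) (hP : |P| ≤ R) :
    |rateB U P a ν| ≤ (R ^ 2 + R) * |a| + |ν| := by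
  have hR : 0 ≤ R := (abs_nonneg U).trans hU
  have e : rateB U P a ν = (1 / 2) * U ^ 2 * a + (1 / 2) * ν + (-P) * a := by
    unfold rateB; ring
  rw [e]
  refine (abs_add_le _ _).trans ?_
  refine (add_le_add (abs_add_le _ _) le_rfl).trans ?_
  simp only [abs_mul, abs_pow, abs_neg]
  have h2 : |(1 / 2 : ℝ)| = 1 / 2 := by norm_num
  rw [h2]
  have : |U| ^ 2 ≤ R ^ 2 := by gcongr
  have h3 : |U| ^ 2 * |a| ≤ R ^ 2 * |a| := by gcongr
  have h4 : |P| * |a| ≤ R * |a| := by gcongr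
  nlinarith [abs_nonneg ν, abs_nonneg a, mul_nonneg (sq_nonneg R) (abs_nonneg a)]

theorem abs_rateN_le (hU : |U| ≤ R) (hP : |P| ≤ R) (hQ : |Q| ≤ R) :
    |rateN U P Q a b| ≤ 2 * R ^ 2 * |a| + (3 * R ^ 2 + 2 * R) * |b| := by
  have hR : 0 ≤ R := (abs_nonneg U).trans hU
  unfold rateN
  refine (abs_add_le _ _).trans ?_
  simp only [abs_mul, abs_neg, abs_two]
  have h1 : 2 * |Q| * |U| * |a| ≤ 2 * R * R * |a| := by gcongr
  have h2 : |3 * U ^ 2 - 2 * P| ≤ 3 * R ^ 2 + 2 * R := by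
    refine (abs_sub _ _).trans ?_
    simp only [abs_mul, abs_pow, abs_two]
    rw [show |(3 : ℝ)| = 3 by norm_num]
    gcongr
  have h3 := mul_le_mul_of_nonneg_right h2 (abs_nonneg b)
  nlinarith [h1, h3]

theorem abs_rateB_sub_le (hU : |U| ≤ R) (hU' : |U'| ≤ R) (hP' : |P'| ≤ R) :
    |rateB U P a ν - rateB U' P' a' ν'| ≤
      (R * |U - U'| + |P - P'|) * |a| + (R ^ 2 + R) * |a - a'| + |ν - ν'| := by
  have hR : 0 ≤ R := (abs_nonneg U).trans hU
  have e : rateB U P a ν - rateB U' P' a' ν' = (1 / 2) * (U + U') * (U - U') * a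
      - (P - P') * a + rateB U' P' (a - a') (ν - ν') := by unfold rateB; ring
  rw [e]
  refine (abs_add_le _ _).trans ?_
  have h1 := abs_rateB_le (a := a - a') (ν := ν - ν') hU' hP'
  have h2 : |1 / 2 * (U + U') * (U - U') * a - (P - P') * a| ≤
      (R * |U - U'| + |P - P'|) * |a| := by
    refine (abs_sub _ _).trans ?_
    simp only [abs_mul]
    rw [show |(1 / 2 : ℝ)| = 1 / 2 by norm_num, add_mul]
    have : |U + U'| ≤ 2 * R := (abs_add_le _ _).trans (by linarith)
    have : 1 / 2 * |U + U'| ≤ R := by linarith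
    gcongr
  linarith

theorem abs_rateN_sub_le (hU : |U| ≤ R) (hU' : |U'| ≤ R) (hP' : |P'| ≤ R) (hQ : |Q| ≤ R)
    (hQ' : |Q'| ≤ R) :
    |rateN U P Q a b - rateN U' P' Q' a' b'| ≤
      2 * R * (|U - U'| + |Q - Q'|) * |a| + (6 * R * |U - U'| + 2 * |P - P'|) * |b| +
      2 * R ^ 2 * |a - a'| + (3 * R ^ 2 + 2 * R) * |b - b'| := by
  have hR : 0 ≤ R := (abs_nonneg U).trans hU
  have e : rateN U P Q a b - rateN U' P' Q' a' b' =
      (-2 * Q * (U - U') * a + -2 * U' * (Q - Q') * a) +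
      (3 * (U + U') * (U - U') * b + -2 * (P - P') * b) +
      rateN U' P' Q' (a - a') (b - b') := by unfold rateN; ring
  rw [e]
  refine (abs_add_le _ _).trans ?_
  have h1 := abs_rateN_le (a := a - a') (b := b - b') hU' hP' hQ'
  have h2 : |-2 * Q * (U - U') * a + -2 * U' * (Q - Q') * a| ≤
      2 * R * (|U - U'| + |Q - Q'|) * |a| := by
    refine (abs_add_le _ _).trans ?_
    simp only [abs_mul, abs_neg, abs_two]
    have : 2 * |Q| * |U - U'| * |a| ≤ 2 * R * |U - U'| * |a| := by gcongr
    have : 2 * |U'| * |Q - Q'| * |a| ≤ 2 * R * |Q - Q'| * |a| := by gcongr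
    linarith
  have h3 : |3 * (U + U') * (U - U') * b + -2 * (P - P') * b| ≤
      (6 * R * |U - U'| + 2 * |P - P'|) * |b| := by
    refine (abs_add_le _ _).trans ?_
    simp only [abs_mul, abs_neg, abs_two]
    rw [show |(3 : ℝ)| = 3 by norm_num, add_mul]
    have : |U + U'| ≤ 2 * R := (abs_add_le _ _).trans (by linarith)
    have : 3 * |U + U'| ≤ 6 * R := by linarith
    gcongr
  have := abs_add_le (-2 * Q * (U - U') * a + -2 * U' * (Q - Q') * a)
    (3 * (U + U') * (U - U') * b + -2 * (P - P') * b)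
  linarith

end Pointwise

/-- The nonlocal terms are bounded and Lipschitz on bounded sets. -/
theorem exists_PQ_bounds (R : ℝ) : ∃ C, R ≤ C ∧ 1 ≤ C ∧
    (∀ X, MemE1 X → SizeLe R X → ∀ ξ, |Pop X ξ| ≤ C ∧ |Qop X ξ| ≤ C) ∧
    (∀ X Y, MemE1 X → MemE1 Y → SizeLe R X → SizeLe R Y → ∀ ξ,
      |Pop X ξ - Pop Y ξ| ≤ C * normE (X - Y) ∧ |Qop X ξ - Qop Y ξ| ≤ C * normE (X - Y)) := by
  refine ⟨max (max R 1) (max (Real.exp R * (R ^ 3 + R))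
    (Real.exp R * (2 * (R ^ 3 + R) + (3 * R ^ 2 + 1)))), by simp, by simp, ?_, ?_⟩
  · intro X hX h ξ
    have h1 := hX.abs_PQ_le (m := R) (fun a b hab hb => (le_abs_self _).trans
      (h.osc hX a b (by rw [abs_le]; constructor <;> linarith))) ξ
    have h2 : Real.exp R * normL1 (dens X) ≤ Real.exp R * (R ^ 3 + R) :=
      mul_le_mul_of_nonneg_left (h.normL1_dens_le hX) (Real.exp_pos _).le
    have h3 := h2.trans ((le_max_left _ (Real.exp R * (2 * (R ^ 3 + R) + (3 * R ^ 2 + 1)))).trans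
      (le_max_right (max R 1) _))
    exact ⟨h1.1.trans h3, h1.2.trans h3⟩
  · intro X Y hX hY h h' ξ
    have h1 := abs_PQ_sub_le hX hY h h' ξ
    have h3 := mul_le_mul_of_nonneg_right ((le_max_right (Real.exp R * (R ^ 3 + R))
      (Real.exp R * (2 * (R ^ 3 + R) + (3 * R ^ 2 + 1)))).trans
      (le_max_right (max R 1) _)) (normE_nonneg (X - Y))
    exact ⟨h1.1.trans h3, h1.2.trans h3⟩

theorem vecField_ν (X : Lag) (ξ : ℝ) : (vecField X).ν ξ =
    rateN (X.U ξ) (Pop X ξ) (Qop X ξ) (deriv X.y ξ) (deriv X.U ξ) := rfl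

theorem MemE1.deriv_neg_Qop {X : Lag} (hX : MemE1 X) :
    deriv (fun ξ => -Qop X ξ) =ᵐ[volume] fun ξ =>
      rateB (X.U ξ) (Pop X ξ) (deriv X.y ξ) (X.ν ξ) := by
  filter_upwards [hX.deriv_Qop] with ξ h
  rw [deriv.fun_neg, h, rateB, dens]; ring

/-- The vector field is Lipschitz on bounded sets in the norm of `E`. -/
theorem exists_lipschitz_vecField (R : ℝ) : ∃ C, 0 ≤ C ∧ ∀ X Y, MemE1 X → MemE1 Y →
    SizeLe R X → SizeLe R Y → normE (vecField X - vecField Y) ≤ C * normE (X - Y) := by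
  obtain ⟨C, hRC, hC1, hb, hl⟩ := exists_PQ_bounds R
  have hC0 : 0 ≤ C := by linarith
  refine ⟨2 + C + ((C + C) * C + (C ^ 2 + C) + 1) +
    (2 * C * (1 + C) * C + (6 * C + 2 * C) * C + 2 * C ^ 2 + (3 * C ^ 2 + 2 * C)),
    by positivity, fun X Y hX hY h h' => ?_⟩
  have hD := normE_nonneg (X - Y)
  have hU := abs_U_sub_le hX hY
  have hdy := normL1_dy_sub_le hX hY
  have hdU := normL1_dU_sub_le hX hY
  have hν := normL1_ν_sub_le (X := X) (Y := Y)
  have hPQ := hl X Y hX hY h h'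
  have hbX := hb X hX h
  have hbY := hb Y hY h'
  have g := h.mono hRC
  have g' := h'.mono hRC
  set D := normE (X - Y) with hDdef
  have i1 := hX.memL1per_dy.abs
  have i1b := hX.memL1per_dU.abs
  have i2 := (hX.memL1per_dy.sub hY.memL1per_dy).abs
  have i2b := (hX.memL1per_dU.sub hY.memL1per_dU).abs
  have i3 := (hX.ν.sub hY.ν).abs
  have A : normV (fun ξ => X.U ξ - Y.U ξ) ≤ 2 * D := by
    have h1 : supN (fun ξ => X.U ξ - Y.U ξ) ≤ D := supN_U_le_normE (X - Y)
    have h2 : normL1 (deriv fun ξ => X.U ξ - Y.U ξ) ≤ D := normL1_dU_le_normE (X - Y)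
    rw [normV_eq]; linarith
  have B1 : supN (fun ξ => -Qop X ξ - -Qop Y ξ) ≤ C * D := supN_le fun ξ _ => by
    have := (hPQ ξ).2
    rwa [abs_sub_comm, show Qop Y ξ - Qop X ξ = -Qop X ξ - -Qop Y ξ by ring] at this
  have B2 : normL1 (deriv fun ξ => -Qop X ξ - -Qop Y ξ) ≤ ((C + C) * C + (C ^ 2 + C) + 1) * D := by
    rw [normL1_congr (hX.memW11per_Qop.neg.1.deriv_sub_ae hY.memW11per_Qop.neg.1)]
    have j := ((i1.const_mul ((C + C) * D)).add (i2.const_mul (C ^ 2 + C))).add i3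
    refine (normL1_mono (hX.memW11per_Qop.neg.memL1per_deriv.sub
      hY.memW11per_Qop.neg.memL1per_deriv).1 j.1 ?_).trans ?_
    · filter_upwards [hX.deriv_neg_Qop, hY.deriv_neg_Qop] with ξ e1 e2
      rw [e1, e2]
      refine (abs_rateB_sub_le (g.U ξ) (g'.U ξ) (hbY ξ).1).trans ?_
      have k1 := hU ξ
      have k2 := (hPQ ξ).1
      have : C * |X.U ξ - Y.U ξ| + |Pop X ξ - Pop Y ξ| ≤ (C + C) * D := by
        have := mul_le_mul_of_nonneg_left k1 hC0
        linarith
      gcongr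
    · rw [intervalIntegral.integral_add (((i1.const_mul _).add
        (i2.const_mul _)).intervalIntegrable _ _) (i3.intervalIntegrable _ _),
        intervalIntegral.integral_add ((i1.const_mul _).intervalIntegrable _ _)
        ((i2.const_mul _).intervalIntegrable _ _), intervalIntegral.integral_const_mul,
        intervalIntegral.integral_const_mul]
      have q1 := mul_le_mul_of_nonneg_left g.dy (show 0 ≤ (C + C) * D by positivity)
      have q2 := mul_le_mul_of_nonneg_left hdy (show 0 ≤ C ^ 2 + C by positivity)
      unfold normL1 at q1 q2 hν
      linarith
  have N : normL1 (fun ξ => (vecField X).ν ξ - (vecField Y).ν ξ) ≤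
      (2 * C * (1 + C) * C + (6 * C + 2 * C) * C + 2 * C ^ 2 + (3 * C ^ 2 + 2 * C)) * D := by
    have j := (((i1.const_mul (2 * C * (1 + C) * D)).add (i1b.const_mul ((6 * C + 2 * C) * D))).add
      (i2.const_mul (2 * C ^ 2))).add (i2b.const_mul (3 * C ^ 2 + 2 * C))
    refine (normL1_mono (hX.memE0_vecField.ν.sub hY.memE0_vecField.ν).1 j.1 ?_).trans ?_
    · refine Eventually.of_forall fun ξ => ?_
      rw [vecField_ν, vecField_ν]
      refine (abs_rateN_sub_le (g.U ξ) (g'.U ξ) (hbY ξ).1 (hbX ξ).2 (hbY ξ).2).trans ?_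
      have k1 := hU ξ
      have k2 := (hPQ ξ).1
      have k3 := (hPQ ξ).2
      have m1 : 2 * C * (|X.U ξ - Y.U ξ| + |Qop X ξ - Qop Y ξ|) ≤ 2 * C * (1 + C) * D := by
        rw [mul_assoc (2 * C)]; gcongr; linarith
      have m2 : 6 * C * |X.U ξ - Y.U ξ| + 2 * |Pop X ξ - Pop Y ξ| ≤ (6 * C + 2 * C) * D := by
        have := mul_le_mul_of_nonneg_left k1 (show 0 ≤ 6 * C by positivity)
        linarith
      gcongr
    · rw [intervalIntegral.integral_add ((((i1.const_mul _).add
        (i1b.const_mul _)).add (i2.const_mul _)).intervalIntegrable _ _)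
        ((i2b.const_mul _).intervalIntegrable _ _),
        intervalIntegral.integral_add (((i1.const_mul _).add
        (i1b.const_mul _)).intervalIntegrable _ _) ((i2.const_mul _).intervalIntegrable _ _),
        intervalIntegral.integral_add ((i1.const_mul _).intervalIntegrable _ _)
        ((i1b.const_mul _).intervalIntegrable _ _), intervalIntegral.integral_const_mul,
        intervalIntegral.integral_const_mul, intervalIntegral.integral_const_mul,
        intervalIntegral.integral_const_mul]
      have q1 := mul_le_mul_of_nonneg_left g.dy (show 0 ≤ 2 * C * (1 + C) * D by positivity)
      have q2 := mul_le_mul_of_nonneg_left g.dU (show 0 ≤ (6 * C + 2 * C) * D by positivity)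
      have q3 := mul_le_mul_of_nonneg_left hdy (show 0 ≤ 2 * C ^ 2 by positivity)
      have q4 := mul_le_mul_of_nonneg_left hdU (show 0 ≤ 3 * C ^ 2 + 2 * C by positivity)
      unfold normL1 at q1 q2 q3 q4
      linarith
  have e : normE (vecField X - vecField Y) = normV (fun ξ => X.U ξ - Y.U ξ) +
    normV (fun ξ => -Qop X ξ - -Qop Y ξ) +
    normL1 (fun ξ => (vecField X).ν ξ - (vecField Y).ν ξ) := rfl
  rw [e, normV_eq (fun ξ => -Qop X ξ - -Qop Y ξ)]
  linarith


/-! ## Ordinary differential equations with locally Lipschitz vector fields -/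

/-- Lipschitz continuity on balls. -/
def LipOnBalls {E : Type*} [NormedAddCommGroup E] (v : E → E) : Prop :=
  ∀ R : ℝ, ∃ C : ℝ, 0 ≤ C ∧ ∀ x y, ‖x‖ ≤ R → ‖y‖ ≤ R → ‖v x - v y‖ ≤ C * ‖x - y‖

section ODE

variable {E : Type*} [NormedAddCommGroup E] [NormedSpace ℝ E] {v : E → E}

/-- The cutoff function `1` on the ball of radius `R`, `0` off the ball of radius `R + 1`. -/
def cutoff (R : ℝ) (x : E) : ℝ := max 0 (min 1 (R + 1 - ‖x‖))

omit [NormedSpace ℝ E] in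
theorem cutoff_mem (R : ℝ) (x : E) : cutoff R x ∈ Icc (0 : ℝ) 1 :=
  ⟨le_max_left _ _, max_le zero_le_one (min_le_left _ _)⟩

omit [NormedSpace ℝ E] in
theorem cutoff_eq_one {R : ℝ} {x : E} (h : ‖x‖ ≤ R) : cutoff R x = 1 := by
  unfold cutoff
  rw [min_eq_left (by linarith), max_eq_right zero_le_one]

omit [NormedSpace ℝ E] in
theorem cutoff_eq_zero {R : ℝ} {x : E} (h : R + 1 ≤ ‖x‖) : cutoff R x = 0 :=
  max_eq_left ((min_le_right _ _).trans (by linarith))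

omit [NormedSpace ℝ E] in
theorem abs_cutoff_sub_le (R : ℝ) (x y : E) : |cutoff R x - cutoff R y| ≤ ‖x - y‖ := by
  unfold cutoff
  rw [max_comm 0, max_comm 0]
  refine ((abs_max_sub_max_le_abs _ _ _).trans ?_).trans (abs_norm_sub_norm_le x y)
  refine (abs_min_sub_min_le_max _ _ _ _).trans ?_
  rw [sub_self, abs_zero, show R + 1 - ‖x‖ - (R + 1 - ‖y‖) = ‖y‖ - ‖x‖ by ring, abs_sub_comm]
  simp

theorem LipOnBalls.cutoff_smul (hv : LipOnBalls v) {R : ℝ} (hR : 0 ≤ R) :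
    ∃ L K : NNReal, (∀ x, ‖cutoff R x • v x‖ ≤ L) ∧
      LipschitzWith K (fun x => cutoff R x • v x) := by
  obtain ⟨C, hC, H⟩ := hv (R + 1)
  have hB : ∀ x, ‖x‖ ≤ R + 1 → ‖v x‖ ≤ ‖v 0‖ + C * (R + 1) := by
    intro x hx
    have h1 := H x 0 hx (by rw [norm_zero]; linarith)
    rw [sub_zero] at h1
    have h2 := norm_sub_norm_le (v x) (v 0)
    have h3 := mul_le_mul_of_nonneg_left hx hC
    linarith
  set B := ‖v 0‖ + C * (R + 1) with hBdef
  have hB0 : 0 ≤ B := by positivity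
  refine ⟨B.toNNReal, (B + C).toNNReal, fun x => ?_, ?_⟩
  · rw [norm_smul, Real.coe_toNNReal _ hB0, Real.norm_eq_abs, abs_of_nonneg (cutoff_mem R x).1]
    rcases le_total ‖x‖ (R + 1) with h | h
    · calc cutoff R x * ‖v x‖ ≤ 1 * B :=
          mul_le_mul (cutoff_mem R x).2 (hB x h) (norm_nonneg _) zero_le_one
        _ = B := one_mul B
    · rw [cutoff_eq_zero h, zero_mul]; exact hB0
  · refine LipschitzWith.of_dist_le_mul fun x y => ?_
    rw [dist_eq_norm, dist_eq_norm, Real.coe_toNNReal _ (by linarith)]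
    wlog hxy : ‖x‖ ≤ ‖y‖ generalizing x y
    · rw [norm_sub_rev, norm_sub_rev x]; exact this y x (not_le.1 hxy).le
    rcases le_total (R + 1) ‖x‖ with h | h
    · rw [cutoff_eq_zero h, cutoff_eq_zero (h.trans hxy), zero_smul, zero_smul, sub_zero, norm_zero]
      positivity
    have key : ∀ w : E, ‖v x - w‖ * cutoff R y ≤ C * ‖x - y‖ →
        ‖cutoff R x • v x - cutoff R y • w‖ ≤ (B + C) * ‖x - y‖ := by
      intro w hw
      have e : cutoff R x • v x - cutoff R y • w =
          (cutoff R x - cutoff R y) • v x + cutoff R y • (v x - w) := by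
        rw [sub_smul, smul_sub]; abel
      rw [e]
      refine (norm_add_le _ _).trans ?_
      rw [norm_smul, norm_smul, Real.norm_eq_abs, Real.norm_eq_abs,
        abs_of_nonneg (cutoff_mem R y).1, add_mul, mul_comm (cutoff R y)]
      refine add_le_add ?_ hw
      rw [mul_comm]
      exact mul_le_mul (hB x h) (abs_cutoff_sub_le R x y) (abs_nonneg _) hB0
    apply key
    rcases le_total (R + 1) ‖y‖ with h' | h'
    · rw [cutoff_eq_zero h', mul_zero]; positivity
    · calc ‖v x - v y‖ * cutoff R y ≤ (C * ‖x - y‖) * 1 :=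
          mul_le_mul (H x y h h') (cutoff_mem R y).2 (cutoff_mem R y).1 (by positivity)
        _ = C * ‖x - y‖ := mul_one _

variable [CompleteSpace E]

theorem LipOnBalls.exists_truncated_solution (hv : LipOnBalls v) {R T : ℝ} (hR : 0 ≤ R)
    (hT : 0 ≤ T) (x₀ : E) : ∃ α : ℝ → E, α 0 = x₀ ∧ ∀ t ∈ Icc 0 T, ∃ c ∈ Icc (0 : ℝ) 1,
      (‖α t‖ ≤ R → c = 1) ∧ HasDerivWithinAt α (c • v (α t)) (Icc 0 T) t := by
  obtain ⟨L, K, hL, hK⟩ := hv.cutoff_smul hR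
  have hp : IsPicardLindelof (fun _ x => cutoff R x • v x)
      (⟨0, by simp [hT]⟩ : Icc (0 : ℝ) T) x₀ (L * T.toNNReal) 0 L K :=
    { lipschitzOnWith := fun _ _ => hK.lipschitzOnWith
      continuousOn := fun _ _ => continuousOn_const
      norm_le := fun _ _ x _ => hL x
      mul_max_le := by
        simp [hT] }
  obtain ⟨α, h0, hα⟩ := hp.exists_eq_forall_mem_Icc_hasDerivWithinAt₀
  exact ⟨α, h0, fun t ht => ⟨cutoff R (α t), cutoff_mem _ _, cutoff_eq_one, hα t ht⟩⟩

omit [CompleteSpace E] in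
theorem LipOnBalls.eqOn_of_solutions (hv : LipOnBalls v) {T : ℝ} {α β : ℝ → E}
    (hα : ∀ t ∈ Icc 0 T, HasDerivWithinAt α (v (α t)) (Icc 0 T) t)
    (hβ : ∀ t ∈ Icc 0 T, HasDerivWithinAt β (v (β t)) (Icc 0 T) t) (h : α 0 = β 0) :
    EqOn α β (Icc 0 T) := by
  have cα : ContinuousOn α (Icc 0 T) := fun t ht => (hα t ht).continuousWithinAt
  have cβ : ContinuousOn β (Icc 0 T) := fun t ht => (hβ t ht).continuousWithinAt
  obtain ⟨A, hA⟩ := isCompact_Icc.exists_bound_of_continuousOn cα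
  obtain ⟨B, hB⟩ := isCompact_Icc.exists_bound_of_continuousOn cβ
  obtain ⟨C, hC, H⟩ := hv (max A B)
  have hn : ∀ t ∈ Ico 0 T, Icc 0 T ∈ 𝓝[Ici t] t := fun t ht =>
    mem_of_superset (Icc_mem_nhdsGE ht.2) (Icc_subset_Icc_left ht.1)
  refine ODE_solution_unique_of_mem_Icc_right (v := fun _ => v) (K := C.toNNReal)
    (s := fun _ => {x | ‖x‖ ≤ max A B})
    (fun t _ => LipschitzOnWith.of_dist_le_mul fun x hx y hy => ?_) cα
    (fun t ht => (hα t (Ico_subset_Icc_self ht)).mono_of_mem_nhdsWithin (hn t ht))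
    (fun t ht => (hA t (Ico_subset_Icc_self ht)).trans (le_max_left _ _)) cβ
    (fun t ht => (hβ t (Ico_subset_Icc_self ht)).mono_of_mem_nhdsWithin (hn t ht))
    (fun t ht => (hB t (Ico_subset_Icc_self ht)).trans (le_max_right _ _)) h
  rw [dist_eq_norm, dist_eq_norm, Real.coe_toNNReal _ hC]
  exact H x y hx hy

omit [CompleteSpace E] in
theorem LipOnBalls.exists_global (hv : LipOnBalls v) {x₀ : E}
    (h : ∀ T : ℝ, 0 ≤ T → ∃ α : ℝ → E, α 0 = x₀ ∧
      ∀ t ∈ Icc 0 T, HasDerivWithinAt α (v (α t)) (Icc 0 T) t) :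
    ∃ α : ℝ → E, α 0 = x₀ ∧ ∀ t, 0 ≤ t → HasDerivWithinAt α (v (α t)) (Ici 0) t := by
  choose! α h0 hα using h
  have heq : ∀ T S, 0 ≤ T → T ≤ S → EqOn (α T) (α S) (Icc 0 T) := by
    intro T S hT hTS
    refine hv.eqOn_of_solutions (hα T hT) (fun t ht => ?_) ((h0 T hT).trans (h0 S
      (hT.trans hTS)).symm)
    exact (hα S (hT.trans hTS) t ⟨ht.1, ht.2.trans hTS⟩).mono (Icc_subset_Icc_right hTS)
  refine ⟨fun t => α t t, h0 0 le_rfl, fun t ht => ?_⟩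
  have h1 := hα (t + 1) (by linarith) t ⟨ht, by linarith⟩
  rw [← heq t (t + 1) ht (by linarith) ⟨ht, le_rfl⟩] at h1
  have hn : Icc 0 (t + 1) ∈ 𝓝[Ici 0] t := by
    rw [← Ici_inter_Iic]
    exact inter_mem self_mem_nhdsWithin (mem_nhdsWithin_of_mem_nhds (Iic_mem_nhds (by linarith)))
  refine (h1.mono_of_mem_nhdsWithin hn).congr_of_eventuallyEq ?_
    (heq t (t + 1) ht (by linarith) ⟨ht, le_rfl⟩)
  filter_upwards [hn] with s hs
  exact heq s (t + 1) hs.1 hs.2 ⟨hs.1, le_rfl⟩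

end ODE

/-! ## The state space of bounded representatives -/

/-- Bounded families of five functions on the line. -/
abbrev Amb := lp (fun _ : Fin 5 × ℝ => ℝ) ⊤

theorem abs_amb_le (x : Amb) (i : Fin 5) (ξ : ℝ) : |x (i, ξ)| ≤ ‖x‖ :=
  lp.norm_apply_le_norm ENNReal.top_ne_zero x (i, ξ)

/-- Bounded measurable periodic families `(ζ, U, a, b, ν)` with `ζ` a primitive of `a` and `U` a
primitive of `b`. -/
def stateSubmodule : Submodule ℝ Amb where
  carrier := {x | (∀ i, Measurable fun ξ => x (i, ξ)) ∧ (∀ i ξ, x (i, ξ + 1) = x (i, ξ)) ∧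
    (∀ ξ, x (0, ξ) = x (0, 0) + ∫ η in (0 : ℝ)..ξ, x (2, η)) ∧
    (∀ ξ, x (1, ξ) = x (1, 0) + ∫ η in (0 : ℝ)..ξ, x (3, η))}
  zero_mem' := by
    refine ⟨fun i => ?_, fun i ξ => ?_, fun ξ => ?_, fun ξ => ?_⟩ <;> simp
  add_mem' := by
    have hi : ∀ (x : Amb), (∀ i, Measurable fun ξ => x (i, ξ)) → ∀ i a b,
        IntervalIntegrable (fun ξ => x (i, ξ)) volume a b := fun x hx i a b =>
      intervalIntegrable_const.mono_fun (g := fun ξ => x (i, ξ)) (f := fun _ => ‖x‖)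
        (hx i).aestronglyMeasurable (Eventually.of_forall fun ξ => by
          rw [norm_norm]; exact abs_amb_le x i ξ)
    rintro x x' ⟨h1, h2, h3, h4⟩ ⟨h1', h2', h3', h4'⟩
    refine ⟨fun i => (h1 i).add (h1' i), fun i ξ => ?_, fun ξ => ?_, fun ξ => ?_⟩
    · simp only [lp.coeFn_add, Pi.add_apply, h2, h2']
    · simp only [lp.coeFn_add, Pi.add_apply]
      rw [intervalIntegral.integral_add (hi x h1 2 _ _) (hi x' h1' 2 _ _), h3 ξ, h3' ξ]
      ring
    · simp only [lp.coeFn_add, Pi.add_apply]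
      rw [intervalIntegral.integral_add (hi x h1 3 _ _) (hi x' h1' 3 _ _), h4 ξ, h4' ξ]
      ring
  smul_mem' := by
    rintro c x ⟨h1, h2, h3, h4⟩
    refine ⟨fun i => (h1 i).const_mul c, fun i ξ => ?_, fun ξ => ?_, fun ξ => ?_⟩
    · simp only [lp.coeFn_smul, Pi.smul_apply, h2]
    · simp only [lp.coeFn_smul, Pi.smul_apply, smul_eq_mul, intervalIntegral.integral_const_mul]
      rw [h3 ξ]; ring
    · simp only [lp.coeFn_smul, Pi.smul_apply, smul_eq_mul, intervalIntegral.integral_const_mul]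
      rw [h4 ξ]; ring

/-- The space of states. -/
abbrev St : Type := stateSubmodule

/-- The components of a state. -/
def St.c (x : St) (i : Fin 5) (ξ : ℝ) : ℝ := (x : Amb) (i, ξ)

namespace St

theorem abs_c_le (x : St) (i : Fin 5) (ξ : ℝ) : |x.c i ξ| ≤ ‖x‖ := abs_amb_le x i ξ

theorem norm_le {x : St} {C : ℝ} (hC : 0 ≤ C) (h : ∀ i ξ, |x.c i ξ| ≤ C) : ‖x‖ ≤ C :=
  lp.norm_le_of_forall_le hC fun p => h p.1 p.2

theorem c_sub (x x' : St) (i : Fin 5) (ξ : ℝ) : (x - x').c i ξ = x.c i ξ - x'.c i ξ := rfl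

theorem c_add (x x' : St) (i : Fin 5) (ξ : ℝ) : (x + x').c i ξ = x.c i ξ + x'.c i ξ := rfl

theorem c_smul (r : ℝ) (x : St) (i : Fin 5) (ξ : ℝ) : (r • x).c i ξ = r * x.c i ξ := rfl

theorem measurable_c (x : St) (i : Fin 5) : Measurable (x.c i) := x.2.1 i

theorem periodic_c (x : St) (i : Fin 5) : Function.Periodic (x.c i) 1 := x.2.2.1 i

theorem c_zero_eq (x : St) (ξ : ℝ) : x.c 0 ξ = x.c 0 0 + ∫ η in (0 : ℝ)..ξ, x.c 2 η :=
  x.2.2.2.1 ξ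

theorem c_one_eq (x : St) (ξ : ℝ) : x.c 1 ξ = x.c 1 0 + ∫ η in (0 : ℝ)..ξ, x.c 3 η :=
  x.2.2.2.2 ξ

theorem intervalIntegrable_c (x : St) (i : Fin 5) (a b : ℝ) :
    IntervalIntegrable (x.c i) volume a b :=
  intervalIntegrable_const.mono_fun (g := x.c i) (f := fun _ => ‖x‖)
    (x.measurable_c i).aestronglyMeasurable (Eventually.of_forall fun ξ => by
      rw [norm_norm]; exact x.abs_c_le i ξ)

theorem memL1per_c (x : St) (i : Fin 5) : MemL1per (x.c i) :=
  ⟨locallyIntegrable_of_intervalIntegrable (x.intervalIntegrable_c i),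
    Eventually.of_forall (x.periodic_c i)⟩

theorem isClosed : IsClosed (stateSubmodule : Set Amb) := by
  refine IsSeqClosed.isClosed fun x y hx hxy => ?_
  have hc : ∀ i ξ, Tendsto (fun n => x n (i, ξ)) atTop (𝓝 (y (i, ξ))) := by
    intro i ξ
    rw [tendsto_iff_norm_sub_tendsto_zero] at hxy ⊢
    exact squeeze_zero (fun _ => norm_nonneg _) (fun n => abs_amb_le (x n - y) i ξ) hxy
  have hm : ∀ i, Measurable fun ξ => y (i, ξ) := fun i =>
    measurable_of_tendsto_metrizable (fun n => (hx n).1 i) (tendsto_pi_nhds.2 fun ξ => hc i ξ)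
  obtain ⟨B, hB⟩ := (hxy.norm.bddAbove_range)
  have hint : ∀ i ξ, Tendsto (fun n => ∫ η in (0 : ℝ)..ξ, x n (i, η)) atTop
      (𝓝 (∫ η in (0 : ℝ)..ξ, y (i, η))) := by
    intro i ξ
    refine intervalIntegral.tendsto_integral_filter_of_dominated_convergence (fun _ => B)
      (Eventually.of_forall fun n => ((hx n).1 i).aestronglyMeasurable)
      (Eventually.of_forall fun n => Eventually.of_forall fun η _ =>
        (abs_amb_le (x n) i η).trans (hB ⟨n, rfl⟩)) intervalIntegrable_const
      (Eventually.of_forall fun η _ => hc i η)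
  refine ⟨hm, fun i ξ => ?_, fun ξ => ?_, fun ξ => ?_⟩
  · exact tendsto_nhds_unique (hc i (ξ + 1)) ((hc i ξ).congr fun n => ((hx n).2.1 i ξ).symm)
  · exact tendsto_nhds_unique (hc 0 ξ) (((hc 0 0).add (hint 2 ξ)).congr fun n =>
      ((hx n).2.2.1 ξ).symm)
  · exact tendsto_nhds_unique (hc 1 ξ) (((hc 1 0).add (hint 3 ξ)).congr fun n =>
      ((hx n).2.2.2 ξ).symm)

instance : CompleteSpace St := isClosed.completeSpace_coe

/-- Evaluation of a component. -/
def ev (i : Fin 5) (ξ : ℝ) : St →L[ℝ] ℝ :=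
  LinearMap.mkContinuous ⟨⟨fun x => x.c i ξ, fun x y => c_add x y i ξ⟩, fun r x => c_smul r x i ξ⟩ 1
    fun x => by rw [one_mul]; exact x.abs_c_le i ξ

/-- The mean of a component. -/
def mean (i : Fin 5) : St →L[ℝ] ℝ :=
  LinearMap.mkContinuous ⟨⟨fun x => ∫ ξ in (0 : ℝ)..1, x.c i ξ, fun x y => by
      simp only [c_add]
      exact intervalIntegral.integral_add (x.intervalIntegrable_c i _ _)
        (y.intervalIntegrable_c i _ _)⟩, fun r x => by
      simp only [c_smul, intervalIntegral.integral_const_mul]; rfl⟩ 1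
    fun x => by
      rw [one_mul]
      have := intervalIntegral.norm_integral_le_of_norm_le_const (a := 0) (b := 1)
        (f := x.c i) (C := ‖x‖) (fun ξ _ => x.abs_c_le i ξ)
      simpa using this

/-- The triple `(ζ, U, ν)`. -/
def lin (x : St) : Lag := (x.c 0, x.c 1, x.c 4)

/-- The Lagrangian variables `(id + ζ, U, ν)` of a state. -/
def lag (x : St) : Lag := (fun ξ => ξ + x.c 0 ξ, x.c 1, x.c 4)

theorem W_zero (x : St) : W11loc (x.c 0) ∧ deriv (x.c 0) =ᵐ[volume] x.c 2 :=
  W11loc.of_integral (x.memL1per_c 2).1 x.c_zero_eq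

theorem W_one (x : St) : W11loc (x.c 1) ∧ deriv (x.c 1) =ᵐ[volume] x.c 3 :=
  W11loc.of_integral (x.memL1per_c 3).1 x.c_one_eq

theorem memE1_lag (x : St) : MemE1 x.lag :=
  ⟨⟨W11loc.id.add x.W_zero.1, fun ξ => by
    simp only [Lag.y, lag, x.periodic_c 0 ξ]; ring⟩, ⟨x.W_one.1, x.periodic_c 1⟩, x.memL1per_c 4⟩

theorem deriv_lag_y (x : St) : deriv x.lag.y =ᵐ[volume] fun ξ => 1 + x.c 2 ξ := by
  filter_upwards [x.W_zero.2, x.W_zero.1.ae_differentiableAt] with ξ h1 h2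
  have := ((hasDerivAt_id ξ).add h2.hasDerivAt).deriv
  rw [h1] at this
  exact this

theorem deriv_lag_U (x : St) : deriv x.lag.U =ᵐ[volume] x.c 3 := x.W_one.2

theorem lag_sub (x x' : St) : x.lag - x'.lag = (x - x').lin := by
  refine Prod.ext ?_ rfl
  funext ξ
  change (ξ + x.c 0 ξ) - (ξ + x'.c 0 ξ) = x.c 0 ξ - x'.c 0 ξ
  ring

theorem normL1_c_le (x : St) (i : Fin 5) : normL1 (x.c i) ≤ ‖x‖ := by
  have := normL1_mono (φ := x.c i) (x.memL1per_c i).1 (locallyIntegrable_const ‖x‖)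
    (Eventually.of_forall (x.abs_c_le i))
  simpa using this

theorem normE_lin_le (x : St) : normE x.lin ≤ 5 * ‖x‖ := by
  have h0 : normV (x.c 0) ≤ ‖x‖ + ‖x‖ := by
    rw [normV_eq, normL1_congr x.W_zero.2]
    exact add_le_add (supN_le fun ξ _ => x.abs_c_le 0 ξ) (x.normL1_c_le 2)
  have h1 : normV (x.c 1) ≤ ‖x‖ + ‖x‖ := by
    rw [normV_eq, normL1_congr x.W_one.2]
    exact add_le_add (supN_le fun ξ _ => x.abs_c_le 1 ξ) (x.normL1_c_le 3)
  have h2 := x.normL1_c_le 4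
  have : normE x.lin = normV (x.c 0) + normV (x.c 1) + normL1 (x.c 4) := rfl
  linarith

theorem sizeLe_lag {R : ℝ} (x : St) (h : ‖x‖ ≤ R) : SizeLe (1 + R) x.lag where
  U := fun ξ => (x.abs_c_le 1 ξ).trans (by linarith)
  dy := by
    rw [normL1_congr x.deriv_lag_y]
    refine (normL1_add_le (locallyIntegrable_const 1) (x.memL1per_c 2).1).trans ?_
    have : normL1 (fun _ => (1 : ℝ)) = 1 := by simp [normL1]
    linarith [x.normL1_c_le 2]
  dU := by
    rw [normL1_congr x.deriv_lag_U]
    linarith [x.normL1_c_le 3]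
  ν := (x.normL1_c_le 4).trans (by linarith)

/-- The components of the vector field at a state. -/
def fieldFun (x : St) (p : Fin 5 × ℝ) : ℝ :=
  match p.1 with
  | 0 => x.c 1 p.2
  | 1 => -Qop x.lag p.2
  | 2 => x.c 3 p.2
  | 3 => rateB (x.c 1 p.2) (Pop x.lag p.2) (1 + x.c 2 p.2) (x.c 4 p.2)
  | 4 => rateN (x.c 1 p.2) (Pop x.lag p.2) (Qop x.lag p.2) (1 + x.c 2 p.2) (x.c 3 p.2)

theorem exists_fieldFun_le (R : ℝ) : ∃ C, 0 ≤ C ∧ ∀ x : St, ‖x‖ ≤ R →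
    ∀ p, |x.fieldFun p| ≤ C := by
  obtain ⟨C, hRC, hC1, hb, -⟩ := exists_PQ_bounds (1 + R)
  refine ⟨C + ((C ^ 2 + C) * C + C) + (2 * C ^ 2 * C + (3 * C ^ 2 + 2 * C) * C), by positivity,
    fun x hx p => ?_⟩
  have hPQ := hb _ x.memE1_lag (x.sizeLe_lag hx) p.2
  have hx0 := norm_nonneg x
  have hc : ∀ i, |x.c i p.2| ≤ C := fun i => (x.abs_c_le i p.2).trans (by linarith)
  have ha : |1 + x.c 2 p.2| ≤ C := (abs_add_le _ _).trans (by
    have := x.abs_c_le 2 p.2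
    rw [abs_one]; linarith)
  have k1 : 0 ≤ (C ^ 2 + C) * C + C := by positivity
  have k2 : 0 ≤ 2 * C ^ 2 * C + (3 * C ^ 2 + 2 * C) * C := by positivity
  obtain ⟨i, ξ⟩ := p
  fin_cases i
  · exact (hc 1).trans (by linarith)
  · change |-Qop x.lag ξ| ≤ _
    rw [abs_neg]; exact hPQ.2.trans (by linarith)
  · exact (hc 3).trans (by linarith)
  · refine (abs_rateB_le (hc 1) hPQ.1).trans ?_
    have m1 := mul_le_mul_of_nonneg_left ha (show 0 ≤ C ^ 2 + C by positivity)
    have m2 := hc 4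
    dsimp only at m1 m2 ⊢
    linarith
  · refine (abs_rateN_le (hc 1) hPQ.1 hPQ.2).trans ?_
    have m1 := mul_le_mul_of_nonneg_left ha (show 0 ≤ 2 * C ^ 2 by positivity)
    have m2 := mul_le_mul_of_nonneg_left (hc 3) (show 0 ≤ 3 * C ^ 2 + 2 * C by positivity)
    dsimp only at m1 m2 ⊢
    linarith

theorem rateB_ae (x : St) : deriv (fun ξ => -Qop x.lag ξ) =ᵐ[volume] fun ξ => x.fieldFun (3, ξ) := by
  filter_upwards [x.memE1_lag.deriv_neg_Qop, x.deriv_lag_y] with ξ h1 h2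
  rw [h1, h2]; rfl

/-- The vector field on the state space. -/
def field (x : St) : St :=
  ⟨⟨x.fieldFun, memℓp_infty (by
    obtain ⟨C, -, h⟩ := exists_fieldFun_le ‖x‖
    refine ⟨C, ?_⟩
    rintro _ ⟨p, rfl⟩
    exact h x le_rfl p)⟩, by
    have hQ := x.memE1_lag.memW11per_Qop
    have hP := x.memE1_lag.memW11per_Pop
    have m := x.measurable_c
    have mQ := hQ.1.continuous.measurable
    have mP := hP.1.continuous.measurable
    refine ⟨fun i => ?_, fun i ξ => ?_, fun ξ => ?_, fun ξ => ?_⟩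
    · fin_cases i
      · exact m 1
      · exact mQ.neg
      · exact m 3
      · change Measurable fun ξ => ((x.c 1 ξ) ^ 2 * (1 + x.c 2 ξ) + x.c 4 ξ) / 2 -
          (1 + x.c 2 ξ) * Pop x.lag ξ
        exact (((((m 1).pow_const 2).mul ((m 2).const_add 1)).add (m 4)).div_const 2).sub
          (((m 2).const_add 1).mul mP)
      · change Measurable fun ξ => -2 * Qop x.lag ξ * x.c 1 ξ * (1 + x.c 2 ξ) +
          (3 * (x.c 1 ξ) ^ 2 - 2 * Pop x.lag ξ) * x.c 3 ξ
        exact (((mQ.const_mul (-2)).mul (m 1)).mul ((m 2).const_add 1)).add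
          (((((m 1).pow_const 2).const_mul 3).sub (mP.const_mul 2)).mul (m 3))
    · change x.fieldFun (i, ξ + 1) = x.fieldFun (i, ξ)
      fin_cases i <;> simp only [fieldFun, x.periodic_c _ ξ, hQ.2 ξ, hP.2 ξ]
    · exact x.c_one_eq ξ
    · change -Qop x.lag ξ = -Qop x.lag 0 + ∫ η in (0 : ℝ)..ξ, x.fieldFun (3, η)
      rw [hQ.neg.1.eq_add_integral ξ]
      congr 1
      exact intervalIntegral.integral_congr_ae (x.rateB_ae.mono fun _ h _ => h)⟩

theorem field_c (x : St) (i : Fin 5) (ξ : ℝ) : x.field.c i ξ = x.fieldFun (i, ξ) := rfl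

theorem lin_field (x : St) : LagEq x.field.lin (vecField x.lag) := by
  refine ⟨rfl, rfl, ?_⟩
  filter_upwards [x.deriv_lag_y, x.deriv_lag_U] with ξ h1 h2
  rw [vecField_ν, h1, h2]; rfl

theorem lipOnBalls_field : LipOnBalls field := by
  intro R
  obtain ⟨C, hRC, hC1, hb, hl⟩ := exists_PQ_bounds (1 + R)
  have hC0 : 0 ≤ C := by linarith
  refine ⟨5 * C + 1 + ((C + C * 5) * C + (C ^ 2 + C) + 1) +
    (2 * C * (1 + C * 5) * C + (6 * C + 2 * (C * 5)) * C + 2 * C ^ 2 + (3 * C ^ 2 + 2 * C)),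
    by positivity, fun x x' hx hx' => ?_⟩
  have hd : normE (x.lag - x'.lag) ≤ 5 * ‖x - x'‖ := by
    rw [lag_sub]; exact normE_lin_le _
  set d := ‖x - x'‖
  have hd0 : 0 ≤ d := norm_nonneg _
  refine norm_le (by positivity) fun i ξ => ?_
  have g1 := hb _ x.memE1_lag (x.sizeLe_lag hx) ξ
  have g2 := hb _ x'.memE1_lag (x'.sizeLe_lag hx') ξ
  have g3 := hl _ _ x.memE1_lag x'.memE1_lag (x.sizeLe_lag hx) (x'.sizeLe_lag hx') ξ
  have hR := norm_nonneg x
  have hR' := norm_nonneg x'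
  have hc : ∀ i, |x.c i ξ| ≤ C := fun i => (x.abs_c_le i ξ).trans (by linarith)
  have hc' : ∀ i, |x'.c i ξ| ≤ C := fun i => (x'.abs_c_le i ξ).trans (by linarith)
  have ha : |1 + x.c 2 ξ| ≤ C := (abs_add_le _ _).trans (by
    have := x.abs_c_le 2 ξ
    rw [abs_one]; linarith)
  have hcd : ∀ i, |x.c i ξ - x'.c i ξ| ≤ d := fun i => (x - x').abs_c_le i ξ
  have had : |1 + x.c 2 ξ - (1 + x'.c 2 ξ)| ≤ d := by
    rw [add_sub_add_left_eq_sub]; exact hcd 2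
  have hP : |Pop x.lag ξ - Pop x'.lag ξ| ≤ C * 5 * d := g3.1.trans (by
    rw [mul_assoc]; exact mul_le_mul_of_nonneg_left hd hC0)
  have hQ : |Qop x.lag ξ - Qop x'.lag ξ| ≤ C * 5 * d := g3.2.trans (by
    rw [mul_assoc]; exact mul_le_mul_of_nonneg_left hd hC0)
  have k1 : 0 ≤ ((C + C * 5) * C + (C ^ 2 + C) + 1) * d := by positivity
  have k2 : 0 ≤ (2 * C * (1 + C * 5) * C + (6 * C + 2 * (C * 5)) * C + 2 * C ^ 2 +
    (3 * C ^ 2 + 2 * C)) * d := by positivity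
  have k3 : 0 ≤ C * d := by positivity
  have k4 : 0 ≤ C * (5 * d) := by positivity
  rw [c_sub, field_c, field_c]
  fin_cases i
  · exact (hcd 1).trans (by linarith)
  · change |-Qop x.lag ξ - -Qop x'.lag ξ| ≤ _
    rw [show -Qop x.lag ξ - -Qop x'.lag ξ = -(Qop x.lag ξ - Qop x'.lag ξ) by ring, abs_neg]
    exact hQ.trans (by linarith)
  · exact (hcd 3).trans (by linarith)
  · refine (abs_rateB_sub_le (hc 1) (hc' 1) g2.1).trans ?_
    have n1 : C * |x.c 1 ξ - x'.c 1 ξ| + |Pop x.lag ξ - Pop x'.lag ξ| ≤ (C + C * 5) * d := by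
      have := mul_le_mul_of_nonneg_left (hcd 1) hC0
      linarith
    have n2 := mul_le_mul n1 ha (abs_nonneg _) (by positivity)
    have n3 := mul_le_mul_of_nonneg_left had (show 0 ≤ C ^ 2 + C by positivity)
    have n4 := hcd 4
    dsimp only at n2 n3 n4 ⊢
    linarith
  · refine (abs_rateN_sub_le (hc 1) (hc' 1) g2.1 g1.2 g2.2).trans ?_
    have n1 : 2 * C * (|x.c 1 ξ - x'.c 1 ξ| + |Qop x.lag ξ - Qop x'.lag ξ|) ≤
        2 * C * (1 + C * 5) * d := by
      have := mul_le_mul_of_nonneg_left (add_le_add (hcd 1) hQ) (show 0 ≤ 2 * C by positivity)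
      linarith
    have n2 := mul_le_mul n1 ha (abs_nonneg _) (by positivity)
    have n3 : 6 * C * |x.c 1 ξ - x'.c 1 ξ| + 2 * |Pop x.lag ξ - Pop x'.lag ξ| ≤
        (6 * C + 2 * (C * 5)) * d := by
      have := mul_le_mul_of_nonneg_left (hcd 1) (show 0 ≤ 6 * C by positivity)
      linarith
    have n4 := mul_le_mul n3 (hc 3) (abs_nonneg _) (by positivity)
    have n5 := mul_le_mul_of_nonneg_left had (show 0 ≤ 2 * C ^ 2 by positivity)
    have n6 := mul_le_mul_of_nonneg_left (hcd 3) (show 0 ≤ 3 * C ^ 2 + 2 * C by positivity)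
    dsimp only at n2 n4 n5 n6 ⊢
    linarith

end St


/-! ## Bounds on `F` in terms of the energy -/

theorem memE1_of_memF {X : Lag} (hX : X ∈ setF) : MemE1 X := ⟨hX.2.1, hX.1.2.1, hX.1.2.2⟩

theorem energy_nonneg (X : Lag) : 0 ≤ energy X := normL1_nonneg _

theorem abs_le_half_add {a b ν U : ℝ} (ha : 0 ≤ a) (hν : 0 ≤ ν)
    (h : a * ν = a ^ 2 * U ^ 2 + b ^ 2) : |b| ≤ (a + ν) / 2 :=
  abs_le_of_sq_le_sq (by nlinarith [sq_nonneg (a - ν), mul_nonneg (sq_nonneg a) (sq_nonneg U)])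
    (by linarith)

theorem sq_mul_le {a b ν U : ℝ} (ha : 0 ≤ a) (hν : 0 ≤ ν)
    (h : a * ν = a ^ 2 * U ^ 2 + b ^ 2) : U ^ 2 * a ≤ ν := by
  rcases ha.eq_or_lt with h0 | h0
  · rw [← h0]; simpa using hν
  · have : a * (U ^ 2 * a) ≤ a * ν := by nlinarith [sq_nonneg b]
    exact le_of_mul_le_mul_left this h0

section FBounds

variable {X : Lag} (hX : X ∈ setF)
include hX

theorem monotone_y_of_memF : Monotone X.y := (memE1_of_memF hX).y.1.monotone_of_deriv_nonneg
  hX.2.2.2.2.2.1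

theorem integral_dy_of_memF (ξ : ℝ) : ∫ x in ξ..(ξ + 1), deriv X.y x = 1 := by
  rw [(memE1_of_memF hX).y.1.integral_deriv, (memE1_of_memF hX).y.2]; ring

theorem integral_ν_of_memF (ξ : ℝ) : ∫ x in ξ..(ξ + 1), X.ν x = energy X := by
  rw [(memE1_of_memF hX).ν.integral_add_one]
  exact intervalIntegral.integral_congr_ae
    (hX.2.2.2.2.2.2.1.mono fun x hx _ => (abs_of_nonneg hx).symm)

theorem integral_abs_dU_le_of_memF (ξ : ℝ) :
    ∫ x in ξ..(ξ + 1), |deriv X.U x| ≤ (1 + energy X) / 2 := by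
  have hE := memE1_of_memF hX
  have h1 : ∫ x in ξ..(ξ + 1), |deriv X.U x| ≤ ∫ x in ξ..(ξ + 1), (1 / 2) * (deriv X.y x + X.ν x) := by
    refine intervalIntegral.integral_mono_ae (by linarith) (hE.memL1per_dU.abs.intervalIntegrable _ _)
      (((hE.memL1per_dy.add hE.ν).const_mul _).intervalIntegrable _ _) ?_
    filter_upwards [hX.2.2.2.2.2.1, hX.2.2.2.2.2.2.1, hX.2.2.2.2.2.2.2.2] with x h1 h2 h3
    linarith [abs_le_half_add h1 h2 h3]
  rw [intervalIntegral.integral_const_mul, intervalIntegral.integral_add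
    (hE.memL1per_dy.intervalIntegrable _ _) (hE.ν.intervalIntegrable _ _),
    integral_dy_of_memF hX, integral_ν_of_memF hX] at h1
  linarith

theorem abs_U_le_of_memF (ξ : ℝ) : |X.U ξ| ≤ 2 * (1 + energy X) := by
  have hE := memE1_of_memF hX
  have hh := energy_nonneg X
  set h := energy X
  have hD := integral_abs_dU_le_of_memF hX ξ
  have i1 := hE.memL1per_dy.continuous_mul (hE.U.1.continuous.pow 2)
    (fun ξ => by simp only [Pi.pow_apply, hE.U.2 ξ])
  have key : ∫ x in ξ..(ξ + 1), (X.U ξ) ^ 2 * deriv X.y x ≤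
      ∫ x in ξ..(ξ + 1), (2 * X.ν x + 2 * ((1 + h) / 2) ^ 2 * deriv X.y x) := by
    refine intervalIntegral.integral_mono_ae_restrict (by linarith)
      ((hE.memL1per_dy.const_mul _).intervalIntegrable _ _)
      (((hE.ν.const_mul _).add (hE.memL1per_dy.const_mul _)).intervalIntegrable _ _) ?_
    refine (ae_restrict_iff' measurableSet_Icc).2 ?_
    filter_upwards [hX.2.2.2.2.2.1, hX.2.2.2.2.2.2.1, hX.2.2.2.2.2.2.2.2] with x h1 h2 h3 hx
    have h4 := sq_mul_le h1 h2 h3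
    have h5 : |X.U x - X.U ξ| ≤ (1 + h) / 2 := by
      refine (hE.U.1.abs_sub_le hx.1).trans (le_trans ?_ hD)
      exact intervalIntegral.integral_mono_interval le_rfl hx.1 hx.2
        (Eventually.of_forall fun x => abs_nonneg _) (hE.memL1per_dU.abs.intervalIntegrable _ _)
    have h6 : (X.U x - X.U ξ) ^ 2 ≤ ((1 + h) / 2) ^ 2 := sq_le_sq' (by
      linarith [(abs_le.1 h5).1]) (abs_le.1 h5).2
    have h7 : (X.U ξ) ^ 2 ≤ 2 * (X.U x) ^ 2 + 2 * ((1 + h) / 2) ^ 2 := by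
      nlinarith [sq_nonneg (2 * X.U x - X.U ξ)]
    have h8 := mul_le_mul_of_nonneg_right h7 h1
    linarith
  rw [intervalIntegral.integral_const_mul, intervalIntegral.integral_add
    ((hE.ν.const_mul _).intervalIntegrable _ _) ((hE.memL1per_dy.const_mul _).intervalIntegrable _ _),
    intervalIntegral.integral_const_mul, intervalIntegral.integral_const_mul,
    integral_dy_of_memF hX, integral_ν_of_memF hX] at key
  refine abs_le_of_sq_le_sq ?_ (by linarith)
  nlinarith

theorem sizeLe_of_memF {M : ℝ} (hM : energy X ≤ M) : SizeLe (2 * (1 + M)) X := by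
  have hh := energy_nonneg X
  refine ⟨fun ξ => (abs_U_le_of_memF hX ξ).trans (by linarith), ?_, ?_, ?_⟩
  · have : normL1 (deriv X.y) = 1 := by
      have h := integral_dy_of_memF hX 0
      rw [zero_add] at h
      rw [← h]
      exact intervalIntegral.integral_congr_ae
        (hX.2.2.2.2.2.1.mono fun x hx _ => abs_of_nonneg hx)
    linarith
  · have := integral_abs_dU_le_of_memF hX 0
    rw [zero_add] at this
    unfold normL1
    linarith
  · change energy X ≤ _
    linarith

theorem abs_PQ_le_of_memF (ξ : ℝ) : |Pop X ξ| ≤ 2 * energy X ∧ |Qop X ξ| ≤ 2 * energy X := by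
  have hE := memE1_of_memF hX
  have h1 := hE.abs_PQ_le (m := 0) (fun a b hab _ => sub_nonpos.2 (monotone_y_of_memF hX hab)) ξ
  have h2 : normL1 (dens X) ≤ 2 * energy X := by
    have h3 := integral_ν_of_memF hX 0
    rw [zero_add] at h3
    rw [← h3, ← intervalIntegral.integral_const_mul]
    refine normL1_mono hE.memL1per_dens.1 (hE.ν.const_mul 2).1 ?_
    filter_upwards [hX.2.2.2.2.2.1, hX.2.2.2.2.2.2.1, hX.2.2.2.2.2.2.2.2] with x h1 h2 h3
    have h4 := sq_mul_le h1 h2 h3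
    have h5 := mul_nonneg (sq_nonneg (X.U x)) h1
    unfold dens
    rw [abs_of_nonneg (by linarith)]
    linarith
  rw [Real.exp_zero, one_mul] at h1
  exact ⟨h1.1.trans h2, h1.2.trans h2⟩

end FBounds

/-- The total energy is stationary along the vector field. -/
theorem MemE1.integral_vecField_ν {X : Lag} (hX : MemE1 X) :
    ∫ ξ in (0 : ℝ)..1, (vecField X).ν ξ = 0 := by
  have hP := hX.memW11per_Pop
  have hW : W11loc fun ξ => X.U ξ * (X.U ξ * X.U ξ) - 2 * (Pop X ξ * X.U ξ) :=
    (hX.U.1.mul (hX.U.1.mul hX.U.1)).sub ((hP.1.mul hX.U.1).const_mul 2)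
  have e : (vecField X).ν =ᵐ[volume]
      deriv fun ξ => X.U ξ * (X.U ξ * X.U ξ) - 2 * (Pop X ξ * X.U ξ) := by
    filter_upwards [hX.U.1.ae_differentiableAt, hP.1.ae_differentiableAt, hX.deriv_Pop]
      with ξ h1 h2 h3
    have hu := h1.hasDerivAt
    have hp := h2.hasDerivAt
    have := ((hu.mul (hu.mul hu)).sub ((hp.mul hu).const_mul 2)).deriv
    refine Eq.trans ?_ this.symm
    rw [vecField_ν, h3, rateN]
    simp only [Pi.mul_apply]
    ring
  rw [intervalIntegral.integral_congr_ae (e.mono fun _ h _ => h), hW.integral_deriv]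
  have h1 := hX.U.2 0
  have h2 := hP.2 0
  rw [zero_add] at h1 h2
  rw [h1, h2]; ring

/-! ## Invariance of `F` along trajectories of the bounded system -/

/-- States all of whose representatives satisfy the defining relations of `F` everywhere. -/
structure Good (x : St) : Prop where
  a : ∀ ξ, 0 ≤ 1 + x.c 2 ξ
  ν : ∀ ξ, 0 ≤ x.c 4 ξ
  pos : ∃ c : ℝ, 0 < c ∧ ∀ ξ, c ≤ 1 + x.c 2 ξ + x.c 4 ξ
  rel : ∀ ξ, (1 + x.c 2 ξ) * x.c 4 ξ = (1 + x.c 2 ξ) ^ 2 * (x.c 1 ξ) ^ 2 + (x.c 3 ξ) ^ 2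

theorem W11loc.locallyLipschitz_of_bound {f : ℝ → ℝ} (hf : W11loc f) {K : ℝ}
    (hK : ∀ᵐ x, |deriv f x| ≤ K) : LocallyLipschitz f :=
  (hf.lipschitz_of_abs_deriv_le hK).locallyLipschitz

theorem Good.memF {x : St} (h : Good x) : x.lag ∈ setF := by
  have hE := x.memE1_lag
  refine ⟨hE.memE, hE.y, hE.y.1.locallyLipschitz_of_bound (K := 1 + ‖x‖) ?_,
    hE.U.1.locallyLipschitz_of_bound (K := ‖x‖) ?_, ⟨‖x‖, ?_⟩, ?_, ?_, ?_, ?_⟩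
  · filter_upwards [x.deriv_lag_y] with ξ h1
    rw [h1]
    exact (abs_add_le _ _).trans (by rw [abs_one]; linarith [x.abs_c_le 2 ξ])
  · filter_upwards [x.deriv_lag_U] with ξ h1
    rw [h1]; exact x.abs_c_le 3 ξ
  · exact Eventually.of_forall fun ξ => x.abs_c_le 4 ξ
  · filter_upwards [x.deriv_lag_y] with ξ h1
    rw [h1]; exact h.a ξ
  · exact Eventually.of_forall h.ν
  · obtain ⟨c, hc, H⟩ := h.pos
    refine ⟨c, hc, ?_⟩
    filter_upwards [x.deriv_lag_y] with ξ h1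
    rw [h1]; exact H ξ
  · filter_upwards [x.deriv_lag_y, x.deriv_lag_U] with ξ h1 h2
    rw [h1, h2]; exact h.rel ξ

theorem Good.energy_eq {x : St} (h : Good x) : energy x.lag = St.mean 4 x :=
  intervalIntegral.integral_congr fun ξ _ => abs_of_nonneg (h.ν ξ)

theorem hasDerivWithinAt_clm {α : ℝ → St} {v : St} {s : Set ℝ} {t : ℝ} (L : St →L[ℝ] ℝ)
    (h : HasDerivWithinAt α v s t) : HasDerivWithinAt (fun t => L (α t)) (L v) s t :=
  L.hasFDerivAt.comp_hasDerivWithinAt t h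

theorem eq_of_hasDerivWithinAt_zero {T : ℝ} {f : ℝ → ℝ}
    (hf : ∀ t ∈ Icc 0 T, HasDerivWithinAt f 0 (Icc 0 T) t) {t : ℝ} (ht : t ∈ Icc 0 T) :
    f t = f 0 :=
  constant_of_has_deriv_right_zero (fun t ht => (hf t ht).continuousWithinAt)
    (fun t ht => (hf t (Ico_subset_Icc_self ht)).mono_of_mem_nhdsWithin
      (mem_of_superset (Icc_mem_nhdsGE ht.2) (Icc_subset_Icc_left ht.1))) t ht

/-- Trajectories of the system run at a speed between zero and one. -/
structure Traj (T : ℝ) (α : ℝ → St) (r : ℝ → ℝ) : Prop where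
  speed : ∀ t ∈ Icc 0 T, r t ∈ Icc (0 : ℝ) 1
  deriv : ∀ t ∈ Icc 0 T, HasDerivWithinAt α (r t • (α t).field) (Icc 0 T) t

namespace Traj

variable {T : ℝ} {α : ℝ → St} {r : ℝ → ℝ} (h : Traj T α r)
include h

theorem comp_deriv (i : Fin 5) (ξ : ℝ) {t : ℝ} (ht : t ∈ Icc 0 T) :
    HasDerivWithinAt (fun t => (α t).c i ξ) (r t * (α t).fieldFun (i, ξ)) (Icc 0 T) t :=
  hasDerivWithinAt_clm (St.ev i ξ) (h.deriv t ht)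

theorem mean_eq {t : ℝ} (ht : t ∈ Icc 0 T) : St.mean 4 (α t) = St.mean 4 (α 0) := by
  refine eq_of_hasDerivWithinAt_zero (f := fun t => St.mean 4 (α t)) (fun s hs => ?_) ht
  have := hasDerivWithinAt_clm (St.mean 4) (h.deriv s hs)
  rw [map_smul] at this
  have h0 : St.mean 4 (α s).field = 0 := by
    rw [← (α s).memE1_lag.integral_vecField_ν]
    exact intervalIntegral.integral_congr_ae ((α s).lin_field.2.2.mono fun _ h _ => h)
  rwa [h0, smul_zero] at this

theorem rel_eq (ξ : ℝ) (h0 : (1 + (α 0).c 2 ξ) * (α 0).c 4 ξ =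
    (1 + (α 0).c 2 ξ) ^ 2 * ((α 0).c 1 ξ) ^ 2 + ((α 0).c 3 ξ) ^ 2) {t : ℝ} (ht : t ∈ Icc 0 T) :
    (1 + (α t).c 2 ξ) * (α t).c 4 ξ =
      (1 + (α t).c 2 ξ) ^ 2 * ((α t).c 1 ξ) ^ 2 + ((α t).c 3 ξ) ^ 2 := by
  have key := eq_of_hasDerivWithinAt_zero (f := fun t => (1 + (α t).c 2 ξ) * (α t).c 4 ξ -
      ((1 + (α t).c 2 ξ) ^ 2 * ((α t).c 1 ξ) ^ 2 + ((α t).c 3 ξ) ^ 2)) (fun s hs => ?_) ht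
  · linarith
  · have a := (h.comp_deriv 2 ξ hs).const_add 1
    have U := h.comp_deriv 1 ξ hs
    have b := h.comp_deriv 3 ξ hs
    have ν := h.comp_deriv 4 ξ hs
    convert! (a.mul ν).sub (((a.pow 2).mul (U.pow 2)).add (b.pow 2)) using 1
    simp only [St.fieldFun, rateB, rateN, Pi.pow_apply]
    ring

theorem exists_bound : ∃ R, ∀ t ∈ Icc 0 T, ‖α t‖ ≤ R :=
  isCompact_Icc.exists_bound_of_continuousOn fun t ht => (h.deriv t ht).continuousWithinAt

theorem exists_lower_bound : ∃ C : ℝ, 0 ≤ C ∧ ∀ ξ, ∀ t ∈ Icc 0 T,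
    (1 + (α 0).c 2 ξ) ^ 2 + ((α 0).c 3 ξ) ^ 2 + ((α 0).c 4 ξ) ^ 2 ≤
      Real.exp (C * t) *
        ((1 + (α t).c 2 ξ) ^ 2 + ((α t).c 3 ξ) ^ 2 + ((α t).c 4 ξ) ^ 2) := by
  obtain ⟨R, hR⟩ := h.exists_bound
  obtain ⟨C, hRC, hC1, hb, -⟩ := exists_PQ_bounds (1 + R)
  refine ⟨4 + 10 * C ^ 2 + 10 * C, by positivity, fun ξ t ht => ?_⟩
  set L := 4 + 10 * C ^ 2 + 10 * C with hL
  have hd : ∀ s ∈ Icc 0 T, HasDerivWithinAt (fun t => Real.exp (L * t) *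
      ((1 + (α t).c 2 ξ) ^ 2 + ((α t).c 3 ξ) ^ 2 + ((α t).c 4 ξ) ^ 2)) _ (Icc 0 T) s :=
    fun s hs => ((((hasDerivAt_id s).const_mul L).exp).hasDerivWithinAt).mul
      (((((h.comp_deriv 2 ξ hs).const_add 1).pow 2).add ((h.comp_deriv 3 ξ hs).pow 2)).add
        ((h.comp_deriv 4 ξ hs).pow 2))
  have hm : MonotoneOn (fun t => Real.exp (L * t) *
      ((1 + (α t).c 2 ξ) ^ 2 + ((α t).c 3 ξ) ^ 2 + ((α t).c 4 ξ) ^ 2)) (Icc 0 T) := by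
    refine monotoneOn_of_hasDerivWithinAt_nonneg (convex_Icc 0 T)
      (fun s hs => (hd s hs).continuousWithinAt)
      (fun s hs => (hd s (interior_subset hs)).mono interior_subset) fun s hs => ?_
    have hs' := interior_subset hs
    have hx := hR s hs'
    have g := hb _ (α s).memE1_lag ((α s).sizeLe_lag hx) ξ
    have hU : |(α s).c 1 ξ| ≤ C := ((α s).abs_c_le 1 ξ).trans (by linarith)
    have hB := abs_rateB_le (a := 1 + (α s).c 2 ξ) (ν := (α s).c 4 ξ) hU g.1
    have hN := abs_rateN_le (a := 1 + (α s).c 2 ξ) (b := (α s).c 3 ξ) hU g.1 g.2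
    have hr := h.speed s hs'
    simp only [St.fieldFun, id]
    set a := 1 + (α s).c 2 ξ
    set b := (α s).c 3 ξ
    set ν := (α s).c 4 ξ
    set B := rateB ((α s).c 1 ξ) (Pop (α s).lag ξ) a ν
    set N := rateN ((α s).c 1 ξ) (Pop (α s).lag ξ) (Qop (α s).lag ξ) a b
    have e1 : |a * b| ≤ (a ^ 2 + b ^ 2 + ν ^ 2) / 2 := by
      rw [abs_mul]
      nlinarith [sq_nonneg (|a| - |b|), sq_abs a, sq_abs b, sq_nonneg ν]
    have e2 : |b * ν| ≤ (a ^ 2 + b ^ 2 + ν ^ 2) / 2 := by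
      rw [abs_mul]
      nlinarith [sq_nonneg (|b| - |ν|), sq_abs ν, sq_abs b, sq_nonneg a]
    have e3 : |a * ν| ≤ (a ^ 2 + b ^ 2 + ν ^ 2) / 2 := by
      rw [abs_mul]
      nlinarith [sq_nonneg (|a| - |ν|), sq_abs ν, sq_abs a, sq_nonneg b]
    have e4 : |b * B| ≤ (C ^ 2 + C) * |a * b| + |b * ν| := by
      rw [abs_mul, abs_mul, abs_mul]
      have := mul_le_mul_of_nonneg_left hB (abs_nonneg b)
      linarith
    have e5 : |ν * N| ≤ 2 * C ^ 2 * |a * ν| + (3 * C ^ 2 + 2 * C) * |b * ν| := by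
      rw [abs_mul, abs_mul, abs_mul]
      have := mul_le_mul_of_nonneg_left hN (abs_nonneg ν)
      linarith
    set S := a ^ 2 + b ^ 2 + ν ^ 2 with hS
    have hS0 : 0 ≤ S := by positivity
    have e6 : |a * b + b * B + ν * N| ≤ (L / 2) * S := by
      refine (abs_add_le _ _).trans ((add_le_add (abs_add_le _ _) le_rfl).trans ?_)
      have f1 := mul_le_mul_of_nonneg_left e1 (show 0 ≤ C ^ 2 + C by positivity)
      have f2 := mul_le_mul_of_nonneg_left e3 (show 0 ≤ 2 * C ^ 2 by positivity)
      have f3 := mul_le_mul_of_nonneg_left e2 (show 0 ≤ 3 * C ^ 2 + 2 * C by positivity)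
      have f4 : 0 ≤ C ^ 2 * S := by positivity
      have f5 : 0 ≤ C * S := by positivity
      rw [hL]
      linarith
    have e7 : |r s * (a * b + b * B + ν * N)| ≤ (L / 2) * S := by
      rw [abs_mul, abs_of_nonneg hr.1]
      calc _ ≤ 1 * (L / 2 * S) := mul_le_mul hr.2 e6 (abs_nonneg _) zero_le_one
        _ = _ := one_mul _
    have e8 := (abs_le.1 e7).1
    have e9 : 0 ≤ Real.exp (L * s) * (L * S + 2 * (r s * (a * b + b * B + ν * N))) :=
      mul_nonneg (Real.exp_pos _).le (by linarith)
    refine e9.trans_eq ?_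
    rw [hS]; push_cast; ring
  have h0 : (0 : ℝ) ∈ Icc 0 T := ⟨le_rfl, ht.1.trans ht.2⟩
  have := hm h0 ht ht.1
  simpa using this

theorem good (h0 : Good (α 0)) {t : ℝ} (ht : t ∈ Icc 0 T) : Good (α t) := by
  obtain ⟨c, hc, hc0⟩ := h0.pos
  obtain ⟨C, hC, hL⟩ := h.exists_lower_bound
  have hrel := fun ξ s (hs : s ∈ Icc 0 T) => h.rel_eq ξ (h0.rel ξ) hs
  set m := Real.exp (-(C * T)) * (c ^ 2 / 2) with hm
  have hm0 : 0 < m := by positivity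
  have hsq : ∀ ξ, ∀ s ∈ Icc 0 T, m ≤ (1 + (α s).c 2 ξ + (α s).c 4 ξ) ^ 2 ∧
      0 ≤ (1 + (α s).c 2 ξ) * (α s).c 4 ξ := by
    intro ξ s hs
    have h1 := hL ξ s hs
    have h2 := hrel ξ s hs
    have h3 := hc0 ξ
    have h4 : 0 ≤ (1 + (α s).c 2 ξ) * (α s).c 4 ξ := by rw [h2]; positivity
    refine ⟨?_, h4⟩
    have h5 : c ^ 2 / 2 ≤ (1 + (α 0).c 2 ξ) ^ 2 + ((α 0).c 3 ξ) ^ 2 + ((α 0).c 4 ξ) ^ 2 := by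
      have : c ^ 2 ≤ (1 + (α 0).c 2 ξ + (α 0).c 4 ξ) ^ 2 := by gcongr
      nlinarith [sq_nonneg ((1 + (α 0).c 2 ξ) - (α 0).c 4 ξ), sq_nonneg ((α 0).c 3 ξ)]
    have h6 : (1 + (α s).c 2 ξ) ^ 2 + ((α s).c 3 ξ) ^ 2 + ((α s).c 4 ξ) ^ 2 ≤
        (1 + (α s).c 2 ξ + (α s).c 4 ξ) ^ 2 := by
      nlinarith [mul_nonneg (sq_nonneg (1 + (α s).c 2 ξ)) (sq_nonneg ((α s).c 1 ξ))]
    have h7 : Real.exp (C * s) ≤ Real.exp (C * T) :=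
      Real.exp_le_exp.2 (mul_le_mul_of_nonneg_left hs.2 hC)
    have h8 : c ^ 2 / 2 ≤ Real.exp (C * T) * (1 + (α s).c 2 ξ + (α s).c 4 ξ) ^ 2 :=
      (h5.trans h1).trans (mul_le_mul h7 h6 (by positivity) (Real.exp_pos _).le)
    rw [hm, Real.exp_neg, inv_mul_le_iff₀ (Real.exp_pos _)]
    exact h8
  have hpos : ∀ ξ, 0 < 1 + (α t).c 2 ξ + (α t).c 4 ξ := by
    intro ξ
    by_contra hneg
    have hcont : ContinuousOn (fun s => 1 + (α s).c 2 ξ + (α s).c 4 ξ) (Icc 0 T) := fun s hs =>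
      (((h.comp_deriv 2 ξ hs).const_add 1).add (h.comp_deriv 4 ξ hs)).continuousWithinAt
    have h00 := hc0 ξ
    have hiv := intermediate_value_Icc' ht.1 (hcont.mono (Icc_subset_Icc_right ht.2))
    obtain ⟨s, hs, hs0⟩ := hiv ⟨not_lt.1 hneg, by linarith⟩
    have := (hsq ξ s ⟨hs.1, hs.2.trans ht.2⟩).1
    simp only at hs0
    rw [hs0] at this
    norm_num at this
    linarith
  refine ⟨fun ξ => ?_, fun ξ => ?_, ⟨Real.sqrt m, Real.sqrt_pos.2 hm0, fun ξ => ?_⟩,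
    fun ξ => hrel ξ t ht⟩
  · by_contra hn
    have := (hsq ξ t ht).2
    nlinarith [hpos ξ]
  · by_contra hn
    have := (hsq ξ t ht).2
    nlinarith [hpos ξ]
  · exact Real.sqrt_le_iff.2 ⟨(hpos ξ).le, (hsq ξ t ht).1⟩

end Traj

theorem exists_apriori_bound {x₀ : St} (h0 : Good x₀) {T : ℝ} (hT : 0 ≤ T) : ∃ R, 0 ≤ R ∧
    ∀ α r, Traj T α r → α 0 = x₀ → ∀ t ∈ Icc 0 T, ‖α t‖ ≤ R := by
  set K := 2 * (1 + energy x₀.lag) with hK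
  have hh := energy_nonneg x₀.lag
  set L := 1 + 5 * K ^ 2 + 2 * K with hL
  refine ⟨‖x₀‖ + K * T + K + 1 + (1 + 2 * ‖x₀‖) * Real.exp (L * T), by positivity, ?_⟩
  rintro α r h rfl t ht
  have hF : ∀ s ∈ Icc 0 T, (α s).lag ∈ setF ∧ energy (α s).lag = energy (α 0).lag := fun s hs =>
    ⟨(h.good h0 hs).memF, by rw [(h.good h0 hs).energy_eq, h0.energy_eq, h.mean_eq hs]⟩
  have hU : ∀ s ∈ Icc 0 T, ∀ ξ, |(α s).c 1 ξ| ≤ K := fun s hs ξ => by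
    rw [hK, ← (hF s hs).2]; exact abs_U_le_of_memF (hF s hs).1 ξ
  have hPQ : ∀ s ∈ Icc 0 T, ∀ ξ, |Pop (α s).lag ξ| ≤ K ∧ |Qop (α s).lag ξ| ≤ K := fun s hs ξ => by
    have := abs_PQ_le_of_memF (hF s hs).1 ξ
    rw [(hF s hs).2] at this
    exact ⟨this.1.trans (by linarith), this.2.trans (by linarith)⟩
  have hs0 : 0 ≤ K * T := by positivity
  have hn0 := norm_nonneg (α 0)
  have hexp : 0 ≤ (1 + 2 * ‖α 0‖) * Real.exp (L * T) := by positivity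
  have hK0 : 0 ≤ K := by linarith
  have hζ : ∀ ξ, |(α t).c 0 ξ| ≤ ‖α 0‖ + K * T := by
    intro ξ
    have h1 := norm_image_sub_le_of_norm_deriv_le_segment' (C := K)
      (fun s hs => h.comp_deriv 0 ξ hs) (fun s hs => by
        have hs' := Ico_subset_Icc_self hs
        rw [norm_mul, Real.norm_eq_abs, Real.norm_eq_abs, abs_of_nonneg (h.speed s hs').1]
        calc r s * |(α s).c 1 ξ| ≤ 1 * K :=
              mul_le_mul (h.speed s hs').2 (hU s hs' ξ) (abs_nonneg _) zero_le_one
          _ = K := one_mul K) t ht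
    have h2 : K * (t - 0) ≤ K * T := mul_le_mul_of_nonneg_left (by linarith [ht.2]) hK0
    have h3 := abs_sub_abs_le_abs_sub ((α t).c 0 ξ) ((α 0).c 0 ξ)
    have h4 := (α 0).abs_c_le 0 ξ
    rw [Real.norm_eq_abs] at h1
    linarith
  have hS : ∀ ξ, 1 + (α t).c 2 ξ + (α t).c 4 ξ ≤ (1 + 2 * ‖α 0‖) * Real.exp (L * T) := by
    intro ξ
    have hd : ∀ s ∈ Icc 0 T, HasDerivWithinAt (fun s => 1 + (α s).c 2 ξ + (α s).c 4 ξ)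
        (r s * (α s).fieldFun (2, ξ) + r s * (α s).fieldFun (4, ξ)) (Icc 0 T) s := fun s hs =>
      ((h.comp_deriv 2 ξ hs).const_add 1).add (h.comp_deriv 4 ξ hs)
    have h1 := norm_le_gronwallBound_of_norm_deriv_right_le (δ := 1 + 2 * ‖α 0‖) (K := L) (ε := 0)
      (fun s hs => (hd s hs).continuousWithinAt)
      (fun s hs => (hd s (Ico_subset_Icc_self hs)).mono_of_mem_nhdsWithin
        (mem_of_superset (Icc_mem_nhdsGE hs.2) (Icc_subset_Icc_left hs.1)))
      (by
        have h1 := (α 0).abs_c_le 2 ξ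
        have h2 := (α 0).abs_c_le 4 ξ
        rw [Real.norm_eq_abs]
        have h3 := (abs_add_le (1 + (α 0).c 2 ξ) ((α 0).c 4 ξ)).trans
          (add_le_add (abs_add_le 1 ((α 0).c 2 ξ)) le_rfl)
        rw [abs_one] at h3
        linarith)
      (fun s hs => by
        have hs' := Ico_subset_Icc_self hs
        have g := h.good h0 hs'
        have ga := g.a ξ
        have gν := g.ν ξ
        have gb := abs_le_half_add ga gν (g.rel ξ)
        rw [← mul_add, norm_mul, Real.norm_eq_abs, Real.norm_eq_abs, Real.norm_eq_abs,
          abs_of_nonneg (h.speed s hs').1, abs_of_nonneg (add_nonneg ga gν), add_zero]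
        have hN := abs_rateN_le (a := 1 + (α s).c 2 ξ) (b := (α s).c 3 ξ) (hU s hs' ξ)
          (hPQ s hs' ξ).1 (hPQ s hs' ξ).2
        have hsum : |(α s).fieldFun (2, ξ) + (α s).fieldFun (4, ξ)| ≤
            L * (1 + (α s).c 2 ξ + (α s).c 4 ξ) := by
          refine (abs_add_le _ _).trans ?_
          change |(α s).c 3 ξ| + |rateN _ _ _ _ _| ≤ _
          rw [abs_of_nonneg ga] at hN
          set a := 1 + (α s).c 2 ξ
          have m1 := mul_le_mul_of_nonneg_left gb (show 0 ≤ 3 * K ^ 2 + 2 * K by positivity)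
          have m2 : 0 ≤ K ^ 2 * (α s).c 4 ξ := by positivity
          have m3 : 0 ≤ K * (a + (α s).c 4 ξ) := by positivity
          have m4 : 0 ≤ K ^ 2 * a := by positivity
          rw [hL]
          linarith
        calc _ ≤ 1 * (L * (1 + (α s).c 2 ξ + (α s).c 4 ξ)) :=
              mul_le_mul (h.speed s hs').2 hsum (abs_nonneg _) zero_le_one
          _ = _ := one_mul _) t ht
    rw [gronwallBound_ε0] at h1
    refine (le_abs_self _).trans (h1.trans ?_)
    refine mul_le_mul_of_nonneg_left (Real.exp_le_exp.2 ?_) (by linarith)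
    exact mul_le_mul_of_nonneg_left (by linarith [ht.2]) (by positivity)
  have g := h.good h0 ht
  refine St.norm_le (by positivity) fun i ξ => ?_
  have ga := g.a ξ
  have gν := g.ν ξ
  have gb := abs_le_half_add ga gν (g.rel ξ)
  have gS := hS ξ
  fin_cases i
  · exact (hζ ξ).trans (by linarith)
  · exact (hU t ht ξ).trans (by linarith)
  · change |(α t).c 2 ξ| ≤ _
    rw [abs_le]; constructor <;> linarith
  · change |(α t).c 3 ξ| ≤ _
    linarith
  · change |(α t).c 4 ξ| ≤ _
    rw [abs_of_nonneg gν]; linarith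

theorem exists_global_state {x₀ : St} (h0 : Good x₀) : ∃ α : ℝ → St, α 0 = x₀ ∧
    (∀ t, 0 ≤ t → HasDerivWithinAt α (α t).field (Ici 0) t) ∧
    ∀ t, 0 ≤ t → (α t).lag ∈ setF ∧ energy (α t).lag = energy x₀.lag := by
  obtain ⟨α, hα0, hα⟩ := St.lipOnBalls_field.exists_global (x₀ := x₀) (fun T hT => by
    obtain ⟨R, hR, H⟩ := exists_apriori_bound h0 hT
    obtain ⟨α, hα0, hα⟩ := St.lipOnBalls_field.exists_truncated_solution hR hT x₀
    choose! r hr1 hr2 hr3 using hα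
    have hb := H α r ⟨hr1, hr3⟩ hα0
    refine ⟨α, hα0, fun t ht => ?_⟩
    have := hr3 t ht
    rwa [hr2 t ht (hb t ht), one_smul] at this)
  refine ⟨α, hα0, hα, fun t ht => ?_⟩
  have htr : Traj t α fun _ => 1 := ⟨fun _ _ => by simp, fun s hs => by
    rw [one_smul]; exact (hα s hs.1).mono Icc_subset_Ici_self⟩
  subst hα0
  have ht' : t ∈ Icc 0 t := ⟨ht, le_rfl⟩
  exact ⟨(htr.good h0 ht').memF, by
    rw [(htr.good h0 ht').energy_eq, h0.energy_eq, htr.mean_eq ht']⟩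


theorem LagEq.memF {X Y : Lag} (h : LagEq X Y) (hX : X ∈ setF) : Y ∈ setF := by
  obtain ⟨y, U, ν⟩ := X
  obtain ⟨y', U', ν'⟩ := Y
  obtain ⟨rfl, rfl, hν⟩ := h
  obtain ⟨h1, h2, h3, h4, ⟨C, h5⟩, h6, h7, ⟨c, hc, h8⟩, h9⟩ := hX
  replace hν : ν =ᵐ[volume] ν' := hν
  refine ⟨⟨h1.1, h1.2.1, h1.2.2.congr hν⟩, h2, h3, h4, ⟨C, ?_⟩, h6, ?_, ⟨c, hc, ?_⟩, ?_⟩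
  · filter_upwards [h5, hν] with x a b
    change |ν' x| ≤ C
    rw [← b]; exact a
  · filter_upwards [h7, hν] with x a b
    change 0 ≤ ν' x
    rw [← b]; exact a
  · filter_upwards [h8, hν] with x a b
    change c ≤ deriv y x + ν' x
    rw [← b]; exact a
  · filter_upwards [h9, hν] with x a b
    change deriv y x * ν' x = (deriv y x) ^ 2 * (U x) ^ 2 + (deriv U x) ^ 2
    rw [← b]; exact a

/-- Every element of `F` has a representative satisfying the defining relations everywhere. -/
theorem exists_good_state {X : Lag} (hX : X ∈ setF) : ∃ x : St, Good x ∧ LagEq x.lag X := by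
  have hE := memE1_of_memF hX
  obtain ⟨-, -, hLy, hLU, ⟨C, hC⟩, h1, h2, ⟨c, hc, h3⟩, h4⟩ := hX
  obtain ⟨Ky, hKy⟩ := exists_lipschitzWith_of_periodic hLy hE.y.2
  obtain ⟨KU, hKU⟩ := exists_lipschitzWith_of_periodic (α := 0) hLU
    (fun ξ => by rw [hE.U.2 ξ, add_zero])
  have hUb := abs_le_supN_of_periodic hE.U.1.continuous hE.U.2
  obtain ⟨g, hgm, hg⟩ := hE.ν.1.aestronglyMeasurable
  have hgper : ∀ᵐ ξ : ℝ, g (ξ + 1) = g ξ := by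
    filter_upwards [hE.ν.2, hg, ae_comp_add hg 1] with ξ a b d
    rw [← b, ← d, a]
  -- a measurable, exactly periodic representative of `ν`
  obtain ⟨n, hnm, hnp, hn⟩ : ∃ n : ℝ → ℝ, Measurable n ∧ Function.Periodic n 1 ∧
      n =ᵐ[volume] X.ν := by
    refine ⟨fun ξ => g (Int.fract ξ), hgm.measurable.comp measurable_fract, fun x => by simp, ?_⟩
    have h1 : ∀ n : ℤ, ∀ᵐ ξ : ℝ, g (ξ + n + 1) = g (ξ + n) := fun n => ae_comp_add hgper n
    filter_upwards [ae_all_iff.2 h1, hg] with x hx hxg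
    have : ∀ n : ℤ, g (x + n) = g x := by
      intro n
      induction n using Int.induction_on with
      | zero => simp
      | succ k ih => rw [← ih, ← hx k]; push_cast; ring_nf
      | pred k ih => rw [← ih, ← hx]; push_cast; ring_nf
    have h2 := this (-⌊x⌋)
    rw [hxg, ← h2]
    congr 1
    push_cast
    rw [Int.fract]; ring
  set p : Set ℝ := {ξ | 0 ≤ deriv X.y ξ ∧ 0 ≤ n ξ ∧ c ≤ deriv X.y ξ + n ξ ∧ |n ξ| ≤ C ∧
    deriv X.y ξ * n ξ = (deriv X.y ξ) ^ 2 * (X.U ξ) ^ 2 + (deriv X.U ξ) ^ 2} with hp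
  have my := measurable_deriv X.y
  have mU' := measurable_deriv X.U
  have mU := hE.U.1.continuous.measurable
  have hpm : MeasurableSet p :=
    (measurableSet_le measurable_const my).inter ((measurableSet_le measurable_const hnm).inter
      ((measurableSet_le measurable_const (my.add hnm)).inter
        ((measurableSet_le hnm.abs measurable_const).inter (measurableSet_eq_fun (my.mul hnm)
          (((my.pow_const 2).mul (mU.pow_const 2)).add (mU'.pow_const 2))))))
  have py : Function.Periodic (deriv X.y) 1 := deriv_add_one hE.y.2
  have pU' : Function.Periodic (deriv X.U) 1 :=
    deriv_add_one (α := 0) (fun ξ => by rw [hE.U.2 ξ, add_zero])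
  have hpp : ∀ ξ, ξ + 1 ∈ p ↔ ξ ∈ p := fun ξ => by
    simp only [hp, mem_ofPred_eq, py ξ, pU' ξ, hnp ξ, hE.U.2 ξ]
  have hpae : ∀ᵐ ξ, ξ ∈ p := by
    filter_upwards [h1, h2, h3, h4, hC, hn] with ξ a1 a2 a3 a4 a5 a6
    simp only [hp, mem_ofPred_eq, a6]
    exact ⟨a1, a2, a3, a5, a4⟩
  classical
  let f : Fin 5 × ℝ → ℝ := fun q => match q.1 with
    | 0 => X.y q.2 - q.2
    | 1 => X.U q.2
    | 2 => p.piecewise (fun ξ => deriv X.y ξ - 1) (fun _ => 0) q.2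
    | 3 => p.piecewise (deriv X.U) (fun _ => 0) q.2
    | 4 => p.piecewise n (fun ξ => (X.U ξ) ^ 2) q.2
  have hζp : Function.Periodic (fun ξ => X.y ξ - ξ) 1 := fun ξ => by
    simp only [hE.y.2 ξ]; ring
  have hζb := abs_le_supN_of_periodic (hE.y.1.sub W11loc.id).continuous hζp
  have hfb : ∀ q, |f q| ≤ supN (fun ξ => X.y ξ - ξ) + supN X.U + (Ky + 1) + KU +
      (|C| + (supN X.U) ^ 2) := by
    have b1 := supN_nonneg (fun ξ => X.y ξ - ξ)
    have b2 := supN_nonneg X.U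
    have b3 := Ky.coe_nonneg
    have b4 := KU.coe_nonneg
    have b5 := abs_nonneg C
    have b6 := sq_nonneg (supN X.U)
    rintro ⟨i, ξ⟩
    fin_cases i
    · exact (hζb ξ).trans (by linarith)
    · exact (hUb ξ).trans (by linarith)
    · change |p.piecewise (fun ξ => deriv X.y ξ - 1) (fun _ => 0) ξ| ≤ _
      by_cases hξ : ξ ∈ p
      · rw [piecewise_eq_of_mem _ _ _ hξ]
        have := abs_deriv_le_of_lipschitz hKy ξ
        exact (abs_sub _ _).trans (by rw [abs_one]; linarith)
      · rw [piecewise_eq_of_notMem _ _ _ hξ, abs_zero]; positivity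
    · change |p.piecewise (deriv X.U) (fun _ => 0) ξ| ≤ _
      by_cases hξ : ξ ∈ p
      · rw [piecewise_eq_of_mem _ _ _ hξ]
        exact (abs_deriv_le_of_lipschitz hKU ξ).trans (by linarith)
      · rw [piecewise_eq_of_notMem _ _ _ hξ, abs_zero]; positivity
    · change |p.piecewise n (fun ξ => (X.U ξ) ^ 2) ξ| ≤ _
      by_cases hξ : ξ ∈ p
      · rw [piecewise_eq_of_mem _ _ _ hξ]
        exact (hξ.2.2.2.1.trans (le_abs_self C)).trans (by linarith)
      · rw [piecewise_eq_of_notMem _ _ _ hξ, abs_pow]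
        have : |X.U ξ| ^ 2 ≤ (supN X.U) ^ 2 := by gcongr; exact hUb ξ
        linarith
  have hf2 : ∀ᵐ ξ, f (2, ξ) = deriv X.y ξ - 1 := hpae.mono fun ξ hξ =>
    piecewise_eq_of_mem _ _ _ hξ
  have hf3 : ∀ᵐ ξ, f (3, ξ) = deriv X.U ξ := hpae.mono fun ξ hξ =>
    piecewise_eq_of_mem _ _ _ hξ
  have hf4 : ∀ᵐ ξ, f (4, ξ) = X.ν ξ := by
    filter_upwards [hpae, hn] with ξ hξ h
    exact (piecewise_eq_of_mem _ _ _ hξ).trans h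
  let x : St := ⟨⟨f, memℓp_infty ⟨_, by rintro _ ⟨q, rfl⟩; exact hfb q⟩⟩, by
    refine ⟨fun i => ?_, fun i ξ => ?_, fun ξ => ?_, fun ξ => ?_⟩
    · fin_cases i
      · exact (hE.y.1.sub W11loc.id).continuous.measurable
      · exact mU
      · exact Measurable.piecewise hpm (my.sub_const 1) measurable_const
      · exact Measurable.piecewise hpm mU' measurable_const
      · exact Measurable.piecewise hpm hnm (mU.pow_const 2)
    · change f (i, ξ + 1) = f (i, ξ)
      fin_cases i
      · exact hζp ξ
      · exact hE.U.2 ξ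
      · simp only [f, Set.piecewise, hpp, py ξ]
      · simp only [f, Set.piecewise, hpp, pU' ξ]
      · simp only [f, Set.piecewise, hpp, hnp ξ, hE.U.2 ξ]
    · change X.y ξ - ξ = X.y 0 - 0 + ∫ η in (0 : ℝ)..ξ, f (2, η)
      rw [(hE.y.1.sub W11loc.id).eq_add_integral ξ]
      congr 1
      refine intervalIntegral.integral_congr_ae ?_
      filter_upwards [hE.y.1.deriv_sub_ae W11loc.id, hf2] with η e1 e2 _
      rw [e1, e2]; simp
    · change X.U ξ = X.U 0 + ∫ η in (0 : ℝ)..ξ, f (3, η)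
      rw [hE.U.1.eq_add_integral ξ]
      congr 1
      exact intervalIntegral.integral_congr_ae (hf3.mono fun η e _ => e.symm)⟩
  refine ⟨x, ⟨fun ξ => ?_, fun ξ => ?_, ⟨min c 1, by positivity, fun ξ => ?_⟩, fun ξ => ?_⟩, ?_⟩
  · change 0 ≤ 1 + p.piecewise (fun ξ => deriv X.y ξ - 1) (fun _ => 0) ξ
    by_cases hξ : ξ ∈ p
    · rw [piecewise_eq_of_mem _ _ _ hξ]; linarith [hξ.1]
    · rw [piecewise_eq_of_notMem _ _ _ hξ]; norm_num
  · change 0 ≤ p.piecewise n (fun ξ => (X.U ξ) ^ 2) ξ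
    by_cases hξ : ξ ∈ p
    · rw [piecewise_eq_of_mem _ _ _ hξ]; exact hξ.2.1
    · rw [piecewise_eq_of_notMem _ _ _ hξ]; positivity
  · change min c 1 ≤ 1 + p.piecewise (fun ξ => deriv X.y ξ - 1) (fun _ => 0) ξ +
      p.piecewise n (fun ξ => (X.U ξ) ^ 2) ξ
    by_cases hξ : ξ ∈ p
    · rw [piecewise_eq_of_mem _ _ _ hξ, piecewise_eq_of_mem _ _ _ hξ]
      exact (min_le_left _ _).trans (by linarith [hξ.2.2.1])
    · rw [piecewise_eq_of_notMem _ _ _ hξ, piecewise_eq_of_notMem _ _ _ hξ]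
      exact (min_le_right _ _).trans (by nlinarith [sq_nonneg (X.U ξ)])
  · change (1 + p.piecewise (fun ξ => deriv X.y ξ - 1) (fun _ => 0) ξ) *
      p.piecewise n (fun ξ => (X.U ξ) ^ 2) ξ =
      (1 + p.piecewise (fun ξ => deriv X.y ξ - 1) (fun _ => 0) ξ) ^ 2 * (X.U ξ) ^ 2 +
        (p.piecewise (deriv X.U) (fun _ => 0) ξ) ^ 2
    by_cases hξ : ξ ∈ p
    · simp only [piecewise_eq_of_mem _ _ _ hξ]
      have := hξ.2.2.2.2
      linear_combination this
    · simp only [piecewise_eq_of_notMem _ _ _ hξ]; ring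
  · refine ⟨?_, rfl, hf4⟩
    funext ξ
    change ξ + (X.y ξ - ξ) = X.y ξ
    ring

/-! ## Solutions of the Lagrangian system -/

theorem LagEq.isGlobalSolution {X : ℝ → Lag} {X₀ Y₀ : Lag} (h : LagEq X₀ Y₀)
    (hX : IsGlobalSolution X X₀) : IsGlobalSolution X Y₀ := ⟨hX.1.trans h, hX.2⟩

theorem tendsto_normE_lin {ι : Type*} {l : Filter ι} {f : ι → St} (h : Tendsto f l (𝓝 0)) :
    Tendsto (fun i => normE (f i).lin) l (𝓝 0) := by
  refine squeeze_zero (fun _ => normE_nonneg _) (fun i => (f i).normE_lin_le) ?_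
  simpa using h.norm.const_mul 5

theorem isGlobalSolution_of_state {α : ℝ → St}
    (hα : ∀ t, 0 ≤ t → HasDerivWithinAt α (α t).field (Ici 0) t) :
    IsGlobalSolution (fun t => (α t).lag) (α 0).lag := by
  refine ⟨LagEq.refl _, fun t _ => ⟨(α t).memE1_lag.memE, (α t).memE1_lag.memE0_vecField.memE⟩,
    fun t ht => ?_, fun t ht => ?_⟩
  · have h1 := hasDerivWithinAt_iff_tendsto_slope.1 (hα t ht)
    have h2 : Tendsto (fun s => (s - t)⁻¹ • (α s - α t) - (α t).field) (𝓝[Ici 0 \ {t}] t) (𝓝 0) := by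
      have := h1.sub_const (α t).field
      rw [sub_self] at this
      exact this
    refine (tendsto_normE_lin h2).congr fun s => ?_
    have e : ((s - t)⁻¹ • (α s - α t) - (α t).field).lin =
        (s - t)⁻¹ • ((α s).lag - (α t).lag) - (α t).field.lin := by
      rw [St.lag_sub]; rfl
    rw [e]
    exact ((LagEq.refl _).sub (α t).lin_field).normE_eq
  · have hc : Tendsto (fun s => (α s).field - (α t).field) (𝓝[Ici 0] t) (𝓝 0) := by
      have hcont : Tendsto α (𝓝[Ici 0] t) (𝓝 (α t)) := (hα t ht).continuousWithinAt
      obtain ⟨C, hC, H⟩ := St.lipOnBalls_field (‖α t‖ + 1)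
      have hev : ∀ᶠ s in 𝓝[Ici 0] t, ‖(α s).field - (α t).field‖ ≤ C * ‖α s - α t‖ := by
        filter_upwards [hcont.norm.eventually (Iic_mem_nhds (by linarith : ‖α t‖ < ‖α t‖ + 1))]
          with s hs
        exact H _ _ hs (by linarith)
      refine squeeze_zero_norm' hev ?_
      have := ((hcont.sub_const (α t)).norm).const_mul C
      simpa using this
    refine (tendsto_normE_lin hc).congr fun s => ?_
    exact (((α s).lin_field).sub (α t).lin_field).normE_eq

theorem exists_globalSolution {X₀ : Lag} (h : X₀ ∈ setF) : ∃ X : ℝ → Lag,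
    IsGlobalSolution X X₀ ∧ ∀ t, 0 ≤ t → X t ∈ setF ∧ energy (X t) = energy X₀ := by
  obtain ⟨x, hx, hxX⟩ := exists_good_state h
  obtain ⟨α, rfl, hα, hF⟩ := exists_global_state hx
  refine ⟨_, hxX.isGlobalSolution (isGlobalSolution_of_state hα), fun t ht => ?_⟩
  rw [← hxX.energy_eq]
  exact hF t ht

namespace IsGlobalSolution

variable {X Y : ℝ → Lag} {X₀ Y₀ : Lag}

theorem memE1 (hX : IsGlobalSolution X X₀) (h0 : MemE1 X₀) {t : ℝ} (ht : 0 ≤ t) :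
    MemE1 (X t) := by
  have hE := fun s hs => (hX.2.1 s hs).1
  have hV := fun s hs => (hX.2.1 s hs).2
  have hd : ∀ s ∈ Icc 0 t, HasDerivWithinAt (fun s => (X s).y 1 - (X s).y 0) 0 (Icc 0 t) s := by
    intro s hs
    refine HasDerivWithinAt.mono ?_ (Icc_subset_Ici_self : Icc 0 t ⊆ Ici 0)
    rw [hasDerivWithinAt_iff_tendsto_slope, tendsto_iff_norm_sub_tendsto_zero]
    have h1 := hX.2.2.1 s hs.1
    refine squeeze_zero' (Eventually.of_forall fun _ => norm_nonneg _) ?_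
      (by simpa using h1.const_mul 2)
    filter_upwards [self_mem_nhdsWithin] with r hr
    set Z := (r - s)⁻¹ • (X r - X s) - vecField (X s)
    have hc : Continuous Z.y := by
      have c1 := (hE r hr.1).1.1.continuous
      have c2 := (hE s hs.1).1.1.continuous
      have c3 := (hE s hs.1).2.1.1.continuous
      exact ((c1.sub c2).const_smul (r - s)⁻¹).sub c3
    have b1 := (abs_le_supN hc (ξ := 1) (by simp)).trans (supN_y_le_normE Z)
    have b0 := (abs_le_supN hc (ξ := 0) (by simp)).trans (supN_y_le_normE Z)
    have hU := (hE s hs.1).2.1.2 0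
    rw [zero_add] at hU
    have e : slope (fun s => (X s).y 1 - (X s).y 0) s r - 0 = Z.y 1 - Z.y 0 := by
      change (r - s)⁻¹ * (((X r).y 1 - (X r).y 0) - ((X s).y 1 - (X s).y 0)) - 0 =
        ((r - s)⁻¹ * ((X r).y 1 - (X s).y 1) - (X s).U 1) -
          ((r - s)⁻¹ * ((X r).y 0 - (X s).y 0) - (X s).U 0)
      rw [hU]; ring
    rw [e, Real.norm_eq_abs]
    exact (abs_sub _ _).trans (by linarith)
  have key := eq_of_hasDerivWithinAt_zero hd ⟨ht, le_rfl⟩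
  have hy0 := h0.y.2 0
  rw [← hX.1.1, zero_add] at hy0
  obtain ⟨⟨hW, a, ha⟩, hU, hν⟩ := hE t ht
  have ha0 := ha 0
  rw [zero_add] at ha0
  have : a = 1 := by linarith
  exact ⟨⟨hW, this ▸ ha⟩, hU, hν⟩

theorem memE0_sub (hX : IsGlobalSolution X X₀) (h0 : MemE1 X₀) {s t : ℝ} (hs : 0 ≤ s)
    (ht : 0 ≤ t) : MemE0 (X s - X t) := (hX.memE1 h0 hs).sub (hX.memE1 h0 ht)

theorem tendsto_normE_sub (hX : IsGlobalSolution X X₀) (h0 : MemE1 X₀) {t : ℝ} (ht : 0 ≤ t) :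
    Tendsto (fun s => normE (X s - X t)) (𝓝[Ici 0] t) (𝓝 0) := by
  have e0 : normE (X t - X t) = 0 := by rw [sub_self, normE_zero]
  have : ContinuousWithinAt (fun s => normE (X s - X t)) (Ici 0) t := by
    rw [← continuousWithinAt_sdiff_self]
    change Tendsto _ _ (𝓝 (normE (X t - X t)))
    rw [e0]
    have hv := (hX.memE1 h0 ht).memE0_vecField
    have h1 := hX.2.2.1 t ht
    have h2 : Tendsto (fun s : ℝ => |s - t|) (𝓝[Ici 0 \ {t}] t) (𝓝 0) := by
      have : Continuous fun s : ℝ => |s - t| := by fun_prop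
      have h := (this.tendsto t).mono_left (nhdsWithin_le_nhds (s := Ici 0 \ {t}))
      simpa using h
    refine squeeze_zero' (Eventually.of_forall fun _ => normE_nonneg _) ?_
      (by simpa using h2.mul (h1.add_const (normE (vecField (X t)))))
    filter_upwards [self_mem_nhdsWithin] with s hs
    have hst : s - t ≠ 0 := sub_ne_zero.2 hs.2
    have hm := hX.memE0_sub h0 hs.1 ht
    have e : X s - X t = (s - t) • (((s - t)⁻¹ • (X s - X t) - vecField (X t)) + vecField (X t)) := by
      rw [sub_add_cancel, smul_smul, mul_inv_cancel₀ hst, one_smul]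
    rw [e, normE_smul]
    refine mul_le_mul_of_nonneg_left ?_ (abs_nonneg _)
    rw [← e]
    exact normE_add_le ((hm.smul _).sub hv) hv
  change Tendsto _ _ (𝓝 (normE (X t - X t))) at this
  rwa [e0] at this

theorem abs_normE_sub_sub_le {A B A' B' : Lag} (h1 : MemE0 (A - A')) (h2 : MemE0 (B - B'))
    (h3 : MemE0 (A' - B')) (h4 : MemE0 (A - B)) :
    |normE (A - B) - normE (A' - B')| ≤ normE (A - A') + normE (B - B') := by
  have h2' : MemE0 (B' - B) := by simpa using h2.smul (-1)
  have h1' : MemE0 (A' - A) := by simpa using h1.smul (-1)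
  have a1 := normE_add_le (h1.add h3) h2'
  have a2 := normE_add_le h1 h3
  have b1 := normE_add_le (h1'.add h4) h2
  have b2 := normE_add_le h1' h4
  rw [show A - A' + (A' - B') + (B' - B) = A - B by abel, normE_sub_comm B' B] at a1
  rw [show A' - A + (A - B) + (B - B') = A' - B' by abel] at b1
  rw [normE_sub_comm A' A] at b2
  rw [abs_le]; constructor <;> linarith

theorem continuousOn_normE_sub (hX : IsGlobalSolution X X₀) (h0 : MemE1 X₀)
    (hY : IsGlobalSolution Y Y₀) (h0' : MemE1 Y₀) :
    ContinuousOn (fun t => normE (X t - Y t)) (Ici 0) := by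
  intro t ht
  unfold ContinuousWithinAt
  rw [tendsto_iff_norm_sub_tendsto_zero]
  refine squeeze_zero' (Eventually.of_forall fun _ => norm_nonneg _) ?_
    (by simpa using (hX.tendsto_normE_sub h0 ht).add (hY.tendsto_normE_sub h0' ht))
  filter_upwards [self_mem_nhdsWithin] with s hs
  exact abs_normE_sub_sub_le (hX.memE0_sub h0 hs ht) (hY.memE0_sub h0' hs ht)
    ((hX.memE1 h0 ht).sub (hY.memE1 h0' ht)) ((hX.memE1 h0 hs).sub (hY.memE1 h0' hs))

theorem normE_sub_le_exp (hX : IsGlobalSolution X X₀) (h0 : MemE1 X₀)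
    (hY : IsGlobalSolution Y Y₀) (h0' : MemE1 Y₀) {T C : ℝ}
    (hC : ∀ t ∈ Icc 0 T, normE (vecField (X t) - vecField (Y t)) ≤ C * normE (X t - Y t)) {t : ℝ}
    (ht : t ∈ Icc 0 T) : normE (X t - Y t) ≤ normE (X₀ - Y₀) * Real.exp (C * t) := by
  have h := le_gronwallBound_of_liminf_deriv_right_le (f := fun t => normE (X t - Y t))
    (f' := fun t => normE (vecField (X t) - vecField (Y t))) (δ := normE (X₀ - Y₀)) (K := C)
    (ε := 0) (a := 0) (b := T)
    ((hX.continuousOn_normE_sub h0 hY h0').mono Icc_subset_Ici_self) ?_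
    ((hX.1.sub hY.1).normE_eq.le) (fun s hs => by
      rw [add_zero]; exact hC s (Ico_subset_Icc_self hs)) t ht
  · rwa [gronwallBound_ε0, sub_zero] at h
  intro s hs r hr
  refine Eventually.frequently ?_
  have hle : 𝓝[>] s ≤ 𝓝[Ici 0 \ {s}] s := nhdsWithin_mono _ fun z hz =>
    ⟨hs.1.trans (le_of_lt hz), fun h => (ne_of_gt hz) h⟩
  have l1 := (hX.2.2.1 s hs.1).mono_left hle
  have l2 := (hY.2.2.1 s hs.1).mono_left hle
  have l3 := (l1.add l2).const_add (normE (vecField (X s) - vecField (Y s)))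
  simp only [add_zero] at l3
  filter_upwards [l3.eventually (Iio_mem_nhds hr), self_mem_nhdsWithin] with z hz hzs
  refine lt_of_le_of_lt ?_ hz
  have hpos : 0 < z - s := sub_pos.2 hzs
  have hz0 : 0 ≤ z := hs.1.trans (le_of_lt hzs)
  rw [inv_mul_le_iff₀ hpos]
  have vX := (hX.memE1 h0 hs.1).memE0_vecField
  have vY := (hY.memE1 h0' hs.1).memE0_vecField
  have mX := (hX.memE0_sub h0 hz0 hs.1)
  have mY := (hY.memE0_sub h0' hz0 hs.1)
  have mXY := (hX.memE1 h0 hs.1).sub (hY.memE1 h0' hs.1)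
  have eX := (mX.smul (z - s)⁻¹).sub vX
  have eY := (mY.smul (z - s)⁻¹).sub vY
  have e : X z - Y z = (X s - Y s) + (z - s) • ((vecField (X s) - vecField (Y s)) +
      (((z - s)⁻¹ • (X z - X s) - vecField (X s)) -
        ((z - s)⁻¹ • (Y z - Y s) - vecField (Y s)))) := by
    have h1 : (vecField (X s) - vecField (Y s)) +
      (((z - s)⁻¹ • (X z - X s) - vecField (X s)) -
        ((z - s)⁻¹ • (Y z - Y s) - vecField (Y s))) =
        (z - s)⁻¹ • ((X z - X s) - (Y z - Y s)) := by rw [smul_sub (z - s)⁻¹ (X z - X s)]; abel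
    rw [h1, smul_smul, mul_inv_cancel₀ hpos.ne', one_smul]; abel
  have n1 := normE_add_le mXY (((vX.sub vY).add (eX.sub eY)).smul (z - s))
  rw [← e, normE_smul, abs_of_pos hpos] at n1
  have n2 := normE_add_le (vX.sub vY) (eX.sub eY)
  have n3 : normE (((z - s)⁻¹ • (X z - X s) - vecField (X s)) -
        ((z - s)⁻¹ • (Y z - Y s) - vecField (Y s))) ≤
      normE ((z - s)⁻¹ • (X z - X s) - vecField (X s)) +
        normE ((z - s)⁻¹ • (Y z - Y s) - vecField (Y s)) := by
    have := normE_add_le eX (eY.smul (-1))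
    rw [normE_smul, neg_one_smul, ← sub_eq_add_neg, abs_neg, abs_one, one_mul] at this
    exact this
  have n4 := mul_le_mul_of_nonneg_left (n2.trans (add_le_add le_rfl n3)) hpos.le
  linarith

end IsGlobalSolution

theorem MemE1.lagEq_of_normE_sub_eq_zero {X Y : Lag} (hX : MemE1 X) (hY : MemE1 Y)
    (h : normE (X - Y) = 0) : LagEq X Y := by
  refine ⟨funext fun ξ => ?_, funext fun ξ => ?_, ?_⟩
  · have := abs_y_sub_le hX hY ξ
    rw [h] at this
    exact sub_eq_zero.1 (abs_nonpos_iff.1 this)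
  · have := abs_U_sub_le hX hY ξ
    rw [h] at this
    exact sub_eq_zero.1 (abs_nonpos_iff.1 this)
  · have h1 : normL1 (fun x => X.ν x - Y.ν x) = 0 :=
      le_antisymm (h ▸ normL1_ν_sub_le) (normL1_nonneg _)
    have hm := hX.ν.sub hY.ν
    have h2 : ∀ n : ℤ, ∀ᵐ x, x ∈ Ioc (n : ℝ) (n + 1) → X.ν x = Y.ν x := by
      intro n
      rw [hm.normL1_eq n, intervalIntegral.integral_of_le (by linarith)] at h1
      have hi := (intervalIntegrable_iff_integrableOn_Ioc_of_le (by linarith)).1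
        (hm.abs.intervalIntegrable (n : ℝ) (n + 1))
      have h3 := (setIntegral_eq_zero_iff_of_nonneg_ae
        (Eventually.of_forall fun x => abs_nonneg _) hi).1 h1
      rw [Filter.EventuallyEq, ae_restrict_iff' measurableSet_Ioc] at h3
      filter_upwards [h3] with x hx hxn
      exact sub_eq_zero.1 (abs_eq_zero.1 (hx hxn))
    filter_upwards [ae_all_iff.2 h2] with x hx
    have hc := hx (⌈x⌉ - 1)
    refine hc ⟨?_, ?_⟩
    · have := Int.ceil_lt_add_one x
      push_cast; linarith
    · have := Int.le_ceil x
      push_cast; linarith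

theorem normE_le_add {X Y : Lag} (hX : MemE1 X) (hY : MemE1 Y) :
    normE X ≤ normE (X - Y) + normE Y := by
  have h1 := normV_add_le (hX.sub hY).y.1 hY.y.1
  have h2 := normV_add_le (hX.sub hY).U.1 hY.U.1
  have h3 := normL1_add_le (hX.sub hY).ν.1 hY.ν.1
  have e : normE X = normV (fun x => (X - Y).y x + Y.y x) + normV (fun x => (X - Y).U x + Y.U x) +
    normL1 (fun x => (X - Y).ν x + Y.ν x) := by
    unfold normE
    congr
    · funext x; change X.y x = X.y x - Y.y x + Y.y x; ring
    · funext x; change X.U x = X.U x - Y.U x + Y.U x; ring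
    · funext x; change X.ν x = X.ν x - Y.ν x + Y.ν x; ring
  rw [e]; unfold normE; linarith

theorem IsGlobalSolution.unique {X Z : ℝ → Lag} {X₀ : Lag} (h0 : MemE1 X₀)
    (hX : IsGlobalSolution X X₀) (hZ : IsGlobalSolution Z X₀) {t : ℝ} (ht : 0 ≤ t) :
    LagEq (Z t) (X t) := by
  have hb : ∀ W : ℝ → Lag, IsGlobalSolution W X₀ → ∃ R, ∀ s ∈ Icc 0 t, SizeLe R (W s) := by
    intro W hW
    have hc : ContinuousOn (fun s => normE (W s - W 0)) (Icc 0 t) := by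
      intro s hs
      refine ContinuousWithinAt.mono ?_ (Icc_subset_Ici_self : Icc 0 t ⊆ Ici 0)
      unfold ContinuousWithinAt
      rw [tendsto_iff_norm_sub_tendsto_zero]
      refine squeeze_zero' (Eventually.of_forall fun _ => norm_nonneg _) ?_
        (hW.tendsto_normE_sub h0 hs.1)
      filter_upwards [self_mem_nhdsWithin] with r hr
      have z0 : MemE0 (W 0 - W 0) := hW.memE0_sub h0 le_rfl le_rfl
      have := IsGlobalSolution.abs_normE_sub_sub_le (hW.memE0_sub h0 hr hs.1) z0
        (hW.memE0_sub h0 hs.1 le_rfl) (hW.memE0_sub h0 hr le_rfl)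
      rwa [sub_self (W 0), normE_zero, add_zero] at this
    obtain ⟨R, hR⟩ := isCompact_Icc.exists_bound_of_continuousOn hc
    refine ⟨R + normE (W 0), fun s hs => ?_⟩
    refine (SizeLe.of_normE _ (hW.memE1 h0 hs.1)).mono ?_
    refine (normE_le_add (hW.memE1 h0 hs.1) (hW.memE1 h0 le_rfl)).trans ?_
    have := hR s hs
    rw [Real.norm_eq_abs] at this
    linarith [le_abs_self (normE (W s - W 0))]
  obtain ⟨R, hR⟩ := hb X hX
  obtain ⟨R', hR'⟩ := hb Z hZ
  obtain ⟨C, hC, H⟩ := exists_lipschitz_vecField (max R' R)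
  have := hZ.normE_sub_le_exp h0 hX h0 (T := t) (C := C) (fun s hs =>
    H _ _ (hZ.memE1 h0 hs.1) (hX.memE1 h0 hs.1) ((hR' s hs).mono (le_max_left _ _))
      ((hR s hs).mono (le_max_right _ _))) ⟨ht, le_rfl⟩
  rw [sub_self, normE_zero, zero_mul] at this
  exact (hZ.memE1 h0 ht).lagEq_of_normE_sub_eq_zero (hX.memE1 h0 ht)
    (le_antisymm this (normE_nonneg _))

/-! ## The Lagrangian flow -/

section Flow

variable {X : Lag} (hX : X ∈ setF)
include hX

theorem flowS_spec : IsGlobalSolution (fun t => flowS t X) X := by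
  obtain ⟨Z, hZ, -⟩ := exists_globalSolution hX
  have h : ∃ Z : ℝ → Lag, IsGlobalSolution Z X := ⟨Z, hZ⟩
  have e : (fun t => flowS t X) = h.choose := by
    funext t; exact dif_pos h
  rw [e]
  exact h.choose_spec

theorem flowS_unique {Z : ℝ → Lag} (hZ : IsGlobalSolution Z X) {t : ℝ} (ht : 0 ≤ t) :
    LagEq (Z t) (flowS t X) := (flowS_spec hX).unique (memE1_of_memF hX) hZ ht

theorem flowS_mem_energy {t : ℝ} (ht : 0 ≤ t) :
    flowS t X ∈ setF ∧ energy (flowS t X) = energy X := by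
  obtain ⟨Z, hZ, hF⟩ := exists_globalSolution hX
  have h := flowS_unique hX hZ ht
  exact ⟨h.memF (hF t ht).1, by rw [← h.energy_eq, (hF t ht).2]⟩

theorem flowS_mem {t : ℝ} (ht : 0 ≤ t) : flowS t X ∈ setF := (flowS_mem_energy hX ht).1

theorem flowS_zero : LagEq (flowS 0 X) X := (flowS_spec hX).1

theorem flowS_congr {Y : Lag} (h : LagEq X Y) {t : ℝ} (ht : 0 ≤ t) :
    LagEq (flowS t X) (flowS t Y) :=
  flowS_unique (h.memF hX) (h.isGlobalSolution (flowS_spec hX)) ht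

theorem flowS_add {s t : ℝ} (hs : 0 ≤ s) (ht : 0 ≤ t) :
    LagEq (flowS (s + t) X) (flowS s (flowS t X)) := by
  have h := flowS_spec hX
  refine flowS_unique (flowS_mem hX ht) (Z := fun s => flowS (s + t) X) ?_ hs
  have hsh : ∀ {s : ℝ}, 0 ≤ s → Tendsto (fun r => r + t) (𝓝[Ici 0] s) (𝓝[Ici 0] (s + t)) := by
    intro s hs
    refine tendsto_nhdsWithin_iff.2 ⟨((continuous_add_const t).tendsto s).mono_left
      nhdsWithin_le_nhds, ?_⟩
    filter_upwards [self_mem_nhdsWithin] with r hr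
    exact add_nonneg hr ht
  refine ⟨by simp only [zero_add]; exact LagEq.refl _, fun r hr => h.2.1 _ (add_nonneg hr ht),
    fun r hr => ?_, fun r hr => (h.2.2.2 _ (add_nonneg hr ht)).comp (hsh hr)⟩
  have h1 := h.2.2.1 (r + t) (add_nonneg hr ht)
  have h2 : Tendsto (fun q => q + t) (𝓝[Ici 0 \ {r}] r) (𝓝[Ici 0 \ {r + t}] (r + t)) := by
    refine tendsto_nhdsWithin_iff.2 ⟨((continuous_add_const t).tendsto r).mono_left
      nhdsWithin_le_nhds, ?_⟩
    filter_upwards [self_mem_nhdsWithin] with q hq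
    exact ⟨add_nonneg hq.1 ht, fun h => hq.2 (add_right_cancel h)⟩
  refine (h1.comp h2).congr fun q => ?_
  simp only [Function.comp, add_sub_add_right_eq_sub]

theorem flowS_tendsto {t : ℝ} (ht : 0 ≤ t) :
    Tendsto (fun s => normE (flowS s X - flowS t X)) (𝓝[Ici 0] t) (𝓝 0) :=
  (flowS_spec hX).tendsto_normE_sub (memE1_of_memF hX) ht

end Flow

theorem exists_flowS_lipschitz (M T : ℝ) : ∃ C : ℝ, 0 ≤ C ∧ ∀ X ∈ setF, ∀ Y ∈ setF,
    energy X ≤ M → energy Y ≤ M → ∀ t ∈ Icc 0 T,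
      normE (flowS t X - flowS t Y) ≤ C * normE (X - Y) := by
  obtain ⟨C, hC, H⟩ := exists_lipschitz_vecField (2 * (1 + M))
  refine ⟨Real.exp (C * T), (Real.exp_pos _).le, fun X hX Y hY hXM hYM t ht => ?_⟩
  have h := (flowS_spec hX).normE_sub_le_exp (memE1_of_memF hX) (flowS_spec hY)
    (memE1_of_memF hY) (T := T) (C := C) (fun s hs =>
      H _ _ (memE1_of_memF (flowS_mem hX hs.1)) (memE1_of_memF (flowS_mem hY hs.1))
        (sizeLe_of_memF (flowS_mem hX hs.1) ((flowS_mem_energy hX hs.1).2.trans_le hXM))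
        (sizeLe_of_memF (flowS_mem hY hs.1) ((flowS_mem_energy hY hs.1).2.trans_le hYM))) ht
  refine h.trans ?_
  rw [mul_comm]
  exact mul_le_mul_of_nonneg_right (Real.exp_le_exp.2 (mul_le_mul_of_nonneg_left ht.2 hC))
    (normE_nonneg _)


/-! ## The relabeling group -/

/-- `f` and `g` are mutually inverse relabeling functions. -/
structure IsRelabeling (f g : ℝ → ℝ) : Prop where
  lip : ∃ K, LipschitzWith K f
  lip' : ∃ K, LipschitzWith K g
  mono : Monotone f
  mono' : Monotone g
  right_inv : ∀ x, f (g x) = x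
  left_inv : ∀ x, g (f x) = x
  add_one : ∀ ξ, f (ξ + 1) = f ξ + 1

theorem lipschitzWith_sub_id {f : ℝ → ℝ} (h : ∃ K, LipschitzWith K f) :
    ∃ K, LipschitzWith K fun ξ => f ξ - ξ :=
  h.elim fun K hK => ⟨K + 1, hK.sub LipschitzWith.id⟩

theorem lipschitzWith_of_sub_id {f : ℝ → ℝ} (h : ∃ K, LipschitzWith K fun ξ => f ξ - ξ) :
    ∃ K, LipschitzWith K f := by
  obtain ⟨K, hK⟩ := h
  refine ⟨K + 1, ?_⟩
  have := hK.add LipschitzWith.id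
  simpa using this

theorem monotone_of_injective_of_add_one {f : ℝ → ℝ} (hc : Continuous f)
    (hi : Function.Injective f) (h1 : ∀ ξ, f (ξ + 1) = f ξ + 1) : Monotone f := by
  rcases hc.strictMono_of_inj hi with h | h
  · exact h.monotone
  · have := h (zero_lt_one' ℝ)
    have h0 := h1 0
    rw [zero_add] at h0
    linarith

namespace IsRelabeling

variable {f g f₁ g₁ : ℝ → ℝ}

theorem symm (h : IsRelabeling f g) : IsRelabeling g f where
  lip := h.lip'
  lip' := h.lip
  mono := h.mono'
  mono' := h.mono
  right_inv := h.left_inv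
  left_inv := h.right_inv
  add_one ξ := by
    conv_lhs => rw [← h.right_inv ξ, ← h.add_one, h.left_inv]

theorem refl : IsRelabeling (fun x => x) fun x => x where
  lip := ⟨1, LipschitzWith.id⟩
  lip' := ⟨1, LipschitzWith.id⟩
  mono := monotone_id
  mono' := monotone_id
  right_inv _ := rfl
  left_inv _ := rfl
  add_one _ := rfl

theorem trans (h : IsRelabeling f g) (h₁ : IsRelabeling f₁ g₁) :
    IsRelabeling (f ∘ f₁) (g₁ ∘ g) where
  lip := h.lip.elim fun _ a => h₁.lip.elim fun _ b => ⟨_, a.comp b⟩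
  lip' := h.lip'.elim fun _ a => h₁.lip'.elim fun _ b => ⟨_, b.comp a⟩
  mono := h.mono.comp h₁.mono
  mono' := h₁.mono'.comp h.mono'
  right_inv x := by simp only [Function.comp, h₁.right_inv, h.right_inv]
  left_inv x := by simp only [Function.comp, h₁.left_inv, h.left_inv]
  add_one ξ := by simp only [Function.comp, h₁.add_one, h.add_one]

theorem translation (a : ℝ) : IsRelabeling (fun x => x - a) fun x => x + a where
  lip := ⟨1, LipschitzWith.of_dist_le_mul fun x y => by simp [Real.dist_eq]⟩
  lip' := ⟨1, LipschitzWith.of_dist_le_mul fun x y => by simp [Real.dist_eq]⟩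
  mono x y h := by simpa using h
  mono' x y h := by simpa using h
  right_inv x := by simp
  left_inv x := by simp
  add_one x := by ring

theorem strictMono (h : IsRelabeling f g) : StrictMono f :=
  h.mono.strictMono_of_injective (Function.LeftInverse.injective h.left_inv)

theorem bijective (h : IsRelabeling f g) : Function.Bijective f :=
  ⟨Function.LeftInverse.injective h.left_inv, Function.RightInverse.surjective h.right_inv⟩

theorem invFun_eq (h : IsRelabeling f g) : Function.invFun f = g :=
  funext fun x => h.bijective.1 (by
    rw [Function.rightInverse_invFun h.bijective.2 x, h.right_inv])

theorem mem_setG (h : IsRelabeling f g) : f ∈ setG := by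
  refine ⟨h.bijective, h.lip.elim fun _ a => a.locallyLipschitz, h.add_one,
    ⟨lipschitzWith_sub_id h.lip, fun ξ => ?_⟩, ?_⟩
  · simp only [h.add_one]; ring
  · rw [h.invFun_eq]
    refine ⟨lipschitzWith_sub_id h.lip', fun ξ => ?_⟩
    simp only [h.symm.add_one]; ring

theorem of_mem_setG (h : f ∈ setG) : IsRelabeling f (Function.invFun f) := by
  obtain ⟨hb, hl, h1, h2, h3⟩ := h
  have r := Function.rightInverse_invFun hb.2
  have l := Function.leftInverse_invFun hb.1
  have k1 := lipschitzWith_of_sub_id h2.1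
  have k2 := lipschitzWith_of_sub_id h3.1
  refine ⟨k1, k2, monotone_of_injective_of_add_one (k1.elim fun _ a => a.continuous) hb.1 h1,
    monotone_of_injective_of_add_one (k2.elim fun _ a => a.continuous) r.injective fun ξ => ?_,
    r, l, h1⟩
  have := h3.2 ξ
  simp only at this
  linarith

/-- A Lipschitz function of degree one whose increments are bounded below is a relabeling. -/
theorem of_lower_bound {c : ℝ} (hf : ∃ K, LipschitzWith K f) (hc : 0 < c)
    (hl : ∀ a b, a ≤ b → c * (b - a) ≤ f b - f a) (h1 : ∀ ξ, f (ξ + 1) = f ξ + 1) :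
    IsRelabeling f (Function.invFun f) := by
  have hcont : Continuous f := hf.elim fun _ a => a.continuous
  have hs : StrictMono f := fun a b hab => by
    have := hl a b hab.le
    nlinarith
  have htop : Tendsto f atTop atTop := by
    refine tendsto_atTop_mono' _ ?_ (tendsto_atTop_add_const_right _ (f 0)
      (tendsto_id.const_mul_atTop hc))
    filter_upwards [eventually_ge_atTop 0] with x hx
    have := hl 0 x hx
    simp only [id]; linarith
  have hbot : Tendsto f atBot atBot := by
    refine tendsto_atBot_mono' _ ?_ (tendsto_atBot_add_const_right _ (f 0)
      (tendsto_id.const_mul_atBot hc))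
    filter_upwards [eventually_le_atBot 0] with x hx
    have := hl x 0 hx
    simp only [id]; linarith
  have hsurj : Function.Surjective f := hcont.surjective htop hbot
  have r := Function.rightInverse_invFun hsurj
  have l := Function.leftInverse_invFun hs.injective
  have hm : Monotone (Function.invFun f) := fun x y hxy => by
    rw [← hs.le_iff_le, r x, r y]; exact hxy
  have key : ∀ x y, x ≤ y → Function.invFun f y - Function.invFun f x ≤ c⁻¹ * (y - x) := by
    intro x y hxy
    have := hl _ _ (hm hxy)
    rw [r x, r y] at this
    rw [inv_mul_eq_div, le_div_iff₀ hc]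
    linarith
  refine ⟨hf, ⟨c⁻¹.toNNReal, LipschitzWith.of_dist_le_mul fun x y => ?_⟩, hs.monotone, hm, r, l, h1⟩
  rw [Real.coe_toNNReal _ (inv_pos.2 hc).le, Real.dist_eq, Real.dist_eq]
  rcases le_total x y with h | h
  · rw [abs_sub_comm, abs_sub_comm x, abs_of_nonneg (sub_nonneg.2 (hm h)),
      abs_of_nonneg (sub_nonneg.2 h)]
    exact key x y h
  · rw [abs_of_nonneg (sub_nonneg.2 (hm h)), abs_of_nonneg (sub_nonneg.2 h)]
    exact key y x h

theorem continuous (h : IsRelabeling f g) : Continuous f := h.lip.elim fun _ a => a.continuous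

theorem ae_comp (h : IsRelabeling f g) {p : ℝ → Prop} (hp : ∀ᵐ x, p x) : ∀ᵐ x, p (f x) := by
  obtain ⟨K, hK⟩ := h.lip'
  rw [ae_iff] at hp ⊢
  refine measure_mono_null ?_ (volume_image_eq_zero_of_lipschitz hK hp)
  intro x hx
  exact ⟨f x, hx, h.left_inv x⟩

theorem deriv_nonneg (h : IsRelabeling f g) (x : ℝ) : 0 ≤ deriv f x := h.mono.deriv_nonneg

theorem deriv_comp (h : IsRelabeling f g) {φ : ℝ → ℝ} (hφ : W11loc φ) :
    W11loc (fun x => φ (f x)) ∧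
      deriv (fun x => φ (f x)) =ᵐ[volume] fun x => deriv φ (f x) * deriv f x := by
  obtain ⟨K, hK⟩ := h.lip
  exact W11loc.comp_right hK h.mono hφ

theorem deriv_mul_deriv (h : IsRelabeling f g) : ∀ᵐ x, deriv g (f x) * deriv f x = 1 := by
  obtain ⟨K, hK⟩ := h.lip'
  have e : (fun x => g (f x)) = fun x => x := funext h.left_inv
  filter_upwards [(h.deriv_comp (W11loc.of_lipschitz hK)).2] with x hx
  rw [← hx, e]; exact deriv_id x

theorem memL1per_comp (h : IsRelabeling f g) {φ : ℝ → ℝ} (hφ : MemL1per φ) :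
    MemL1per fun x => φ (f x) * deriv f x := by
  obtain ⟨K, hK⟩ := h.lip
  refine ⟨locallyIntegrable_comp_mul_deriv hK h.mono hφ.1, ?_⟩
  filter_upwards [h.ae_comp hφ.2] with x hx
  rw [h.add_one, hx, deriv_add_one h.add_one]

theorem normL1_comp (h : IsRelabeling f g) {φ : ℝ → ℝ} (hφ : MemL1per φ) :
    normL1 (fun x => φ (f x) * deriv f x) = normL1 φ := by
  obtain ⟨K, hK⟩ := h.lip
  have e : ∀ x, |φ (f x) * deriv f x| = (fun z => |φ z|) (f x) * deriv f x := fun x => by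
    rw [abs_mul, abs_of_nonneg (h.deriv_nonneg x)]
  unfold normL1
  simp only [e]
  rw [intervalIntegral_comp_mul_deriv hK h.mono (fun z => |φ z|) 0 1]
  have := h.add_one 0
  rw [zero_add] at this
  rw [this]
  exact (hφ.normL1_eq _).symm

theorem memW11per_comp (h : IsRelabeling f g) {φ : ℝ → ℝ} (hφ : MemW11per φ) :
    MemW11per fun x => φ (f x) :=
  ⟨(h.deriv_comp hφ.1).1, fun x => by simp only [h.add_one, hφ.2 (f x)]⟩

theorem supN_comp_le (_h : IsRelabeling f g) {φ : ℝ → ℝ} (hφ : MemW11per φ) :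
    supN (fun x => φ (f x)) ≤ supN φ :=
  supN_le fun ξ _ => abs_le_supN_of_periodic hφ.1.continuous hφ.2 (f ξ)

theorem normV_comp (h : IsRelabeling f g) {φ : ℝ → ℝ} (hφ : MemW11per φ) :
    normV (fun x => φ (f x)) = normV φ := by
  rw [normV_eq, normV_eq, normL1_congr (h.deriv_comp hφ.1).2, h.normL1_comp hφ.memL1per_deriv]
  congr 1
  refine le_antisymm (h.supN_comp_le hφ) ?_
  have := h.symm.supN_comp_le (h.memW11per_comp hφ)
  simpa only [h.right_inv] using this

variable {X Y Z : Lag}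

theorem memE1_relabel (h : IsRelabeling f g) (hX : MemE1 X) : MemE1 (relabel X f) :=
  ⟨⟨(h.deriv_comp hX.y.1).1, fun ξ => by
    change X.y (f (ξ + 1)) = X.y (f ξ) + 1
    rw [h.add_one, hX.y.2]⟩, h.memW11per_comp hX.U, h.memL1per_comp hX.ν⟩

theorem normE_relabel (h : IsRelabeling f g) (hZ : MemE0 Z) :
    normE (relabel Z f) = normE Z := by
  unfold normE
  congr 1
  · congr 1
    · exact h.normV_comp hZ.y
    · exact h.normV_comp hZ.U
  · exact h.normL1_comp hZ.ν

theorem lagEq_relabel (h : IsRelabeling f g) (hXY : LagEq X Y) :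
    LagEq (relabel X f) (relabel Y f) := by
  refine ⟨congrArg (· ∘ f) hXY.1, congrArg (· ∘ f) hXY.2.1, ?_⟩
  filter_upwards [h.ae_comp hXY.2.2] with x hx
  change X.ν (f x) * _ = Y.ν (f x) * _
  rw [hx]

theorem energy_relabel (h : IsRelabeling f g) (hX : MemE1 X) :
    energy (relabel X f) = energy X := h.normL1_comp hX.ν

theorem relabel_comp (h : IsRelabeling f g) (h₁ : IsRelabeling f₁ g₁) (X : Lag) :
    LagEq (relabel (relabel X f) f₁) (relabel X (f ∘ f₁)) := by
  refine ⟨rfl, rfl, ?_⟩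
  obtain ⟨K, hK⟩ := h.lip
  filter_upwards [(h₁.deriv_comp (W11loc.of_lipschitz hK)).2] with x hx
  change X.ν (f (f₁ x)) * deriv f (f₁ x) * deriv f₁ x = X.ν (f (f₁ x)) * deriv (f ∘ f₁) x
  rw [mul_assoc, ← hx]; rfl

theorem relabel_inv (h : IsRelabeling f g) (X : Lag) : LagEq (relabel (relabel X f) g) X := by
  refine (h.relabel_comp h.symm X).trans ?_
  have e : f ∘ g = fun x => x := funext h.right_inv
  rw [e]
  refine ⟨rfl, rfl, Eventually.of_forall fun x => ?_⟩
  change X.ν x * deriv (fun x => x) x = X.ν x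
  rw [deriv_id'', mul_one]

theorem deriv_y_relabel (h : IsRelabeling f g) (hX : MemE1 X) :
    deriv (relabel X f).y =ᵐ[volume] fun x => deriv X.y (f x) * deriv f x :=
  (h.deriv_comp hX.y.1).2

theorem deriv_U_relabel (h : IsRelabeling f g) (hX : MemE1 X) :
    deriv (relabel X f).U =ᵐ[volume] fun x => deriv X.U (f x) * deriv f x :=
  (h.deriv_comp hX.U.1).2

theorem deriv_lower_bound (h : IsRelabeling f g) : ∃ c : ℝ, 0 < c ∧ ∀ᵐ x, c ≤ deriv f x := by
  obtain ⟨K, hK⟩ := h.lip'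
  refine ⟨((K : ℝ) + 1)⁻¹, by positivity, ?_⟩
  filter_upwards [h.deriv_mul_deriv] with x hx
  have h1 := (le_abs_self _).trans (abs_deriv_le_of_lipschitz hK (f x))
  rw [inv_le_iff_one_le_mul₀ (by positivity), ← hx]
  nlinarith [h.deriv_nonneg x]

theorem relabel_mem_setF (h : IsRelabeling f g) (hX : X ∈ setF) : relabel X f ∈ setF := by
  have hE := memE1_of_memF hX
  have hR := h.memE1_relabel hE
  obtain ⟨-, -, hy, hU, ⟨C, hC⟩, h1, h2, ⟨c, hc, h3⟩, h4⟩ := hX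
  obtain ⟨K, hK⟩ := h.lip
  obtain ⟨c', hc', h5⟩ := h.deriv_lower_bound
  have dy := h.deriv_y_relabel hE
  have dU := h.deriv_U_relabel hE
  refine ⟨hR.memE, hR.y, hy.comp hK.locallyLipschitz, hU.comp hK.locallyLipschitz,
    ⟨C * K, ?_⟩, ?_, ?_, ⟨c * c', by positivity, ?_⟩, ?_⟩
  · filter_upwards [h.ae_comp hC] with x hx
    change |X.ν (f x) * deriv f x| ≤ _
    rw [abs_mul]
    exact mul_le_mul hx (abs_deriv_le_of_lipschitz hK x) (abs_nonneg _) ((abs_nonneg _).trans hx)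
  · filter_upwards [dy, h.ae_comp h1] with x e hx
    rw [e]; exact mul_nonneg hx (h.deriv_nonneg x)
  · filter_upwards [h.ae_comp h2] with x hx
    exact mul_nonneg hx (h.deriv_nonneg x)
  · filter_upwards [dy, h.ae_comp h3, h5] with x e hx hx'
    rw [e]
    change _ ≤ deriv X.y (f x) * deriv f x + X.ν (f x) * deriv f x
    rw [← add_mul]
    exact mul_le_mul hx hx' hc'.le (hc.le.trans hx)
  · filter_upwards [dy, dU, h.ae_comp h4] with x e e' hx
    rw [e, e']
    change deriv X.y (f x) * deriv f x * (X.ν (f x) * deriv f x) =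
      (deriv X.y (f x) * deriv f x) ^ 2 * (X.U (f x)) ^ 2 + (deriv X.U (f x) * deriv f x) ^ 2
    linear_combination (deriv f x) ^ 2 * hx

theorem integral_comp (h : IsRelabeling f g) (φ : ℝ → ℝ) :
    ∫ x, φ (f x) * deriv f x = ∫ x, φ x := by
  obtain ⟨K, hK⟩ := h.lip
  have := integral_image_eq_of_monotone_lipschitz hK h.mono MeasurableSet.univ φ
  rw [image_univ, h.bijective.2.range_eq, Measure.restrict_univ] at this
  rw [this]
  exact integral_congr_ae (Eventually.of_forall fun x => mul_comm _ _)

theorem sign_sub (h : IsRelabeling f g) (x y : ℝ) : Real.sign (f x - f y) = Real.sign (x - y) := by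
  rcases lt_trichotomy x y with hxy | rfl | hxy
  · rw [Real.sign_of_neg (sub_neg.2 hxy), Real.sign_of_neg (sub_neg.2 (h.strictMono hxy))]
  · simp
  · rw [Real.sign_of_pos (sub_pos.2 hxy), Real.sign_of_pos (sub_pos.2 (h.strictMono hxy))]

theorem Qop_relabel (h : IsRelabeling f g) (hX : MemE1 X) (ξ : ℝ) :
    Qop (relabel X f) ξ = Qop X (f ξ) := by
  unfold Qop
  congr 1
  refine Eq.trans ?_ (h.integral_comp _)
  refine integral_congr_ae ?_
  filter_upwards [h.deriv_y_relabel hX] with η e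
  rw [e, h.sign_sub]
  change _ * Real.exp (_ * (X.y (f ξ) - X.y (f η))) * ((X.U (f η)) ^ 2 * _ +
    X.ν (f η) * deriv f η) = _
  ring

theorem Pop_relabel (h : IsRelabeling f g) (hX : MemE1 X) (ξ : ℝ) :
    Pop (relabel X f) ξ = Pop X (f ξ) := by
  unfold Pop
  congr 1
  refine Eq.trans ?_ (h.integral_comp _)
  refine integral_congr_ae ?_
  filter_upwards [h.deriv_y_relabel hX] with η e
  rw [e, h.sign_sub]
  change Real.exp (_ * (X.y (f ξ) - X.y (f η))) * ((X.U (f η)) ^ 2 * _ +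
    X.ν (f η) * deriv f η) = _
  ring

theorem vecField_relabel (h : IsRelabeling f g) (hX : MemE1 X) :
    LagEq (vecField (relabel X f)) (relabel (vecField X) f) := by
  refine ⟨rfl, funext fun ξ => ?_, ?_⟩
  · change -Qop (relabel X f) ξ = -Qop X (f ξ)
    rw [h.Qop_relabel hX]
  · filter_upwards [h.deriv_y_relabel hX, h.deriv_U_relabel hX] with ξ e e'
    change -2 * Qop (relabel X f) ξ * X.U (f ξ) * deriv (relabel X f).y ξ +
      (3 * X.U (f ξ) ^ 2 - 2 * Pop (relabel X f) ξ) * deriv (relabel X f).U ξ =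
      (-2 * Qop X (f ξ) * X.U (f ξ) * deriv X.y (f ξ) +
      (3 * X.U (f ξ) ^ 2 - 2 * Pop X (f ξ)) * deriv X.U (f ξ)) * deriv f ξ
    rw [e, e', h.Qop_relabel hX, h.Pop_relabel hX]
    ring

theorem relabel_sub (X Y : Lag) (f : ℝ → ℝ) :
    relabel (X - Y) f = relabel X f - relabel Y f := by
  refine Prod.ext rfl (Prod.ext rfl (funext fun x => ?_))
  change (X.ν (f x) - Y.ν (f x)) * deriv f x = X.ν (f x) * deriv f x - Y.ν (f x) * deriv f x
  ring

theorem relabel_smul (c : ℝ) (X : Lag) (f : ℝ → ℝ) :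
    relabel (c • X) f = c • relabel X f := by
  refine Prod.ext rfl (Prod.ext rfl (funext fun x => ?_))
  change c * X.ν (f x) * deriv f x = c * (X.ν (f x) * deriv f x)
  ring

theorem normE_relabel_sub (h : IsRelabeling f g) (hX : MemE1 X) (hY : MemE1 Y) :
    normE (relabel X f - relabel Y f) = normE (X - Y) := by
  rw [← relabel_sub, h.normE_relabel (hX.sub hY)]

/-- The flow commutes with relabeling. -/
theorem flowS_relabel (h : IsRelabeling f g) (hX : X ∈ setF) {t : ℝ} (ht : 0 ≤ t) :
    LagEq (relabel (flowS t X) f) (flowS t (relabel X f)) := by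
  have hS := flowS_spec hX
  have hE : ∀ s, 0 ≤ s → MemE1 (flowS s X) := fun s hs => memE1_of_memF (flowS_mem hX hs)
  refine flowS_unique (h.relabel_mem_setF hX) (Z := fun t => relabel (flowS t X) f)
    ⟨h.lagEq_relabel (flowS_zero hX), fun s hs =>
      ⟨(h.memE1_relabel (hE s hs)).memE, (h.memE1_relabel (hE s hs)).memE0_vecField.memE⟩,
      fun s hs => ?_, fun s hs => ?_⟩ ht
  · refine (hS.2.2.1 s hs).congr' ?_
    filter_upwards [self_mem_nhdsWithin] with r hr
    have hm := (((hE r hr.1).sub (hE s hs)).smul (r - s)⁻¹).sub (hE s hs).memE0_vecField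
    rw [← h.normE_relabel hm, relabel_sub, relabel_smul, relabel_sub]
    exact ((LagEq.refl _).sub (h.vecField_relabel (hE s hs)).symm).normE_eq
  · refine (hS.2.2.2 s hs).congr' ?_
    filter_upwards [self_mem_nhdsWithin] with r hr
    have hm := (hE r hr).memE0_vecField.sub (hE s hs).memE0_vecField
    rw [← h.normE_relabel hm, relabel_sub]
    exact (((h.vecField_relabel (hE r hr)).symm).sub (h.vecField_relabel (hE s hs)).symm).normE_eq

end IsRelabeling

/-! ## The projection onto normalized representatives -/

section Projection

variable {X : Lag}

theorem isRelabeling_normalization (hX : X ∈ setF) :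
    let F := fun ξ => (1 / (1 + energy X)) * (X.y ξ + ∫ η in (0 : ℝ)..ξ, X.ν η)
    IsRelabeling F (Function.invFun F) ∧
      deriv F =ᵐ[volume] fun ξ => (1 / (1 + energy X)) * (deriv X.y ξ + X.ν ξ) := by
  intro F
  have hE := memE1_of_memF hX
  have hint := integral_ν_of_memF hX
  obtain ⟨-, -, hy, hU, ⟨C, hC⟩, h1, h2, ⟨c, hc, h3⟩, h4⟩ := hX
  have hh : 0 < 1 + energy X := by linarith [energy_nonneg X]
  have hg : LocallyIntegrable (fun ξ => (1 / (1 + energy X)) * (deriv X.y ξ + X.ν ξ)) volume :=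
    ((hE.memL1per_dy.add hE.ν).const_mul _).1
  have hi := hE.memL1per_dy.intervalIntegrable
  have hi' := hE.ν.intervalIntegrable
  have hF : ∀ ξ, F ξ = F 0 + ∫ η in (0 : ℝ)..ξ, (1 / (1 + energy X)) * (deriv X.y η + X.ν η) := by
    intro ξ
    rw [intervalIntegral.integral_const_mul, intervalIntegral.integral_add (hi _ _) (hi' _ _),
      hE.y.1.integral_deriv]
    simp only [F, intervalIntegral.integral_same]
    ring
  obtain ⟨hW, hd⟩ := W11loc.of_integral hg hF
  obtain ⟨Ky, hKy⟩ := exists_lipschitzWith_of_periodic hy hE.y.2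
  refine ⟨IsRelabeling.of_lower_bound (c := c / (1 + energy X))
    ⟨_, hW.lipschitz_of_abs_deriv_le (K := (1 / (1 + energy X)) * (Ky + C)) ?_⟩ (by positivity)
    (fun a b hab => ?_) fun ξ => ?_, hd⟩
  · filter_upwards [hd, hC] with x e hx
    rw [e, abs_mul, abs_of_pos (by positivity : 0 < 1 / (1 + energy X))]
    refine mul_le_mul_of_nonneg_left ((abs_add_le _ _).trans ?_) (by positivity)
    exact add_le_add (abs_deriv_le_of_lipschitz hKy x) hx
  · rw [← hW.integral_deriv a b]
    have : ∫ _ in a..b, c / (1 + energy X) = c / (1 + energy X) * (b - a) := by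
      rw [intervalIntegral.integral_const, smul_eq_mul, mul_comm]
    rw [← this]
    refine intervalIntegral.integral_mono_ae hab (by simp) (hW.intervalIntegrable_deriv a b) ?_
    filter_upwards [hd, h3] with x e hx
    rw [e, div_eq_mul_one_div, mul_comm]
    exact mul_le_mul_of_nonneg_left hx (by positivity)
  · have := intervalIntegral.integral_add_adjacent_intervals (hi' 0 ξ) (hi' ξ (ξ + 1))
    simp only [F]
    rw [← this, hint, hE.y.2]
    field_simp
    ring

theorem proj1_mem (hX : X ∈ setF) : proj1 X ∈ setF0 ∧ energy (proj1 X) = energy X ∧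
    ∃ f g, IsRelabeling f g ∧ proj1 X = relabel X f := by
  obtain ⟨hR, hd⟩ := isRelabeling_normalization hX
  have hE := memE1_of_memF hX
  have hh : 0 < 1 + energy X := by linarith [energy_nonneg X]
  have he : energy (proj1 X) = energy X := hR.symm.energy_relabel hE
  refine ⟨⟨hR.symm.relabel_mem_setF hX, ?_⟩, he, _, _, hR.symm, rfl⟩
  filter_upwards [hR.symm.deriv_y_relabel hE, hR.symm.ae_comp hd, hR.symm.deriv_mul_deriv]
    with x e e1 e2
  rw [he]
  change deriv (relabel X _).y x + X.ν _ * _ = _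
  rw [e, ← add_mul]
  rwa [e1, mul_assoc, one_div_mul_eq_div, div_eq_one_iff_eq hh.ne'] at e2

theorem proj2_mem (hX : X ∈ setF0) : proj2 X ∈ setH ∧ energy (proj2 X) = energy X ∧
    ∃ f g, IsRelabeling f g ∧ proj2 X = relabel X f := by
  obtain ⟨hX, h0⟩ := hX
  have hE := memE1_of_memF hX
  set a := ∫ η in (0 : ℝ)..1, X.y η with ha
  have hR := IsRelabeling.translation a
  have he : energy (proj2 X) = energy X := hR.energy_relabel hE
  refine ⟨⟨⟨hR.relabel_mem_setF hX, ?_⟩, ?_⟩, he, _, _, hR, rfl⟩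
  · have hd : ∀ x, deriv (fun ξ : ℝ => ξ - a) x = 1 := fun x => by simp
    filter_upwards [hR.deriv_y_relabel hE, hR.ae_comp h0] with x e e1
    rw [he]
    change deriv (relabel X _).y x + X.ν (x - a) * deriv (fun ξ : ℝ => ξ - a) x = _
    rw [e, hd, mul_one, mul_one, e1]
  · change ∫ ξ in (0 : ℝ)..1, X.y (ξ - a) = 0
    have hp : MemL1per fun ξ => X.y ξ - ξ :=
      ⟨(hE.y.1.sub W11loc.id).continuous.locallyIntegrable, Eventually.of_forall fun ξ => by
        simp only [hE.y.2 ξ]; ring⟩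
    have hc := hE.y.1.continuous
    rw [intervalIntegral.integral_comp_sub_right (fun x => X.y x) a]
    have e1 : ∀ p q : ℝ, ∫ x in p..q, X.y x = (∫ x in p..q, (X.y x - x)) + ∫ x in p..q, x := by
      intro p q
      rw [← intervalIntegral.integral_add (hp.intervalIntegrable p q) (by simp)]
      simp
    have e2 := hp.integral_add_one (0 - a)
    have e3 := e1 (0 - a) (1 - a)
    have e4 := e1 0 1
    rw [show 0 - a + 1 = 1 - a by ring] at e2
    rw [e2, integral_id] at e3
    rw [integral_id, ← ha] at e4
    rw [e3]; linarith

theorem proj_mem (hX : X ∈ setF) : proj X ∈ setH ∧ energy (proj X) = energy X ∧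
    ∃ f g, IsRelabeling f g ∧ LagEq (proj X) (relabel X f) := by
  obtain ⟨h1, h2, f, g, h3, h4⟩ := proj1_mem hX
  obtain ⟨k1, k2, f', g', k3, k4⟩ := proj2_mem h1
  refine ⟨k1, k2.trans h2, _, _, h3.trans k3, ?_⟩
  have e : proj X = relabel (relabel X f) f' := by
    rw [← h4]; exact k4
  rw [e]
  exact h3.relabel_comp k3 X

end Projection

/-! ## The distance -/

section Distance

variable {X Y Z : Lag} {f g : ℝ → ℝ}

theorem J_set_bddBelow (X Y : Lag) :
    BddBelow {r | ∃ f ∈ setG, ∃ g ∈ setG, r = normE (relabel X f - relabel Y g)} :=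
  ⟨0, by rintro _ ⟨f, -, g, -, rfl⟩; exact normE_nonneg _⟩

theorem J_set_nonempty (X Y : Lag) :
    {r | ∃ f ∈ setG, ∃ g ∈ setG, r = normE (relabel X f - relabel Y g)}.Nonempty :=
  ⟨_, _, IsRelabeling.refl.mem_setG, _, IsRelabeling.refl.mem_setG, rfl⟩

theorem J_nonneg (X Y : Lag) : 0 ≤ J X Y :=
  le_csInf (J_set_nonempty X Y) (by rintro _ ⟨f, -, g, -, rfl⟩; exact normE_nonneg _)

theorem J_comm (X Y : Lag) : J X Y = J Y X := by
  unfold J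
  congr 1
  ext r
  constructor
  · rintro ⟨f, hf, g, hg, rfl⟩; exact ⟨g, hg, f, hf, normE_sub_comm _ _⟩
  · rintro ⟨f, hf, g, hg, rfl⟩; exact ⟨g, hg, f, hf, normE_sub_comm _ _⟩

theorem relabel_id (X : Lag) : LagEq (relabel X fun x => x) X := by
  refine ⟨rfl, rfl, Eventually.of_forall fun x => ?_⟩
  change X.ν x * deriv (fun x => x) x = X.ν x
  rw [deriv_id'', mul_one]

theorem J_le_of_relabel (h : IsRelabeling f g) (X Y : Lag) : J X Y ≤ normE (relabel X f - Y) := by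
  refine csInf_le (J_set_bddBelow X Y) ⟨f, h.mem_setG, _, IsRelabeling.refl.mem_setG, ?_⟩
  exact ((LagEq.refl _).sub (relabel_id Y).symm).normE_eq

theorem J_le_normE (X Y : Lag) : J X Y ≤ normE (X - Y) := by
  refine (J_le_of_relabel IsRelabeling.refl X Y).trans_eq ?_
  exact ((relabel_id X).sub (LagEq.refl Y)).normE_eq

theorem exists_relabel_lt (hX : MemE1 X) (hY : MemE1 Y) {r : ℝ} (h : J X Y < r) :
    ∃ f g, IsRelabeling f g ∧ normE (relabel X f - Y) < r := by
  obtain ⟨_, ⟨f, hf, g, hg, rfl⟩, hlt⟩ := exists_lt_of_csInf_lt (J_set_nonempty X Y) h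
  have hf := IsRelabeling.of_mem_setG hf
  have hg := IsRelabeling.of_mem_setG hg
  refine ⟨_, _, hf.trans hg.symm, lt_of_eq_of_lt ?_ hlt⟩
  rw [← hg.symm.normE_relabel_sub (hf.memE1_relabel hX) (hg.memE1_relabel hY)]
  exact ((hf.relabel_comp hg.symm X).symm.sub (hg.relabel_inv Y).symm).normE_eq

theorem J_triangle (hX : MemE1 X) (hY : MemE1 Y) (hZ : MemE1 Z) : J X Z ≤ J X Y + J Y Z := by
  refine le_of_forall_pos_lt_add fun ε hε => ?_
  obtain ⟨f, f', hf, h1⟩ := exists_relabel_lt hX hY (show J X Y < J X Y + ε / 2 by linarith)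
  obtain ⟨g, g', hg, h2⟩ := exists_relabel_lt hY hZ (show J Y Z < J Y Z + ε / 2 by linarith)
  have hXf := hf.memE1_relabel hX
  have hYg := hg.memE1_relabel hY
  have hXfg := hg.memE1_relabel hXf
  have h3 := J_le_of_relabel (hf.trans hg) X Z
  rw [((hf.relabel_comp hg X).symm.sub (LagEq.refl Z)).normE_eq] at h3
  have h4 := normE_sub_le (hXfg.sub hYg) (hYg.sub hZ)
  rw [hg.normE_relabel_sub hXf hY] at h4
  linarith

theorem J_self (X : Lag) : J X X = 0 :=
  le_antisymm ((J_le_normE X X).trans_eq (by rw [sub_self, normE_zero])) (J_nonneg _ _)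

theorem J_eq_zero_of_relabel (h : IsRelabeling f g) (hY : LagEq Y (relabel X f)) : J X Y = 0 := by
  refine le_antisymm ((J_le_of_relabel h X Y).trans_eq ?_) (J_nonneg _ _)
  rw [((LagEq.refl _).sub hY).normE_eq, sub_self, normE_zero]

theorem J_congr {X' Y' : Lag} (hX : MemE1 X) (hY : MemE1 Y) (hX' : MemE1 X') (hY' : MemE1 Y')
    (h : J X X' = 0) (h' : J Y Y' = 0) : J X Y = J X' Y' := by
  have a1 := J_triangle hX hX' hY
  have a2 := J_triangle hX' hY' hY
  have b1 := J_triangle hX' hX hY'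
  have b2 := J_triangle hX hY hY'
  rw [J_comm Y' Y] at a2
  rw [J_comm X' X] at b1
  linarith

theorem chainDist_eq {S : Set Lag} (hS : S ⊆ setF) (hX : X ∈ S) (hY : Y ∈ S) :
    chainDist S X Y = J X Y := by
  have hE : ∀ {Z}, Z ∈ S → MemE1 Z := fun h => memE1_of_memF (hS h)
  refine le_antisymm (csInf_le ⟨0, ?_⟩ ⟨1, fun n => if n = 0 then X else Y, ?_, ?_, ?_, ?_⟩)
    (le_csInf ⟨_, 1, fun n => if n = 0 then X else Y, ?_, ?_, ?_, rfl⟩ ?_)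
  · rintro _ ⟨N, Z, -, -, -, rfl⟩
    exact Finset.sum_nonneg fun _ _ => J_nonneg _ _
  · intro n _
    by_cases h : n = 0 <;> simp [h, hX, hY]
  · simp
  · simp
  · simp
  · intro n _
    by_cases h : n = 0 <;> simp [h, hX, hY]
  · simp
  · simp
  · rintro _ ⟨N, Z, hZ, rfl, rfl, rfl⟩
    clear hX hY
    induction N with
    | zero => simp [J_self]
    | succ N ih =>
      rw [Finset.sum_range_succ]
      have := ih fun n hn => hZ n (hn.trans (Nat.le_succ N))
      have h2 := J_triangle (hE (hZ 0 (Nat.zero_le _))) (hE (hZ N (Nat.le_succ N)))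
        (hE (hZ (N + 1) le_rfl))
      linarith

theorem abs_energy_sub_le_J (hX : MemE1 X) (hY : MemE1 Y) : |energy X - energy Y| ≤ J X Y := by
  refine le_of_forall_pos_lt_add fun ε hε => ?_
  obtain ⟨f, f', hf, h1⟩ := exists_relabel_lt hX hY (show J X Y < J X Y + ε by linarith)
  refine lt_of_le_of_lt ?_ h1
  rw [← hf.energy_relabel hX]
  have hf' := hf.memE1_relabel hX
  set W := relabel X f
  have k1 := normL1_add_le (hf'.ν.sub hY.ν).1 hY.ν.1
  have k2 := normL1_add_le (hY.ν.sub hf'.ν).1 hf'.ν.1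
  simp only [sub_add_cancel] at k1 k2
  have k3 : normL1 (fun x => W.ν x - Y.ν x) ≤ normE (W - Y) := normL1_ν_sub_le
  have k4 : normL1 (fun x => Y.ν x - W.ν x) ≤ normE (Y - W) := normL1_ν_sub_le
  rw [normE_sub_comm] at k4
  unfold energy
  rw [abs_le]
  constructor <;> linarith

theorem exists_J_flowS_le (M T : ℝ) : ∃ C : ℝ, 0 ≤ C ∧ ∀ X ∈ setF, ∀ Y ∈ setF,
    energy X ≤ M → energy Y ≤ M → ∀ t ∈ Icc 0 T,
      J (flowS t X) (flowS t Y) ≤ C * J X Y := by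
  obtain ⟨C, hC, H⟩ := exists_flowS_lipschitz M T
  refine ⟨C, hC, fun X hX Y hY hXM hYM t ht => ?_⟩
  refine le_of_forall_pos_le_add fun ε hε => ?_
  have hE := memE1_of_memF hX
  obtain ⟨f, f', hf, h1⟩ := exists_relabel_lt hE (memE1_of_memF hY)
    (show J X Y < J X Y + ε / (C + 1) by have : 0 < ε / (C + 1) := by positivity
                                         linarith)
  have h2 := J_le_of_relabel hf (flowS t X) (flowS t Y)
  rw [((hf.flowS_relabel hX ht.1).sub (LagEq.refl _)).normE_eq] at h2
  have h3 := H _ (hf.relabel_mem_setF hX) Y hY ((hf.energy_relabel hE).trans_le hXM) hYM t ht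
  have h4 := mul_le_mul_of_nonneg_left h1.le hC
  have h5 : C * (ε / (C + 1)) ≤ ε := by
    rw [mul_div_assoc', div_le_iff₀ (by positivity)]; nlinarith
  linarith

end Distance


/-! ## Monotone Lipschitz maps and measures -/

theorem eq_of_deriv_ne_zero {g : ℝ → ℝ} (hm : Monotone g) {ξ ζ : ℝ} (hd : deriv g ξ ≠ 0)
    (h : g ζ = g ξ) : ζ = ξ := by
  have hD := (differentiableAt_of_deriv_ne_zero hd).hasDerivAt
  by_contra hne
  obtain ⟨a, b, hab, hξ, hc⟩ : ∃ a b : ℝ, a < b ∧ ξ ∈ Icc a b ∧ ∀ x ∈ Icc a b, g x = g ξ := by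
    rcases lt_or_gt_of_ne hne with hlt | hlt
    · exact ⟨ζ, ξ, hlt, ⟨hlt.le, le_rfl⟩, fun x hx =>
        le_antisymm (hm hx.2) (h.symm.trans_le (hm hx.1))⟩
    · exact ⟨ξ, ζ, hlt, ⟨le_rfl, hlt.le⟩, fun x hx =>
        le_antisymm ((hm hx.2).trans_eq h) (hm hx.1)⟩
  have h1 : HasDerivWithinAt g 0 (Icc a b) ξ :=
    (hasDerivWithinAt_const ξ (Icc a b) (g ξ)).congr hc rfl
  exact hd ((uniqueDiffOn_Icc hab ξ hξ).eq_deriv _ hD.hasDerivWithinAt h1)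

theorem surjective_of_add_one {g : ℝ → ℝ} (hc : Continuous g) (h1 : ∀ ξ, g (ξ + 1) = g ξ + 1) :
    Function.Surjective g := by
  intro x
  have hp : Function.Periodic (fun ξ => g ξ - ξ) 1 := fun ξ => by simp only [h1]; ring
  have hb : ∀ ξ, |g ξ - ξ| ≤ supN fun ξ => g ξ - ξ :=
    abs_le_supN_of_periodic (hc.sub continuous_id) hp
  set S := supN fun ξ => g ξ - ξ
  have h0 : 0 ≤ S := supN_nonneg _
  have b1 := abs_le.1 (hb (x - S))
  have b2 := abs_le.1 (hb (x + S))
  obtain ⟨z, -, hz⟩ := intermediate_value_Icc (by linarith : x - S ≤ x + S) hc.continuousOn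
    (show x ∈ Icc (g (x - S)) (g (x + S)) from ⟨by linarith [b1.2], by linarith [b2.1]⟩)
  exact ⟨z, hz⟩

theorem exists_le_iff {g : ℝ → ℝ} (hc : Continuous g) (hm : Monotone g)
    (hs : Function.Surjective g) (x : ℝ) : ∃ a, g a = x ∧ ∀ ξ, x ≤ g ξ ↔ a ≤ ξ := by
  obtain ⟨z, hz⟩ := hs x
  obtain ⟨z₀, hz₀⟩ := hs (x - 1)
  have hne : {ξ | x ≤ g ξ}.Nonempty := ⟨z, hz.ge⟩
  have hbd : BddBelow {ξ | x ≤ g ξ} := ⟨z₀, fun ξ hξ => by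
    by_contra hlt
    have h1 := hm (not_le.1 hlt).le
    have h2 : x ≤ g ξ := hξ
    linarith⟩
  have hmem : x ≤ g (sInf {ξ | x ≤ g ξ}) :=
    (isClosed_le continuous_const hc).csInf_mem hne hbd
  exact ⟨_, le_antisymm ((hm (csInf_le hbd hz.ge)).trans_eq hz) hmem,
    fun ξ => ⟨fun h => csInf_le hbd h, fun h => hmem.trans (hm h)⟩⟩

section MonotoneLipschitz

variable {g : ℝ → ℝ} {K : NNReal} (hg : LipschitzWith K g) (hm : Monotone g)
include hg hm

theorem ae_comp_of_deriv_ne_zero {p : ℝ → Prop} (hp : ∀ᵐ x, p x) :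
    ∀ᵐ ξ, deriv g ξ ≠ 0 → p (g ξ) := by
  obtain ⟨N, hN, hNm, hN0⟩ := exists_measurable_superset_of_null (ae_iff.1 hp)
  have hs : MeasurableSet (g ⁻¹' N) := hg.continuous.measurable hNm
  have h := lintegral_image_eq_of_monotone_lipschitz hg hm hs 1
  have h0 : ∫⁻ x in g '' (g ⁻¹' N), (1 : ℝ → ENNReal) x = 0 := by
    have : volume.restrict (g '' (g ⁻¹' N)) = 0 :=
      Measure.restrict_eq_zero.2 (measure_mono_null (image_preimage_subset g N) hN0)
    rw [this, lintegral_zero_measure]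
  rw [h0] at h
  have h1 := (setLIntegral_eq_zero_iff hs (((measurable_deriv g).ennreal_ofReal).mul
    (measurable_one.comp hg.continuous.measurable))).1 h.symm
  filter_upwards [h1] with ξ hξ hd
  by_contra hn
  have := hξ (hN hn)
  simp only [Function.comp, Pi.mul_apply, Pi.one_apply, mul_one, ENNReal.ofReal_eq_zero] at this
  exact hd (le_antisymm this (hm.deriv_nonneg))

omit hg hm in
theorem measurableSet_deriv_eq_zero : MeasurableSet {ξ | deriv g ξ = 0} :=
  measurableSet_eq_fun (measurable_deriv g) measurable_const

theorem map_restrict_mutuallySingular (ρ : Measure ℝ) :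
    (ρ.restrict {ξ | deriv g ξ = 0}).map g ⟂ₘ volume := by
  have hZ := measurableSet_deriv_eq_zero (g := g)
  have h0 : volume (g '' {ξ | deriv g ξ = 0}) = 0 := by
    have h := lintegral_image_eq_of_monotone_lipschitz hg hm hZ 1
    rw [setLIntegral_congr_fun (g := fun _ => 0) hZ (fun ξ hξ => by
      rw [show deriv g ξ = 0 from hξ]; simp)] at h
    simpa using h
  obtain ⟨N, hN, hNm, hN0⟩ := exists_measurable_superset_of_null h0
  refine Measure.MutuallySingular.mk (s := Nᶜ) (t := N) ?_ hN0 (by simp)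
  rw [Measure.map_apply hg.continuous.measurable hNm.compl, Measure.restrict_apply
    (hg.continuous.measurable hNm.compl)]
  convert measure_empty (μ := ρ)
  ext ξ
  simp only [mem_inter_iff, mem_preimage, mem_compl_iff, mem_empty_iff_false, iff_false, not_and]
  intro h1 h2
  exact h1 (hN ⟨ξ, h2, rfl⟩)

theorem map_restrict_absolutelyContinuous (n : ℝ → ENNReal) :
    ((volume.withDensity n).restrict {ξ | deriv g ξ = 0}ᶜ).map g ≪ volume := by
  have hZ := measurableSet_deriv_eq_zero (g := g)
  refine Measure.AbsolutelyContinuous.mk fun A hA hA0 => ?_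
  rw [Measure.map_apply hg.continuous.measurable hA, Measure.restrict_apply
    (hg.continuous.measurable hA)]
  refine withDensity_absolutelyContinuous volume n ?_
  have h : ∀ᵐ x, x ∉ A := measure_eq_zero_iff_ae_notMem.1 hA0
  refine measure_eq_zero_iff_ae_notMem.2 ?_
  filter_upwards [ae_comp_of_deriv_ne_zero hg hm h] with ξ hξ hmem
  exact hξ hmem.2 hmem.1

theorem setLIntegral_preimage (hs : Function.Surjective g) {A : Set ℝ} (hA : MeasurableSet A)
    (w : ℝ → ENNReal) :
    ∫⁻ ξ in g ⁻¹' A ∩ {ξ | deriv g ξ = 0}ᶜ, ENNReal.ofReal (deriv g ξ) * w (g ξ) =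
      ∫⁻ x in A, w x := by
  have hZ := measurableSet_deriv_eq_zero (g := g)
  have hm' := hg.continuous.measurable hA
  conv_rhs => rw [← image_preimage_eq A hs]
  rw [lintegral_image_eq_of_monotone_lipschitz hg hm hm',
    ← lintegral_inter_add_sdiff _ (g ⁻¹' A) hZ]
  rw [setLIntegral_congr_fun (f := fun x => ENNReal.ofReal (deriv g x) * w (g x))
    (g := fun _ => 0) (hm'.inter hZ) (fun ξ hξ => by
      simp only [show deriv g ξ = 0 from hξ.2, ENNReal.ofReal_zero, zero_mul]),
    lintegral_zero, zero_add]
  rfl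

theorem map_restrict_eq_withDensity (hs : Function.Surjective g) {n w : ℝ → ENNReal}
    (h : ∀ᵐ ξ, deriv g ξ ≠ 0 → n ξ = ENNReal.ofReal (deriv g ξ) * w (g ξ)) :
    ((volume.withDensity n).restrict {ξ | deriv g ξ = 0}ᶜ).map g = volume.withDensity w := by
  have hZ := measurableSet_deriv_eq_zero (g := g)
  ext A hA
  have hm' := hg.continuous.measurable hA
  rw [Measure.map_apply hg.continuous.measurable hA, Measure.restrict_apply hm',
    withDensity_apply _ (hm'.inter hZ.compl), withDensity_apply _ hA,
    ← setLIntegral_preimage hg hm hs hA]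
  refine setLIntegral_congr_fun_ae (hm'.inter hZ.compl) ?_
  filter_upwards [h] with ξ hξ hmem
  exact hξ hmem.2

end MonotoneLipschitz

/-! ## The map from Lagrangian to Eulerian variables -/

/-- The density `u² + u_x²` of the absolutely continuous part of the energy. -/
def energyDensity (u : ℝ → ℝ) (x : ℝ) : ENNReal := ENNReal.ofReal ((u x) ^ 2 + (deriv u x) ^ 2)

theorem measurable_energyDensity {u : ℝ → ℝ} (hu : Continuous u) :
    Measurable (energyDensity u) :=
  ((hu.measurable.pow_const 2).add ((measurable_deriv u).pow_const 2)).ennreal_ofReal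

theorem LagEq.mapM_eq {X Y : Lag} (h : LagEq X Y) : mapM X = mapM Y := by
  refine Prod.ext ?_ ?_
  · change (fun x => X.U (Function.invFun X.y x)) = fun x => Y.U (Function.invFun Y.y x)
    rw [h.1, h.2.1]
  · change Measure.map X.y _ = Measure.map Y.y _
    rw [h.1]
    congr 1
    refine withDensity_congr_ae ?_
    filter_upwards [h.2.2] with ξ hξ
    rw [hξ]

section EulerMap

variable {X : Lag} (hX : X ∈ setF)
include hX

theorem exists_lipschitz_y_of_memF : ∃ K, LipschitzWith K X.y :=
  exists_lipschitzWith_of_periodic hX.2.2.1 (memE1_of_memF hX).y.2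

theorem surjective_y_of_memF : Function.Surjective X.y :=
  surjective_of_add_one (memE1_of_memF hX).y.1.continuous (memE1_of_memF hX).y.2

theorem ae_dU_eq_zero : ∀ᵐ ξ, deriv X.y ξ = 0 → deriv X.U ξ = 0 := by
  filter_upwards [hX.2.2.2.2.2.2.2.2] with ξ h h0
  rw [h0] at h
  have : (deriv X.U ξ) ^ 2 = 0 := by linarith
  exact pow_eq_zero_iff two_ne_zero |>.1 this

theorem U_eq_of_y_eq {ξ ζ : ℝ} (h : X.y ξ = X.y ζ) : X.U ξ = X.U ζ := by
  wlog hle : ξ ≤ ζ generalizing ξ ζ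
  · exact (this h.symm (not_le.1 hle).le).symm
  have hE := memE1_of_memF hX
  have h1 := hE.y.1.integral_deriv ξ ζ
  rw [h, sub_self, intervalIntegral.integral_eq_zero_iff_of_le_of_nonneg_ae hle
    (ae_restrict_of_ae hX.2.2.2.2.2.1) (hE.y.1.intervalIntegrable_deriv ξ ζ)] at h1
  have h2 := hE.U.1.integral_deriv ξ ζ
  rw [intervalIntegral.integral_of_le hle, integral_eq_zero_of_ae] at h2
  · linarith
  · filter_upwards [h1, ae_restrict_of_ae (ae_dU_eq_zero hX)] with x a b
    exact b a

theorem mapM_fst_y (ξ : ℝ) : (mapM X).1 (X.y ξ) = X.U ξ :=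
  U_eq_of_y_eq hX (Function.invFun_eq ⟨ξ, rfl⟩)

theorem W11loc_mapM_fst : W11loc (mapM X).1 := by
  have hE := memE1_of_memF hX
  obtain ⟨K, hK⟩ := exists_lipschitz_y_of_memF hX
  have hm := monotone_y_of_memF hX
  have hs := surjective_y_of_memF hX
  let φ : ℝ → ℝ := fun x =>
    deriv X.U (Function.invFun X.y x) / deriv X.y (Function.invFun X.y x)
  have hφ : ∀ᵐ ξ, φ (X.y ξ) * deriv X.y ξ = deriv X.U ξ := by
    filter_upwards [ae_dU_eq_zero hX] with ξ h0
    by_cases hd : deriv X.y ξ = 0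
    · rw [hd, h0 hd, mul_zero]
    · have : Function.invFun X.y (X.y ξ) = ξ :=
        eq_of_deriv_ne_zero hm hd (Function.invFun_eq ⟨ξ, rfl⟩)
      simp only [φ, this]
      exact div_mul_cancel₀ _ hd
  have hloc : LocallyIntegrable φ volume := by
    refine locallyIntegrable_of_intervalIntegrable fun a b => ?_
    wlog hab : a ≤ b generalizing a b
    · exact (this b a (not_le.1 hab).le).symm
    obtain ⟨p, rfl⟩ := hs a
    obtain ⟨q, hq⟩ := hs (b + 1)
    have hpq : p ≤ q := le_of_lt (hm.reflect_lt (by linarith))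
    have hi : IntegrableOn φ (X.y '' Icc p q) := by
      rw [integrableOn_image_iff_of_monotone_lipschitz hK hm measurableSet_Icc]
      have := (intervalIntegrable_iff_integrableOn_Icc_of_le hpq).1
        (hE.U.1.intervalIntegrable_deriv p q)
      refine this.congr_fun_ae (ae_restrict_of_ae ?_)
      filter_upwards [hφ] with ξ e
      rw [mul_comm, e]
    rw [image_Icc_of_monotone_lipschitz hK hm hpq, hq] at hi
    rw [intervalIntegrable_iff_integrableOn_Icc_of_le hab]
    exact hi.mono_set (Icc_subset_Icc_right (by linarith))
  refine (W11loc.of_integral hloc fun x => ?_).1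
  obtain ⟨p, hp⟩ := hs 0
  obtain ⟨q, rfl⟩ := hs x
  rw [← hp, ← intervalIntegral_comp_mul_deriv hK hm, mapM_fst_y hX, mapM_fst_y hX,
    intervalIntegral.integral_congr_ae (hφ.mono fun ξ e _ => e), hE.U.1.integral_deriv]
  ring

theorem deriv_mapM_fst : ∀ᵐ ξ, deriv (mapM X).1 (X.y ξ) * deriv X.y ξ = deriv X.U ξ := by
  obtain ⟨K, hK⟩ := exists_lipschitz_y_of_memF hX
  have h := (W11loc.comp_right hK (monotone_y_of_memF hX) (W11loc_mapM_fst hX)).2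
  have e : (fun x => (mapM X).1 (X.y x)) = X.U := funext (mapM_fst_y hX)
  rw [e] at h
  exact h.mono fun ξ hξ => hξ.symm

theorem ae_ofReal_ν_eq : ∀ᵐ ξ, deriv X.y ξ ≠ 0 → ENNReal.ofReal (X.ν ξ) =
    ENNReal.ofReal (deriv X.y ξ) * energyDensity (mapM X).1 (X.y ξ) := by
  filter_upwards [deriv_mapM_fst hX, hX.2.2.2.2.2.1, hX.2.2.2.2.2.2.2.2] with ξ e h0 h hd
  rw [energyDensity, ← ENNReal.ofReal_mul h0, mapM_fst_y hX]
  congr 1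
  rw [← e] at h
  refine mul_left_cancel₀ hd ?_
  rw [h]; ring

theorem mapM_snd_eq : (mapM X).2 =
    ((volume.withDensity fun ξ => ENNReal.ofReal (X.ν ξ)).restrict {ξ | deriv X.y ξ = 0}).map X.y +
      volume.withDensity (energyDensity (mapM X).1) := by
  obtain ⟨K, hK⟩ := exists_lipschitz_y_of_memF hX
  rw [← map_restrict_eq_withDensity hK (monotone_y_of_memF hX) (surjective_y_of_memF hX)
    (ae_ofReal_ν_eq hX), ← Measure.map_add _ _ hK.continuous.measurable,
    Measure.restrict_add_restrict_compl measurableSet_deriv_eq_zero]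
  rfl

theorem memH1per_mapM_fst : MemH1per (mapM X).1 := by
  have hE := memE1_of_memF hX
  obtain ⟨K, hK⟩ := exists_lipschitz_y_of_memF hX
  have hm := monotone_y_of_memF hX
  have hs := surjective_y_of_memF hX
  refine ⟨W11loc_mapM_fst hX, fun x => ?_, ?_⟩
  · obtain ⟨ξ, rfl⟩ := hs x
    rw [← hE.y.2, mapM_fst_y hX, mapM_fst_y hX, hE.U.2]
  rw [memLp_two_iff_integrable_sq (measurable_deriv _).aestronglyMeasurable]
  refine ⟨((measurable_deriv _).pow_const 2).aestronglyMeasurable, ?_⟩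
  rw [hasFiniteIntegral_iff_ofReal (Eventually.of_forall fun _ => sq_nonneg _)]
  obtain ⟨p, hp⟩ := hs 0
  have hp1 : X.y (p + 1) = 1 := by rw [hE.y.2, hp, zero_add]
  have hi : IntegrableOn X.ν (Icc p (p + 1)) := hE.ν.1.integrableOn_isCompact isCompact_Icc
  calc ∫⁻ x in Ioc (0 : ℝ) 1, ENNReal.ofReal ((deriv (mapM X).1 x) ^ 2)
      ≤ ∫⁻ x in X.y '' Icc p (p + 1), ENNReal.ofReal ((deriv (mapM X).1 x) ^ 2) := by
        rw [image_Icc_of_monotone_lipschitz hK hm (by linarith), hp, hp1]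
        exact lintegral_mono_set Ioc_subset_Icc_self
    _ = ∫⁻ ξ in Icc p (p + 1), ENNReal.ofReal (deriv X.y ξ) *
          ENNReal.ofReal ((deriv (mapM X).1 (X.y ξ)) ^ 2) :=
        lintegral_image_eq_of_monotone_lipschitz hK hm measurableSet_Icc _
    _ ≤ ∫⁻ ξ in Icc p (p + 1), ENNReal.ofReal ‖X.ν ξ‖ := by
        refine lintegral_mono_ae (ae_restrict_of_ae ?_)
        filter_upwards [deriv_mapM_fst hX, hX.2.2.2.2.2.1, hX.2.2.2.2.2.2.1,
          hX.2.2.2.2.2.2.2.2] with ξ e h0 h1 h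
        rw [← ENNReal.ofReal_mul h0]
        refine ENNReal.ofReal_le_ofReal ?_
        rw [Real.norm_eq_abs, abs_of_nonneg h1]
        rcases h0.eq_or_lt with h0 | h0
        · rw [← h0, zero_mul]; exact h1
        · rw [← e] at h
          refine le_of_mul_le_mul_left ?_ h0
          rw [h]
          nlinarith [sq_nonneg (deriv X.y ξ * X.U ξ)]
    _ < ⊤ := by
        have := hi.norm.2
        rwa [hasFiniteIntegral_iff_ofReal (Eventually.of_forall fun _ => norm_nonneg _)] at this

theorem mapM_snd_Ico {x x' a a' : ℝ} (ha : ∀ ξ, x ≤ X.y ξ ↔ a ≤ ξ)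
    (ha' : ∀ ξ, x' ≤ X.y ξ ↔ a' ≤ ξ) (h : a ≤ a') :
    (mapM X).2 (Ico x x') = ENNReal.ofReal (∫ ξ in a..a', X.ν ξ) := by
  have hE := memE1_of_memF hX
  have hc := hE.y.1.continuous
  have e : X.y ⁻¹' Ico x x' = Ico a a' := by
    ext ξ
    simp only [mem_preimage, mem_Ico, ← not_le, ha, ha']
  change Measure.map X.y _ _ = _
  rw [Measure.map_apply hc.measurable measurableSet_Ico, e,
    withDensity_apply _ measurableSet_Ico, intervalIntegral.integral_of_le h,
    ← integral_Icc_eq_integral_Ioc, integral_Icc_eq_integral_Ico,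
    ofReal_integral_eq_lintegral_ofReal _ (ae_restrict_of_ae hX.2.2.2.2.2.2.1)]
  exact (hE.ν.1.integrableOn_isCompact isCompact_Icc).mono_set Ico_subset_Icc_self

theorem mapM_snd_real_Ico {x x' a a' : ℝ} (ha : ∀ ξ, x ≤ X.y ξ ↔ a ≤ ξ)
    (ha' : ∀ ξ, x' ≤ X.y ξ ↔ a' ≤ ξ) (h : a ≤ a') :
    (mapM X).2.real (Ico x x') = ∫ ξ in a..a', X.ν ξ := by
  rw [Measure.real, mapM_snd_Ico hX ha ha' h, ENNReal.toReal_ofReal]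
  exact intervalIntegral.integral_nonneg_of_ae h hX.2.2.2.2.2.2.1

theorem exists_le_iff_of_memF (x : ℝ) : ∃ a, X.y a = x ∧ ∀ ξ, x ≤ X.y ξ ↔ a ≤ ξ :=
  exists_le_iff (memE1_of_memF hX).y.1.continuous (monotone_y_of_memF hX)
    (surjective_y_of_memF hX) x

theorem isLocallyFiniteMeasure_mapM_snd : IsLocallyFiniteMeasure (mapM X).2 := by
  refine ⟨fun x => ⟨Ico (x - 1) (x + 1), Ico_mem_nhds (by linarith) (by linarith), ?_⟩⟩
  obtain ⟨a, h1, h2⟩ := exists_le_iff_of_memF hX (x - 1)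
  obtain ⟨b, h3, h4⟩ := exists_le_iff_of_memF hX (x + 1)
  rw [mapM_snd_Ico hX h2 h4 ((h2 b).1 (by rw [h3]; linarith))]
  exact ENNReal.ofReal_lt_top

theorem mapM_snd_real_period : (mapM X).2.real (Ico 0 1) = energy X := by
  obtain ⟨a, h1, h2⟩ := exists_le_iff_of_memF hX 0
  have hE := memE1_of_memF hX
  rw [mapM_snd_real_Ico hX h2 (a' := a + 1) (fun ξ => ?_) (by linarith), integral_ν_of_memF hX]
  have := hE.y.2 (ξ - 1)
  rw [sub_add_cancel] at this
  rw [this, ← sub_le_iff_le_add, sub_self, h2 (ξ - 1), le_sub_iff_add_le]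

theorem map_add_one_mapM_snd : (mapM X).2.map (fun x => x + 1) = (mapM X).2 := by
  have hE := memE1_of_memF hX
  have hc := hE.y.1.continuous
  have e : (fun x => x + 1) ∘ X.y = X.y ∘ fun ξ => ξ + 1 := funext fun ξ => (hE.y.2 ξ).symm
  change Measure.map _ (Measure.map X.y _) = Measure.map X.y _
  rw [Measure.map_map (measurable_add_const 1) hc.measurable, e,
    ← Measure.map_map hc.measurable (measurable_add_const 1)]
  congr 1
  ext A hA
  rw [Measure.map_apply (measurable_add_const 1) hA, withDensity_apply _ hA,
    withDensity_apply _ (measurable_add_const 1 hA)]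
  rw [← (measurePreserving_add_right volume (1 : ℝ)).setLIntegral_comp_preimage_emb
    (measurableEmbedding_addRight 1) (fun ξ => ENNReal.ofReal (X.ν ξ)) A]
  refine lintegral_congr_ae (ae_restrict_of_ae ?_)
  filter_upwards [hE.ν.2] with ξ h
  rw [h]

theorem mapM_mem_setD : mapM X ∈ setD := by
  obtain ⟨K, hK⟩ := exists_lipschitz_y_of_memF hX
  refine ⟨memH1per_mapM_fst hX, isLocallyFiniteMeasure_mapM_snd hX, map_add_one_mapM_snd hX, ?_⟩
  exact (Measure.eq_withDensity_rnDeriv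
    (measurable_energyDensity (W11loc_mapM_fst hX).continuous)
    (map_restrict_mutuallySingular hK (monotone_y_of_memF hX) _) (mapM_snd_eq hX)).symm

theorem IsRelabeling.mapM_relabel {f g : ℝ → ℝ} (h : IsRelabeling f g) :
    mapM (relabel X f) = mapM X := by
  have hX' := h.relabel_mem_setF hX
  have hE := memE1_of_memF hX
  obtain ⟨K, hK⟩ := h.lip
  refine Prod.ext (funext fun x => ?_) ?_
  · obtain ⟨ξ, rfl⟩ := surjective_y_of_memF hX' x
    rw [mapM_fst_y hX']
    exact (mapM_fst_y hX (f ξ)).symm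
  · change Measure.map (X.y ∘ f) _ = Measure.map X.y _
    rw [← Measure.map_map hE.y.1.continuous.measurable h.continuous.measurable]
    congr 1
    ext A hA
    rw [Measure.map_apply h.continuous.measurable hA, withDensity_apply _ hA,
      withDensity_apply _ (h.continuous.measurable hA)]
    conv_rhs => rw [← image_preimage_eq A h.bijective.2]
    rw [lintegral_image_eq_of_monotone_lipschitz hK h.mono (h.continuous.measurable hA)]
    refine lintegral_congr fun ξ => ?_
    rw [← ENNReal.ofReal_mul (h.deriv_nonneg ξ), mul_comm]
    rfl

end EulerMap


/-! ## Distribution functions of periodic measures -/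

section Distribution

variable (μ : Measure ℝ) [IsLocallyFiniteMeasure μ]

theorem real_Ico_add {a b c : ℝ} (h : a ≤ b) (h' : b ≤ c) :
    μ.real (Ico a b) + μ.real (Ico b c) = μ.real (Ico a c) := by
  rw [← measureReal_union (Ico_disjoint_Ico_same) measurableSet_Ico measure_Ico_lt_top.ne
    measure_Ico_lt_top.ne, Ico_union_Ico_eq_Ico h h']

theorem distrib_sub {a b : ℝ} (h : a ≤ b) : distrib μ b - distrib μ a = μ.real (Ico a b) := by
  unfold distrib
  rcases le_or_gt 0 a with ha | ha
  · rw [if_pos ha, if_pos (ha.trans h), ← real_Ico_add μ ha h]; ring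
  rw [if_neg ha.not_ge]
  rcases le_or_gt 0 b with hb | hb
  · rw [if_pos hb, ← real_Ico_add μ ha.le hb]; ring
  · rw [if_neg hb.not_ge, ← real_Ico_add μ h hb.le]; ring

theorem distrib_mono : Monotone (distrib μ) := fun a b h => by
  have := distrib_sub μ h
  have h0 : 0 ≤ μ.real (Ico a b) := measureReal_nonneg
  linarith

omit [IsLocallyFiniteMeasure μ] in
theorem distrib_zero : distrib μ 0 = 0 := by simp [distrib]

theorem exists_lt_distrib {x c : ℝ} (h : c < distrib μ x) : ∃ z < x, c < distrib μ z := by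
  let s : ℕ → Set ℝ := fun n => Ico (x - 1) (x - 1 / ((n : ℝ) + 1))
  have hs : Monotone s := fun m n hmn => Ico_subset_Ico_right
    (sub_le_sub_left (one_div_le_one_div_of_le (by positivity) (by gcongr)) _)
  have hU : ⋃ n, s n = Ico (x - 1) x := by
    ext z
    simp only [s, mem_iUnion, mem_Ico]
    constructor
    · rintro ⟨n, h1, h2⟩
      exact ⟨h1, h2.trans (sub_lt_self _ (by positivity))⟩
    · rintro ⟨h1, h2⟩
      obtain ⟨n, hn⟩ := exists_nat_one_div_lt (sub_pos.2 h2)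
      exact ⟨n, h1, by linarith⟩
  have ht := tendsto_measure_iUnion_atTop (μ := μ) hs
  rw [hU] at ht
  have ht' := (ENNReal.tendsto_toReal measure_Ico_lt_top.ne).comp ht
  have e := distrib_sub μ (sub_le_self x zero_le_one)
  have : c - distrib μ (x - 1) < (μ (Ico (x - 1) x)).toReal := by
    change _ < μ.real _
    linarith
  obtain ⟨n, hn⟩ := (ht'.eventually (Ioi_mem_nhds this)).exists
  refine ⟨x - 1 / ((n : ℝ) + 1), sub_lt_self _ (by positivity), ?_⟩
  have hle : x - 1 ≤ x - 1 / ((n : ℝ) + 1) :=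
    sub_le_sub_left ((div_le_one (by positivity)).2 (by linarith [n.cast_nonneg (α := ℝ)])) _
  have e' := distrib_sub μ hle
  have hn' : c - distrib μ (x - 1) < μ.real (Ico (x - 1) (x - 1 / ((n : ℝ) + 1))) := hn
  linarith

variable {μ} (hμ : μ.map (fun x => x + 1) = μ)
include hμ

omit [IsLocallyFiniteMeasure μ] in
theorem real_Ico_add_one (a b : ℝ) : μ.real (Ico (a + 1) (b + 1)) = μ.real (Ico a b) := by
  conv_lhs => rw [← hμ]
  rw [Measure.real, Measure.map_apply (measurable_add_const 1) measurableSet_Ico]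
  simp [Measure.real]

theorem distrib_add_one (x : ℝ) : distrib μ (x + 1) = distrib μ x + μ.real (Ico 0 1) := by
  have h1 := distrib_sub μ (zero_le_one (α := ℝ))
  have h0 := distrib_zero μ
  rcases le_total 0 x with h | h
  · have e1 := distrib_sub μ h
    have e2 := distrib_sub μ (show (0 : ℝ) + 1 ≤ x + 1 by linarith)
    rw [real_Ico_add_one hμ] at e2
    rw [zero_add] at e2
    linarith
  · have e1 := distrib_sub μ h
    have e2 := distrib_sub μ (show x + 1 ≤ (0 : ℝ) + 1 by linarith)
    rw [real_Ico_add_one hμ] at e2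
    rw [zero_add] at e2
    linarith

omit [IsLocallyFiniteMeasure μ] hμ in
theorem one_add_period_pos : 0 < 1 + μ.real (Ico 0 1) := by
  have : 0 ≤ μ.real (Ico 0 1) := measureReal_nonneg
  linarith

omit hμ in
theorem le_charOf_iff (x ξ : ℝ) :
    x ≤ charOf μ ξ ↔ distrib μ x + x ≤ (1 + μ.real (Ico 0 1)) * ξ := by
  set c := (1 + μ.real (Ico 0 1)) * ξ
  have hm : ∀ {z w}, z ≤ w → distrib μ z + z ≤ distrib μ w + w := fun h =>
    add_le_add (distrib_mono μ h) h
  have h0 := distrib_zero μ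
  have hne : {x : ℝ | distrib μ x + x < c}.Nonempty := by
    refine ⟨min 0 (c - 1), ?_⟩
    have h1 := distrib_mono μ (min_le_left 0 (c - 1))
    have h2 := min_le_right 0 (c - 1)
    simp only [mem_ofPred_eq]
    linarith
  have hbd : ∀ {z}, c ≤ distrib μ z + z → ∀ w ∈ {x : ℝ | distrib μ x + x < c}, w ≤ z := by
    intro z hz w hw
    by_contra hlt
    have h1 := hm (not_le.1 hlt).le
    have h2 : distrib μ w + w < c := hw
    linarith
  have hbdd : BddAbove {x : ℝ | distrib μ x + x < c} := by
    refine ⟨max 0 c, hbd ?_⟩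
    have h1 := distrib_mono μ (le_max_left 0 c)
    have h2 := le_max_right 0 c
    linarith
  constructor
  · intro h
    by_contra hlt
    obtain ⟨z, hz, hz'⟩ := exists_lt_distrib μ (show c - x < distrib μ x by linarith)
    set z' := max z (max (x - (distrib μ z + x - c)) (x - 1))
    have l1 : z ≤ z' := le_max_left _ _
    have l2 : x - (distrib μ z + x - c) ≤ z' := (le_max_left _ _).trans (le_max_right _ _)
    have l3 : z' < x := max_lt hz (max_lt (by linarith) (by linarith))
    have l4 := distrib_mono μ l1
    have : charOf μ ξ ≤ z' := csSup_le hne (hbd (by linarith))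
    linarith
  · intro h
    refine le_of_forall_lt fun z hz => ?_
    obtain ⟨w, hzw, hwx⟩ := exists_between hz
    refine hzw.trans_le (le_csSup hbdd ?_)
    have := distrib_mono μ hwx.le
    simp only [mem_ofPred_eq]
    linarith

omit hμ in
theorem charOf_mono : Monotone (charOf μ) := fun ξ ζ h => by
  rw [le_charOf_iff]
  exact ((le_charOf_iff _ _).1 le_rfl).trans
    (mul_le_mul_of_nonneg_left h one_add_period_pos.le)

omit hμ in
theorem charOf_lipschitz : LipschitzWith (1 + μ.real (Ico 0 1)).toNNReal (charOf μ) := by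
  have key : ∀ ξ ζ, ξ ≤ ζ → charOf μ ζ - charOf μ ξ ≤ (1 + μ.real (Ico 0 1)) * (ζ - ξ) := by
    intro ξ ζ h
    have h0 : 0 ≤ (1 + μ.real (Ico 0 1)) * (ζ - ξ) :=
      mul_nonneg one_add_period_pos.le (sub_nonneg.2 h)
    have h1 := (le_charOf_iff (μ := μ) (charOf μ ζ) ζ).1 le_rfl
    rw [sub_le_comm, le_charOf_iff]
    have h2 := distrib_mono μ (sub_le_self (charOf μ ζ) h0)
    linarith
  refine LipschitzWith.of_dist_le_mul fun ξ ζ => ?_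
  rw [Real.coe_toNNReal _ one_add_period_pos.le, Real.dist_eq, Real.dist_eq]
  rcases le_total ξ ζ with h | h
  · rw [abs_sub_comm, abs_sub_comm ξ, abs_of_nonneg (sub_nonneg.2 (charOf_mono h)),
      abs_of_nonneg (sub_nonneg.2 h)]
    exact key ξ ζ h
  · rw [abs_of_nonneg (sub_nonneg.2 (charOf_mono h)), abs_of_nonneg (sub_nonneg.2 h)]
    exact key ζ ξ h

theorem charOf_add_one (ξ : ℝ) : charOf μ (ξ + 1) = charOf μ ξ + 1 := by
  refine eq_of_forall_le_iff fun x => ?_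
  have := distrib_add_one hμ (x - 1)
  rw [sub_add_cancel] at this
  rw [← sub_le_iff_le_add, le_charOf_iff, le_charOf_iff, this, mul_add, mul_one]
  constructor <;> intro h <;> linarith

omit hμ in
theorem charOf_distrib (x : ℝ) :
    charOf μ ((distrib μ x + x) / (1 + μ.real (Ico 0 1))) = x := by
  refine eq_of_forall_le_iff fun z => ?_
  rw [le_charOf_iff, mul_div_cancel₀ _ one_add_period_pos.ne']
  constructor
  · intro h
    by_contra hlt
    have := distrib_mono μ (not_le.1 hlt).le
    linarith [not_le.1 hlt]
  · intro h
    exact add_le_add (distrib_mono μ h) h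

omit hμ in
theorem surjective_charOf : Function.Surjective (charOf μ) := fun x => ⟨_, charOf_distrib x⟩

omit hμ in
theorem deriv_charOf_le (ξ : ℝ) : deriv (charOf μ) ξ ≤ 1 + μ.real (Ico 0 1) := by
  have := (le_abs_self _).trans (abs_deriv_le_of_lipschitz (charOf_lipschitz (μ := μ)) ξ)
  rwa [Real.coe_toNNReal _ one_add_period_pos.le] at this

omit hμ in
/-- The energy is the push-forward of `1 + h - y_ξ` along the characteristic. -/
theorem map_charOf : (volume.withDensity fun ξ =>
    ENNReal.ofReal (1 + μ.real (Ico 0 1) - deriv (charOf μ) ξ)).map (charOf μ) = μ := by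
  have hc := (charOf_lipschitz (μ := μ)).continuous
  have hpos := one_add_period_pos (μ := μ)
  have hW := W11loc.of_lipschitz (charOf_lipschitz (μ := μ))
  set k := 1 + μ.real (Ico 0 1) with hk
  refine (Measure.ext_of_Ico μ _ fun a b hab => ?_).symm
  have e : charOf μ ⁻¹' Ico a b = Ico ((distrib μ a + a) / k) ((distrib μ b + b) / k) := by
    ext ξ
    simp only [mem_preimage, mem_Ico, ← not_le, le_charOf_iff, div_le_iff₀' hpos, ← hk]
  have hle : (distrib μ a + a) / k ≤ (distrib μ b + b) / k := by
    have := distrib_mono μ hab.le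
    gcongr
  have hi : ∀ p q, IntervalIntegrable (fun ξ => k - deriv (charOf μ) ξ) volume p q := fun p q =>
    intervalIntegrable_const.sub (hW.intervalIntegrable_deriv p q)
  rw [Measure.map_apply hc.measurable measurableSet_Ico, e,
    withDensity_apply _ measurableSet_Ico, ← ofReal_integral_eq_lintegral_ofReal
      (((intervalIntegrable_iff_integrableOn_Icc_of_le hle).1 (hi _ _)).mono_set
        Ico_subset_Icc_self)
      (Eventually.of_forall fun ξ => sub_nonneg.2 (deriv_charOf_le ξ)),
    ← integral_Icc_eq_integral_Ico, integral_Icc_eq_integral_Ioc,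
    ← intervalIntegral.integral_of_le hle,
    intervalIntegral.integral_sub intervalIntegrable_const (hW.intervalIntegrable_deriv _ _),
    hW.integral_deriv, intervalIntegral.integral_const, charOf_distrib, charOf_distrib,
    smul_eq_mul, sub_mul, div_mul_cancel₀ _ hpos.ne', div_mul_cancel₀ _ hpos.ne',
    show distrib μ b + b - (distrib μ a + a) - (b - a) = distrib μ b - distrib μ a by ring,
    distrib_sub μ hab.le, Measure.real, ENNReal.ofReal_toReal measure_Ico_lt_top.ne]

end Distribution

/-! ## The map from Eulerian to Lagrangian variables -/

/-- The Lagrangian triple `(y, u ∘ y, (1 + h) - y_ξ)` before normalization. -/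
def rawL (p : Eul) : Lag :=
  (charOf p.2, p.1 ∘ charOf p.2,
    fun ξ => (1 + p.2.real (Ico 0 1)) - deriv (charOf p.2) ξ)

section EulerToLagrange

variable {p : Eul} (hp : p ∈ setD)
include hp

theorem ae_rawL_ν_eq : ∀ᵐ ξ, deriv (charOf p.2) ξ ≠ 0 → (rawL p).ν ξ =
    deriv (charOf p.2) ξ * ((p.1 (charOf p.2 ξ)) ^ 2 + (deriv p.1 (charOf p.2 ξ)) ^ 2) := by
  obtain ⟨u, μ⟩ := p
  obtain ⟨hu, hfin, hper, hac⟩ := hp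
  simp only at hu hfin hper hac ⊢
  have := hfin
  have hL := charOf_lipschitz (μ := μ)
  have hm := charOf_mono (μ := μ)
  have hs := surjective_charOf (μ := μ)
  have hc := hL.continuous
  set y := charOf μ with hy
  set n : ℝ → ENNReal := fun ξ => ENNReal.ofReal (1 + μ.real (Ico 0 1) - deriv y ξ) with hn
  set ρ := volume.withDensity n
  set σ := (ρ.restrict {ξ | deriv y ξ = 0}ᶜ).map y with hσ
  have hw : Measurable (energyDensity u) := measurable_energyDensity hu.1.continuous
  have hdec : μ = (ρ.restrict {ξ | deriv y ξ = 0}).map y + σ := by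
    rw [hσ, ← Measure.map_add _ _ hc.measurable,
      Measure.restrict_add_restrict_compl measurableSet_deriv_eq_zero]
    exact map_charOf.symm
  have hle : σ ≤ μ := by
    conv_rhs => rw [hdec]
    exact Measure.le_add_left le_rfl
  have : IsLocallyFiniteMeasure σ := ⟨fun x => by
    obtain ⟨s, hs, h⟩ := μ.finiteAt_nhds x
    exact ⟨s, hs, (hle s).trans_lt h⟩⟩
  have hσw : σ = volume.withDensity (energyDensity u) := by
    have h1 := Measure.withDensity_rnDeriv_eq σ volume
      (map_restrict_absolutelyContinuous hL hm n)
    have h2 : volume.withDensity (σ.rnDeriv volume) = volume.withDensity (μ.rnDeriv volume) :=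
      Measure.eq_withDensity_rnDeriv (Measure.measurable_rnDeriv σ volume)
        (map_restrict_mutuallySingular hL hm ρ) (by rw [h1]; exact hdec)
    rw [← h1, h2, hac]
    rfl
  have hZ := (measurableSet_deriv_eq_zero (g := y)).compl
  have key : n =ᵐ[volume.restrict {ξ | deriv y ξ = 0}ᶜ]
      fun ξ => ENNReal.ofReal (deriv y ξ) * energyDensity u (y ξ) := by
    refine ae_eq_of_forall_setLIntegral_eq_of_sigmaFinite
      ((measurable_const.sub (measurable_deriv y)).ennreal_ofReal)
      ((measurable_deriv y).ennreal_ofReal.mul (hw.comp hc.measurable)) fun s hsm _ => ?_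
    rw [Measure.restrict_restrict hsm]
    have hinj : InjOn y (s ∩ {ξ | deriv y ξ = 0}ᶜ) := fun ξ hξ ζ hζ h =>
      eq_of_deriv_ne_zero hm hζ.2 h
    have hA := (hsm.inter hZ).image_of_continuousOn_injOn hc.continuousOn hinj
    have hpre : y ⁻¹' (y '' (s ∩ {ξ | deriv y ξ = 0}ᶜ)) ∩ {ξ | deriv y ξ = 0}ᶜ =
        s ∩ {ξ | deriv y ξ = 0}ᶜ := by
      ext ξ
      constructor
      · rintro ⟨⟨ζ, hζ, h⟩, h0⟩
        rwa [eq_of_deriv_ne_zero hm hζ.2 h.symm]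
      · intro h
        exact ⟨⟨ξ, h, rfl⟩, h.2⟩
    have e1 : σ (y '' (s ∩ {ξ | deriv y ξ = 0}ᶜ)) = ρ (s ∩ {ξ | deriv y ξ = 0}ᶜ) := by
      rw [hσ, Measure.map_apply hc.measurable hA, Measure.restrict_apply (hc.measurable hA), hpre]
    rw [hσw, withDensity_apply _ hA, withDensity_apply _ (hsm.inter hZ),
      ← setLIntegral_preimage hL hm hs hA, hpre] at e1
    exact e1.symm
  rw [Filter.EventuallyEq, ae_restrict_iff' hZ] at key
  filter_upwards [key] with ξ h hd
  have h := h hd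
  have h0 : 0 ≤ deriv y ξ := hm.deriv_nonneg
  rw [energyDensity, ← ENNReal.ofReal_mul h0, hn] at h
  exact (ENNReal.ofReal_eq_ofReal_iff (sub_nonneg.2 (deriv_charOf_le ξ)) (by positivity)).1 h

theorem rawL_mem_setF : rawL p ∈ setF := by
  have hν := ae_rawL_ν_eq hp
  obtain ⟨u, μ⟩ := p
  obtain ⟨hu, hfin, hper, hac⟩ := hp
  simp only at hu hfin hper hac hν
  have := hfin
  have hL := charOf_lipschitz (μ := μ)
  have hm := charOf_mono (μ := μ)
  have hW := W11loc.of_lipschitz hL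
  have h1 := charOf_add_one hper
  have hpos := one_add_period_pos (μ := μ)
  obtain ⟨hU, hdU⟩ := W11loc.comp_right hL hm hu.1
  set y := charOf μ with hy
  have hν0 : ∀ ξ, 0 ≤ (rawL (u, μ)).ν ξ := fun ξ => sub_nonneg.2 (deriv_charOf_le ξ)
  have hy0 : ∀ ξ, 0 ≤ deriv y ξ := fun ξ => hm.deriv_nonneg
  have hrel : ∀ᵐ ξ, deriv y ξ * (rawL (u, μ)).ν ξ =
      (deriv y ξ) ^ 2 * (u (y ξ)) ^ 2 + (deriv (fun x => u (y x)) ξ) ^ 2 := by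
    filter_upwards [hν, hdU] with ξ a b
    rw [b]
    by_cases hd : deriv y ξ = 0
    · rw [hd]; ring
    · rw [a hd]; ring
  have hUper : ∀ ξ, u (y (ξ + 1)) = u (y ξ) := fun ξ => by rw [h1, hu.2.1]
  refine ⟨⟨⟨hW, 1, h1⟩, ⟨hU, hUper⟩, ⟨?_, ?_⟩⟩, ⟨hW, h1⟩, hL.locallyLipschitz,
    hU.locallyLipschitz_of_bound (K := 1 + μ.real (Ico 0 1)) ?_, ⟨1 + μ.real (Ico 0 1), ?_⟩,
    Eventually.of_forall hy0, Eventually.of_forall hν0, ⟨1 + μ.real (Ico 0 1), hpos, ?_⟩, hrel⟩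
  · exact (locallyIntegrable_const _).sub hW.locallyIntegrable_deriv
  · refine Eventually.of_forall fun ξ => ?_
    change _ - deriv y (ξ + 1) = _ - deriv y ξ
    rw [deriv_add_one h1]
  · filter_upwards [hrel] with ξ h
    have a1 : deriv y ξ ≤ 1 + μ.real (Ico 0 1) := deriv_charOf_le ξ
    have a2 : (rawL (u, μ)).ν ξ ≤ 1 + μ.real (Ico 0 1) := sub_le_self _ (hy0 ξ)
    refine abs_le_of_sq_le_sq ?_ hpos.le
    have a3 := mul_le_mul a1 a2 (hν0 ξ) hpos.le
    nlinarith [sq_nonneg (deriv y ξ * u (y ξ))]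
  · refine Eventually.of_forall fun ξ => ?_
    rw [abs_of_nonneg (hν0 ξ)]
    exact sub_le_self _ (hy0 ξ)
  · refine Eventually.of_forall fun ξ => ?_
    change _ ≤ deriv y ξ + (1 + μ.real (Ico 0 1) - deriv y ξ)
    linarith

theorem mapM_rawL : mapM (rawL p) = p := by
  have hF := rawL_mem_setF hp
  obtain ⟨u, μ⟩ := p
  have : IsLocallyFiniteMeasure μ := hp.2.1
  refine Prod.ext (funext fun x => ?_) map_charOf
  obtain ⟨ξ, rfl⟩ := surjective_charOf (μ := μ) x
  exact mapM_fst_y hF ξ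

theorem mapL_spec : mapL p ∈ setH ∧ energy (mapL p) = p.2.real (Ico 0 1) ∧ mapM (mapL p) = p := by
  have hF := rawL_mem_setF hp
  obtain ⟨h1, h2, f, g, h3, h4⟩ := proj_mem hF
  have hM := mapM_rawL hp
  refine ⟨h1, ?_, ?_⟩
  · change energy (proj (rawL p)) = _
    rw [h2, ← mapM_snd_real_period hF, hM]
  · change mapM (proj (rawL p)) = _
    rw [h4.mapM_eq, h3.mapM_relabel hF, hM]

end EulerToLagrange

/-! ## Lagrangian variables are determined by the Eulerian ones up to relabeling -/

theorem exists_rawL_mapM_of_memF0 {X : Lag} (hX : X ∈ setF0) :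
    ∃ f g, IsRelabeling f g ∧ LagEq (rawL (mapM X)) (relabel X f) := by
  obtain ⟨hX, h0⟩ := hX
  have hE := memE1_of_memF hX
  have hh : 0 < 1 + energy X := by linarith [energy_nonneg X]
  have := isLocallyFiniteMeasure_mapM_snd hX
  have hper := mapM_snd_real_period hX
  obtain ⟨a, ha, ha'⟩ := exists_le_iff_of_memF hX 0
  have hint : ∀ p q, ∫ ξ in p..q, X.ν ξ = (1 + energy X) * (q - p) - (X.y q - X.y p) := by
    intro p q
    rw [← hE.y.1.integral_deriv, intervalIntegral.integral_congr_ae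
      (g := fun ξ => (1 + energy X) - deriv X.y ξ) (h0.mono fun ξ h _ => by linarith),
      intervalIntegral.integral_sub intervalIntegrable_const (hE.y.1.intervalIntegrable_deriv _ _),
      intervalIntegral.integral_const, smul_eq_mul, mul_comm]
  have hchar : ∀ ξ, charOf (mapM X).2 ξ = X.y (ξ - -a) := by
    intro ξ
    refine eq_of_forall_le_iff fun x => ?_
    obtain ⟨b, hb, hb'⟩ := exists_le_iff_of_memF hX x
    have hF : distrib (mapM X).2 x + x = (1 + energy X) * (b - a) := by
      rcases le_total 0 x with h | h
      · have e := distrib_sub (mapM X).2 h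
        have hab : a ≤ b := (ha' b).1 (hb.symm ▸ h)
        rw [mapM_snd_real_Ico hX ha' hb' hab, hint, distrib_zero, ha, hb] at e
        linarith
      · have e := distrib_sub (mapM X).2 h
        have hab : b ≤ a := (hb' a).1 (ha.symm ▸ h)
        rw [mapM_snd_real_Ico hX hb' ha' hab, hint, distrib_zero, ha, hb] at e
        linarith
    rw [le_charOf_iff, hF, hper, hb', mul_le_mul_iff_right₀ hh]
    constructor <;> intro h <;> linarith
  have hy : charOf (mapM X).2 = fun ξ => X.y (ξ - -a) := funext hchar
  refine ⟨_, _, IsRelabeling.translation (-a), hy, ?_, ?_⟩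
  · change (mapM X).1 ∘ charOf (mapM X).2 = fun ξ => X.U (ξ - -a)
    funext ξ
    rw [hy]
    exact mapM_fst_y hX _
  · have hd : ∀ x, deriv (fun ξ : ℝ => ξ - -a) x = 1 := fun x => by simp
    filter_upwards [(IsRelabeling.translation (-a)).ae_comp h0] with ξ h
    change 1 + (mapM X).2.real (Ico 0 1) - deriv (charOf (mapM X).2) ξ =
      X.ν (ξ - -a) * deriv (fun ξ : ℝ => ξ - -a) ξ
    rw [hper, hy, hd, mul_one, deriv_comp_sub_const]
    linarith

theorem exists_mapL_mapM {X : Lag} (hX : X ∈ setF) :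
    ∃ f g, IsRelabeling f g ∧ LagEq (mapL (mapM X)) (relabel X f) := by
  obtain ⟨h1, -, f₁, g₁, r1, e1⟩ := proj1_mem hX
  obtain ⟨f₂, g₂, r2, e2⟩ := exists_rawL_mapM_of_memF0 h1
  have hM : mapM (proj1 X) = mapM X := by rw [e1, r1.mapM_relabel hX]
  rw [hM, e1] at e2
  obtain ⟨-, -, f₃, g₃, r3, e3⟩ := proj_mem (rawL_mem_setF (mapM_mem_setD hX))
  refine ⟨_, _, (r1.trans r2).trans r3, ?_⟩
  refine e3.trans ((r3.lagEq_relabel (e2.trans (r1.relabel_comp r2 X))).trans ?_)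
  exact (r1.trans r2).relabel_comp r3 X


/-! ## The distance separates Eulerian points -/

theorem MemL1per.integral_abs_add_nat {φ : ℝ → ℝ} (hφ : MemL1per φ) (a : ℝ) (k : ℕ) :
    ∫ x in a..(a + k), |φ x| = k * normL1 φ := by
  induction k with
  | zero => simp
  | succ k ih =>
    have hi := hφ.abs.intervalIntegrable
    rw [← intervalIntegral.integral_add_adjacent_intervals (hi a (a + k)) (hi _ _), ih,
      Nat.cast_succ, ← add_assoc, ← hφ.normL1_eq]
    ring

theorem MemL1per.abs_integral_le {φ : ℝ → ℝ} (hφ : MemL1per φ) {a b : ℝ} (h : a ≤ b) {k : ℕ}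
    (hk : b ≤ a + k) : |∫ x in a..b, φ x| ≤ k * normL1 φ := by
  rw [← hφ.integral_abs_add_nat a k]
  refine (intervalIntegral.abs_integral_le_integral_abs h).trans ?_
  exact intervalIntegral.integral_mono_interval le_rfl h hk
    (Eventually.of_forall fun _ => abs_nonneg _) (hφ.abs.intervalIntegrable _ _)

section Separation

variable {X Y : Lag} (hX : X ∈ setF) (hY : Y ∈ setF) (h : J X Y = 0)
include hX hY h

theorem mapM_fst_eq_of_J_eq_zero : (mapM X).1 = (mapM Y).1 := by
  have hEX := memE1_of_memF hX
  have hEY := memE1_of_memF hY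
  have hu := (W11loc_mapM_fst hX).continuous
  funext x
  obtain ⟨ξ, rfl⟩ := surjective_y_of_memF hY x
  rw [mapM_fst_y hY]
  refine eq_of_forall_dist_le fun ε hε => ?_
  obtain ⟨δ, hδ, H⟩ := Metric.continuous_iff.1 hu (Y.y ξ) (ε / 2) (by positivity)
  obtain ⟨f, g, hf, hlt⟩ := exists_relabel_lt hEX hEY (h.trans_lt (lt_min hδ (half_pos hε)))
  have hF := hf.relabel_mem_setF hX
  have hE := memE1_of_memF hF
  have e1 := (abs_y_sub_le hE hEY ξ).trans_lt (hlt.trans_le (min_le_left _ _))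
  have e2 := (abs_U_sub_le hE hEY ξ).trans_lt (hlt.trans_le (min_le_right _ _))
  have e3 := H _ e1
  rw [← hf.mapM_relabel hX, mapM_fst_y hF] at e3
  have e4 := dist_triangle_left ((mapM (relabel X f)).1 (Y.y ξ)) (Y.U ξ) ((relabel X f).U ξ)
  rw [← hf.mapM_relabel hX]
  rw [← Real.dist_eq] at e2
  linarith

theorem real_Ico_le_of_J_eq_zero {c d c' d' : ℝ} (h1 : c' < c) (h2 : c ≤ d) (h3 : d < d') :
    (mapM X).2.real (Ico c d) ≤ (mapM Y).2.real (Ico c' d') := by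
  have hEX := memE1_of_memF hX
  have hEY := memE1_of_memF hY
  obtain ⟨a, ha, ha'⟩ := exists_le_iff_of_memF hY c'
  obtain ⟨b, hb, hb'⟩ := exists_le_iff_of_memF hY d'
  have hab : a ≤ b := (ha' b).1 (by rw [hb]; linarith)
  rw [mapM_snd_real_Ico hY ha' hb' hab]
  obtain ⟨k, hk⟩ := exists_nat_ge (b - a)
  refine le_of_forall_pos_le_add fun ε hε => ?_
  have hr : 0 < min (ε / (k + 1)) (min (c - c') (d' - d)) :=
    lt_min (by positivity) (lt_min (sub_pos.2 h1) (sub_pos.2 h3))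
  obtain ⟨f, g, hf, hlt⟩ := exists_relabel_lt hEX hEY (h.trans_lt hr)
  have hF := hf.relabel_mem_setF hX
  have hE := memE1_of_memF hF
  rw [← hf.mapM_relabel hX]
  set W := relabel X f
  have l1 := hlt.trans_le (min_le_left _ _)
  have l2 := hlt.trans_le ((min_le_right _ _).trans (min_le_left _ _))
  have l3 := hlt.trans_le ((min_le_right _ _).trans (min_le_right _ _))
  obtain ⟨p, hp, hp'⟩ := exists_le_iff_of_memF hF c
  obtain ⟨q, hq, hq'⟩ := exists_le_iff_of_memF hF d
  have hpq : p ≤ q := (hp' q).1 (by rw [hq]; exact h2)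
  rw [mapM_snd_real_Ico hF hp' hq' hpq]
  have hap : a ≤ p := by
    have := (abs_lt.1 ((abs_y_sub_le hE hEY p).trans_lt l2)).2
    rw [hp] at this
    exact (ha' p).1 (by linarith)
  have hqb : q ≤ b := by
    have := (abs_lt.1 ((abs_y_sub_le hE hEY b).trans_lt l3)).1
    rw [hb] at this
    exact (hq' b).1 (by linarith)
  have hi := hE.ν.intervalIntegrable
  have i1 : ∫ ξ in p..q, W.ν ξ ≤ ∫ ξ in a..b, W.ν ξ :=
    intervalIntegral.integral_mono_interval hap hpq hqb
      (ae_restrict_of_ae hF.2.2.2.2.2.2.1) (hi a b)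
  have i2 := (hE.ν.sub hEY.ν).abs_integral_le hab (show b ≤ a + k by linarith)
  rw [intervalIntegral.integral_sub (hi a b) (hEY.ν.intervalIntegrable a b)] at i2
  have i3 : normL1 (fun x => W.ν x - Y.ν x) ≤ ε / (k + 1) := normL1_ν_sub_le.trans l1.le
  have i4 : (k : ℝ) * normL1 (fun x => W.ν x - Y.ν x) ≤ ε := by
    refine (mul_le_mul_of_nonneg_left i3 k.cast_nonneg).trans ?_
    rw [mul_div_assoc', div_le_iff₀ (by positivity)]
    nlinarith
  linarith [le_abs_self ((∫ ξ in a..b, W.ν ξ) - ∫ ξ in a..b, Y.ν ξ)]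

theorem real_Ico_le_real_Ico_of_J_eq_zero {c d : ℝ} (hcd : c < d) :
    (mapM X).2.real (Ico c d) ≤ (mapM Y).2.real (Ico c d) := by
  have := isLocallyFiniteMeasure_mapM_snd hX
  have := isLocallyFiniteMeasure_mapM_snd hY
  refine le_of_forall_pos_le_add fun ε hε => ?_
  obtain ⟨c', hc', e1⟩ := exists_lt_distrib (mapM Y).2
    (show distrib (mapM Y).2 c - ε / 2 < distrib (mapM Y).2 c by linarith)
  obtain ⟨d', hd', e2⟩ := exists_lt_distrib (mapM X).2
    (show distrib (mapM X).2 d - ε / 2 < distrib (mapM X).2 d by linarith)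
  have e3 := distrib_mono (mapM X).2 (le_max_left d' c)
  have hm : max d' c < d := max_lt hd' hcd
  have key := real_Ico_le_of_J_eq_zero hX hY h hc' (le_max_right d' c) hm
  rw [← distrib_sub _ (le_max_right d' c), ← distrib_sub _ (hc'.le.trans hcd.le)] at key
  rw [← distrib_sub _ hcd.le, ← distrib_sub _ hcd.le]
  linarith

theorem mapM_eq_of_J_eq_zero : mapM X = mapM Y := by
  have i1 := isLocallyFiniteMeasure_mapM_snd hX
  have i2 := isLocallyFiniteMeasure_mapM_snd hY
  refine Prod.ext (mapM_fst_eq_of_J_eq_zero hX hY h) (Measure.ext_of_Ico _ _ fun a b hab => ?_)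
  rw [← ENNReal.toReal_eq_toReal_iff' measure_Ico_lt_top.ne measure_Ico_lt_top.ne]
  exact le_antisymm (real_Ico_le_real_Ico_of_J_eq_zero hX hY h hab)
    (real_Ico_le_real_Ico_of_J_eq_zero hY hX ((J_comm Y X).trans h) hab)

end Separation

/-! ## The semigroup in Eulerian variables -/

theorem mapL_mem_setF {p : Eul} (hp : p ∈ setD) : mapL p ∈ setF := (mapL_spec hp).1.1.1

theorem setHM_subset_setF (M : ℝ) : setHM M ⊆ setF := fun _ h => h.1.1.1

theorem mapL_mem_setHM {M : ℝ} {p : Eul} (hp : p ∈ setDM M) : mapL p ∈ setHM M :=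
  ⟨(mapL_spec hp.1).1, (mapL_spec hp.1).2.1.trans_le hp.2⟩

theorem dist_D_eq {p q : Eul} (hp : p ∈ setD) (hq : q ∈ setD) :
    dist_D p q = J (mapL p) (mapL q) :=
  chainDist_eq subset_rfl (mapL_mem_setF hp) (mapL_mem_setF hq)

theorem dist_DM_eq {M : ℝ} {p q : Eul} (hp : p ∈ setDM M) (hq : q ∈ setDM M) :
    dist_DM M p q = J (mapL p) (mapL q) :=
  chainDist_eq (setHM_subset_setF M) (mapL_mem_setHM hp) (mapL_mem_setHM hq)

theorem isMetricOn_of_eq_J {S : Set Eul} (hS : S ⊆ setD) {d : Eul → Eul → ℝ}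
    (hd : ∀ p ∈ S, ∀ q ∈ S, d p q = J (mapL p) (mapL q)) : IsMetricOn S d := by
  refine ⟨fun p hp q hq => ?_, fun p hp q hq => ?_, fun p hp q hq => ?_,
    fun p hp q hq r hr => ?_⟩
  · rw [hd p hp q hq]; exact J_nonneg _ _
  · rw [hd p hp q hq]
    refine ⟨fun h => ?_, fun h => by rw [h, J_self]⟩
    rw [← (mapL_spec (hS hp)).2.2, ← (mapL_spec (hS hq)).2.2]
    exact mapM_eq_of_J_eq_zero (mapL_mem_setF (hS hp)) (mapL_mem_setF (hS hq)) h
  · rw [hd p hp q hq, hd q hq p hp, J_comm]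
  · rw [hd p hp q hq, hd q hq r hr, hd p hp r hr]
    exact J_triangle (memE1_of_memF (mapL_mem_setF (hS hp)))
      (memE1_of_memF (mapL_mem_setF (hS hq))) (memE1_of_memF (mapL_mem_setF (hS hr)))

section Semigroup

variable {p : Eul} (hp : p ∈ setD) {t : ℝ} (ht : 0 ≤ t)
include hp ht

theorem flowT_eq : flowT t p = mapM (flowS t (mapL p)) := by
  have hF := flowS_mem (mapL_mem_setF hp) ht
  obtain ⟨-, -, f, g, h, e⟩ := proj_mem hF
  change mapM (proj (flowS t (mapL p))) = _
  rw [e.mapM_eq, h.mapM_relabel hF]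

theorem flowT_mem_setD : flowT t p ∈ setD := by
  rw [flowT_eq hp ht]
  exact mapM_mem_setD (flowS_mem (mapL_mem_setF hp) ht)

theorem real_period_flowT : (flowT t p).2.real (Ico 0 1) = p.2.real (Ico 0 1) := by
  obtain ⟨h1, h2⟩ := flowS_mem_energy (mapL_mem_setF hp) ht
  rw [flowT_eq hp ht, mapM_snd_real_period h1, h2, (mapL_spec hp).2.1]

theorem exists_mapL_flowT :
    ∃ f g, IsRelabeling f g ∧ LagEq (mapL (flowT t p)) (relabel (flowS t (mapL p)) f) := by
  rw [flowT_eq hp ht]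
  exact exists_mapL_mapM (flowS_mem (mapL_mem_setF hp) ht)

theorem J_mapL_flowT_eq {q : Eul} (hq : q ∈ setD) {s : ℝ} (hs : 0 ≤ s) :
    J (mapL (flowT t p)) (mapL (flowT s q)) = J (flowS t (mapL p)) (flowS s (mapL q)) := by
  obtain ⟨f, f', hf, e⟩ := exists_mapL_flowT hp ht
  obtain ⟨g, g', hg, e'⟩ := exists_mapL_flowT hq hs
  have h1 := memE1_of_memF (flowS_mem (mapL_mem_setF hp) ht)
  have h2 := memE1_of_memF (flowS_mem (mapL_mem_setF hq) hs)
  exact (J_congr h1 h2 (memE1_of_memF (mapL_mem_setF (flowT_mem_setD hp ht)))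
    (memE1_of_memF (mapL_mem_setF (flowT_mem_setD hq hs))) (J_eq_zero_of_relabel hf e)
    (J_eq_zero_of_relabel hg e')).symm

theorem flowT_add {s : ℝ} (hs : 0 ≤ s) : flowT (s + t) p = flowT s (flowT t p) := by
  have hF := mapL_mem_setF hp
  have hFt := flowS_mem hF ht
  obtain ⟨f, g, h, e⟩ := exists_mapL_flowT hp ht
  rw [flowT_eq hp (add_nonneg hs ht), flowT_eq (flowT_mem_setD hp ht) hs,
    (flowS_add hF hs ht).mapM_eq,
    (flowS_congr (mapL_mem_setF (flowT_mem_setD hp ht)) e hs).mapM_eq,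
    ← (h.flowS_relabel hFt hs).mapM_eq, h.mapM_relabel (flowS_mem hFt hs)]

end Semigroup

theorem flowT_zero {p : Eul} (hp : p ∈ setD) : flowT 0 p = p := by
  rw [flowT_eq hp le_rfl, (flowS_zero (mapL_mem_setF hp)).mapM_eq, (mapL_spec hp).2.2]

theorem flowT_continuous {t₀ : ℝ} (ht₀ : 0 ≤ t₀) {p₀ : Eul} (hp₀ : p₀ ∈ setD) {ε : ℝ}
    (hε : 0 < ε) : ∃ δ > 0, ∀ t, 0 ≤ t → |t - t₀| < δ → ∀ p ∈ setD, dist_D p p₀ < δ →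
      dist_D (flowT t p) (flowT t₀ p₀) < ε := by
  have hF₀ := mapL_mem_setF hp₀
  have hE₀ := memE1_of_memF hF₀
  obtain ⟨C, hC, H⟩ := exists_J_flowS_le (energy (mapL p₀) + 1) (t₀ + 1)
  obtain ⟨η, hη, Hη⟩ := Metric.tendsto_nhdsWithin_nhds.1 (flowS_tendsto hF₀ ht₀) (ε / 2)
    (half_pos hε)
  refine ⟨min (min 1 η) (ε / (2 * (C + 1))), by positivity, fun t ht htd p hp hpd => ?_⟩
  have hF := mapL_mem_setF hp
  rw [dist_D_eq hp hp₀] at hpd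
  have l1 := htd.trans_le ((min_le_left _ _).trans (min_le_left _ _))
  have l2 := htd.trans_le ((min_le_left _ _).trans (min_le_right _ _))
  have l3 := hpd.trans_le ((min_le_left _ _).trans (min_le_left _ _))
  have l4 := hpd.trans_le (min_le_right _ _)
  rw [dist_D_eq (flowT_mem_setD hp ht) (flowT_mem_setD hp₀ ht₀), J_mapL_flowT_eq hp ht hp₀ ht₀]
  have e1 := (abs_le.1 (abs_energy_sub_le_J (memE1_of_memF hF) hE₀)).2
  have k1 := H _ hF _ hF₀ (by linarith) (by linarith) t ⟨ht, by linarith [(abs_lt.1 l1).2]⟩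
  have k2 := J_le_normE (flowS t (mapL p₀)) (flowS t₀ (mapL p₀))
  have k3 := Hη (x := t) ht l2
  rw [Real.dist_eq, sub_zero, abs_of_nonneg (normE_nonneg _)] at k3
  have k4 := J_triangle (memE1_of_memF (flowS_mem hF ht)) (memE1_of_memF (flowS_mem hF₀ ht))
    (memE1_of_memF (flowS_mem hF₀ ht₀))
  have k5 : C * J (mapL p) (mapL p₀) ≤ ε / 2 := by
    refine (mul_le_mul_of_nonneg_left l4.le hC).trans ?_
    rw [mul_div_assoc', div_le_iff₀ (by positivity)]
    nlinarith
  linarith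

theorem exists_dist_DM_flowT_le (M T : ℝ) : ∃ C : ℝ, ∀ p ∈ setDM M, ∀ q ∈ setDM M,
    ∀ t ∈ Icc 0 T, dist_DM M (flowT t p) (flowT t q) ≤ C * dist_DM M p q := by
  obtain ⟨C, -, H⟩ := exists_J_flowS_le M T
  refine ⟨C, fun p hp q hq t ht => ?_⟩
  have hpt : flowT t p ∈ setDM M :=
    ⟨flowT_mem_setD hp.1 ht.1, (real_period_flowT hp.1 ht.1).trans_le hp.2⟩
  have hqt : flowT t q ∈ setDM M :=
    ⟨flowT_mem_setD hq.1 ht.1, (real_period_flowT hq.1 ht.1).trans_le hq.2⟩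
  rw [dist_DM_eq hpt hqt, dist_DM_eq hp hq, J_mapL_flowT_eq hp.1 ht.1 hq.1 ht.1]
  exact H _ (mapL_mem_setF hp.1) _ (mapL_mem_setF hq.1) (mapL_mem_setHM hp).2
    (mapL_mem_setHM hq).2 t ht

end
end PeriodicCH

theorem theorem5p2 :
    -- the maps of which `T_t` is composed are well defined:
    -- `S_t` (unique global solutions, which stay in `F`), `L : D → H` and `M : F → D`
    (∀ X₀ ∈ setF, ∃ X : ℝ → Lag, IsGlobalSolution X X₀ ∧ (∀ t, 0 ≤ t → X t ∈ setF) ∧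
      ∀ Z : ℝ → Lag, IsGlobalSolution Z X₀ → ∀ t, 0 ≤ t → LagEq (Z t) (X t)) ∧
    (∀ p ∈ setD, mapL p ∈ setH) ∧
    (∀ X ∈ setF, mapM X ∈ setD ∧ ∀ ξ, (mapM X).1 (X.y ξ) = X.U ξ) ∧
    -- `T_t` is a semigroup on `D`
    (∀ t, 0 ≤ t → ∀ p ∈ setD, flowT t p ∈ setD) ∧
    (∀ p ∈ setD, flowT 0 p = p) ∧
    (∀ s t, 0 ≤ s → 0 ≤ t → ∀ p ∈ setD, flowT (s + t) p = flowT s (flowT t p)) ∧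
    -- `d_D` is a metric, and the semigroup is (jointly) continuous with respect to it
    IsMetricOn setD dist_D ∧
    (∀ t₀, 0 ≤ t₀ → ∀ p₀ ∈ setD, ∀ ε > 0, ∃ δ > 0, ∀ t, 0 ≤ t → |t - t₀| < δ →
      ∀ p ∈ setD, dist_D p p₀ < δ → dist_D (flowT t p) (flowT t₀ p₀) < ε) ∧
    -- Lipschitz continuity on sets of bounded energy
    (∀ M : ℝ, 0 < M →
      IsMetricOn (setDM M) (dist_DM M) ∧
      (∀ t, 0 ≤ t → ∀ p ∈ setDM M, flowT t p ∈ setDM M) ∧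
      ∀ T : ℝ, 0 < T → ∃ C : ℝ, ∀ p ∈ setDM M, ∀ q ∈ setDM M, ∀ t ∈ Icc 0 T,
        dist_DM M (flowT t p) (flowT t q) ≤ C * dist_DM M p q) := by
  refine ⟨fun X₀ hX₀ => ?_, fun p hp => (mapL_spec hp).1,
    fun X hX => ⟨mapM_mem_setD hX, mapM_fst_y hX⟩, fun t ht p hp => flowT_mem_setD hp ht,
    fun p hp => flowT_zero hp, fun s t hs ht p hp => flowT_add hp ht hs,
    isMetricOn_of_eq_J subset_rfl fun p hp q hq => dist_D_eq hp hq,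
    fun t₀ ht₀ p₀ hp₀ ε hε => flowT_continuous ht₀ hp₀ hε, fun M _ =>
    ⟨isMetricOn_of_eq_J (fun p hp => hp.1) fun p hp q hq => dist_DM_eq hp hq,
      fun t ht p hp => ⟨flowT_mem_setD hp.1 ht, (real_period_flowT hp.1 ht).trans_le hp.2⟩,
      fun T _ => exists_dist_DM_flowT_le M T⟩⟩
  exact ⟨fun t => flowS t X₀, flowS_spec hX₀, fun t ht => flowS_mem hX₀ ht,
    fun Z hZ t ht => flowS_unique hX₀ hZ ht⟩
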